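/- Let $d_1,d_2\ge 0$, $d=d_1+d_2$, $\mathbb L=\mathbb Z_+^{d_1}\times\mathbb Z^{d_2}$ with nearest-neighbour edge set $E_{\mathbb L}$, $D=(0,\infty)^{d_1}\times\mathbb R^{d_2}$ and $\bar D=[0,\infty)^{d_1}\times\mathbb R^{d_2}$. Let $(\mu_e)_{e\in E_{\mathbb L}}$ be i.i.d. $[0,\infty)$-valued random variables on a probability space $(\Omega,\mathbb P)$ with $C_0:=\mathbb E(\mu_e)<\infty$. Let $\mathcal O_1=\{e:\mu_e>0\}$, let $\mathcal C_1$ be the infinite connected cluster of $(\mathbb L,\mathcal O_1)$ if it exists and is unique, and $\mathcal C_1=\emptyset$ otherwise, and put $D_n=n^{-1}\mathcal C_1$ and $m_n=n^{-d}\sum_{x\in\mathcal C_1}\delta_{x/n}$. Let $Y$ be the variable speed random walk on $\mathcal C_1$: a continuous time Markov chain with jump probabilities $\mu_{xy}/\mu_x$ and exponential holding times of mean $1/\mu_x$, $\mu_x=\sum_{y\sim x}\mu_{xy}$. Put $Y^n_t=n^{-1}Y_{n^2t}$ and $$\mathcal E^{(n)}(f,f)=\frac{n^{2-d}}2\sum_{x,y\in\mathcal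 C_1,\ \{x,y\}\in\mathcal O_1}(f(x/n)-f(y/n))^2\mu_{xy}.$$ For a realisation of $\mu$, a subsequential limit consists of a strictly increasing sequence $(n_k)$, a locally finite measure $m$ on $\bar D$ which is the vague limit of $(m_{n_k})$, and a continuous conservative $m$-symmetric Markov process $(\tilde X,\tilde P_x,x\in\bar D)$ such that, whenever $x_k\in D_{n_k}$ and $x_k\to x\in\bar D$, the law of $Y^{n_k}$ started from $x_k$ converges weakly to $\tilde P_x$ in $\mathbb D([0,\infty),\bar D)$ with the Skorokhod topology. Its Dirichlet form on $L^2(\bar D;m)$ is $\tilde{\mathcal E}(f,f)=\sup_{t>0}\frac1t(f-P_tf,f)_{L^2(m)}$, $P_tf(x)=\tilde E_x f(\tilde X_t)$, with domain $\tilde{\mathcal F}=\{f\in L^2(m):\tilde{\mathcal E}(f,f)<\infty\}$. Let $C_c^2(\bar D)$ be the space of compactly supported functions on $\bar D$ that are twice continuously differentiable up to the boundary. Then $\mathbb P$-almost surely, for every $f\in C_c^2(\bar D)$ and every subsequential limit, $f\in\tilde{\mathcal F}$ and $$\tilde{\mathcal E}(f,f)\le\limsup_{n\to\infty}\mathcal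 E^{(n)}(f,f)\le C_0\int_{\bar D}|\nabla f(x)|^2\,dx$$ (the second inequality holding whether or not a subsequential limit exists). In particular, let $A$ be any measurable field of symmetric matrices on $\bar D$ with $c^{-1}I\le A\le cI$ almost everywhere for some $c\ge1$, and let $\mathcal E(u,v)=\frac12\int_D\nabla u\cdot A\nabla v\,dx$ on $W^{1,2}(D)$. Then $C_c^2(\bar D)$ is a core of $(\mathcal E,W^{1,2}(D))$, and there is a deterministic constant $C\in[1,\infty)$ such that, $\mathbb P$-almost surely, every subsequential limit satisfies $C_c^2(\bar D)\subset\tilde{\mathcal F}$ and $\tilde{\mathcal E}(f,f)\le C\,\mathcal E(f,f)$ for all $f\in C_c^2(\bar D)$. -/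

import Mathlib

open MeasureTheory ProbabilityTheory Filter Topology Set
open scoped NNReal ENNReal

noncomputable section

/-! ### Càdlàg paths and the Skorokhod topology -/

/-- The space `D([0,∞), E)` of right-continuous paths with left limits. -/
structure CadlagPath (E : Type*) [TopologicalSpace E] where
  toFun : ℝ≥0 → E
  right_cts : ∀ t, ContinuousWithinAt toFun (Ici t) t
  left_lim : ∀ t, ∃ l, Tendsto toFun (𝓝[<] t) (𝓝 l)

namespace CadlagPath

instance instFunLike (E : Type*) [TopologicalSpace E] :
    CoeFun (CadlagPath E) (fun _ => ℝ≥0 → E) := ⟨CadlagPath.toFun⟩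

/-- The constant path. -/
def const {E : Type*} [TopologicalSpace E] (z : E) : CadlagPath E where
  toFun := fun _ => z
  right_cts := fun _ => continuousWithinAt_const
  left_lim := fun _ => ⟨z, tendsto_const_nhds⟩

/-- Basic Skorokhod (`J₁`) neighbourhood of `p`: the paths which, up to time `T`, are uniformly
`ε`-close to `p` after a time change that is itself `ε`-close to the identity. -/
def skorokhodNhd {E : Type*} [PseudoMetricSpace E] (p : CadlagPath E) (T : ℝ≥0) (ε : ℝ) :
    Set (CadlagPath E) :=
  {q | ∃ γ : ℝ≥0 ≃o ℝ≥0, ∀ t ≤ T, dist (γ t) t < ε ∧ dist (q t) (p (γ t)) < ε}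

theorem skorokhodNhd_mono {E : Type*} [PseudoMetricSpace E] (p : CadlagPath E)
    {T T' : ℝ≥0} {ε ε' : ℝ} (hT : T' ≤ T) (hε : ε ≤ ε') :
    skorokhodNhd p T ε ⊆ skorokhodNhd p T' ε' := by
  rintro q ⟨γ, hγ⟩
  exact ⟨γ, fun t ht => ⟨(hγ t (ht.trans hT)).1.trans_le hε, (hγ t (ht.trans hT)).2.trans_le hε⟩⟩

/-- The Skorokhod `J₁` topology on `D([0,∞), E)`. -/
instance instTopologicalSpace (E : Type*) [PseudoMetricSpace E] :
    TopologicalSpace (CadlagPath E) where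
  IsOpen U := ∀ p ∈ U, ∃ T : ℝ≥0, ∃ ε : ℝ, 0 < ε ∧ skorokhodNhd p T ε ⊆ U
  isOpen_univ := fun _ _ => ⟨0, 1, one_pos, subset_univ _⟩
  isOpen_inter := by
    intro U V hU hV p hp
    obtain ⟨T, ε, hε, h⟩ := hU p hp.1
    obtain ⟨T', ε', hε', h'⟩ := hV p hp.2
    exact ⟨max T T', min ε ε', lt_min hε hε', subset_inter
      ((skorokhodNhd_mono p (le_max_left _ _) (min_le_left _ _)).trans h)
      ((skorokhodNhd_mono p (le_max_right _ _) (min_le_right _ _)).trans h')⟩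
  isOpen_sUnion := by
    intro S hS p hp
    obtain ⟨U, hU, hpU⟩ := hp
    obtain ⟨T, ε, hε, h⟩ := hS U hU p hpU
    exact ⟨T, ε, hε, h.trans (subset_sUnion_of_mem hU)⟩

/-- The σ-algebra generated by the coordinate maps. -/
instance instMeasurableSpace (E : Type*) [TopologicalSpace E] [MeasurableSpace E] :
    MeasurableSpace (CadlagPath E) :=
  MeasurableSpace.comap CadlagPath.toFun inferInstance

/-- The σ-algebra generated by the coordinates up to time `s`. -/
abbrev past (E : Type*) [TopologicalSpace E] [MeasurableSpace E] (s : ℝ≥0) :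
    MeasurableSpace (CadlagPath E) :=
  ⨆ u : Set.Iic s, MeasurableSpace.comap (fun p : CadlagPath E => p u) inferInstance

/-- Weak convergence of measures on `D([0,∞), E)` with the Skorokhod topology. (For separable `E`
continuous functionals are automatically measurable for the coordinate σ-algebra.) -/
def WeakConv {E : Type*} [PseudoMetricSpace E] [MeasurableSpace E]
    (P : ℕ → Measure (CadlagPath E)) (Q : Measure (CadlagPath E)) : Prop :=
  ∀ F : CadlagPath E → ℝ, Continuous F → Measurable F → (∃ B, ∀ p, |F p| ≤ B) →
    Tendsto (fun k => ∫ p, F p ∂(P k)) atTop (𝓝 (∫ p, F p ∂Q))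

end CadlagPath

/-! ### The lattice, the domain and the cluster -/

/-- `ℤ₊^{d₁} × ℤ^{d₂}`. -/
abbrev OrthLat (d₁ d₂ : ℕ) : Type := {x : Fin d₁ ⊕ Fin d₂ → ℤ // ∀ i, 0 ≤ x (Sum.inl i)}

/-- `ℝ^d`, `d = d₁ + d₂`, with the Euclidean norm. -/
abbrev Euc (d₁ d₂ : ℕ) : Type := EuclideanSpace ℝ (Fin d₁ ⊕ Fin d₂)

/-- `D = (0,∞)^{d₁} × ℝ^{d₂}`. -/
def openDom (d₁ d₂ : ℕ) : Set (Euc d₁ d₂) := {x | ∀ i, 0 < x (Sum.inl i)}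

/-- `D̄ = [0,∞)^{d₁} × ℝ^{d₂}`. -/
def closedDom (d₁ d₂ : ℕ) : Set (Euc d₁ d₂) := {x | ∀ i, 0 ≤ x (Sum.inl i)}

/-- `D̄` as a space. -/
abbrev Dbar (d₁ d₂ : ℕ) : Type := closedDom d₁ d₂

/-- The nearest-neighbour graph: `x ~ y` iff `|x - y| = 1`. -/
def latGraph (d₁ d₂ : ℕ) : SimpleGraph (OrthLat d₁ d₂) where
  Adj x y := ∑ i, (x.1 i - y.1 i) ^ 2 = 1
  symm := by
    constructor
    intro x y h
    rw [← h]
    exact Finset.sum_congr rfl fun i _ => by ring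
  loopless := ⟨fun x h => by simp at h⟩

/-- A realisation of the conductances. -/
abbrev Env (d₁ d₂ : ℕ) : Type := (latGraph d₁ d₂).edgeSet → ℝ≥0

variable {d₁ d₂ : ℕ}

open Classical in
/-- `μ_{xy}`, which is `0` unless `x ~ y`. -/
def conduct (w : Env d₁ d₂) (x y : OrthLat d₁ d₂) : ℝ≥0 :=
  if h : (latGraph d₁ d₂).Adj x y then w ⟨s(x, y), h⟩ else 0

/-- `μ_x = ∑_{y ~ x} μ_{xy}`. -/
def vertexWeight (w : Env d₁ d₂) (x : OrthLat d₁ d₂) : ℝ≥0∞ := ∑' y, (conduct w x y : ℝ≥0∞)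

theorem finite_nbrs (x : OrthLat d₁ d₂) : {y | (latGraph d₁ d₂).Adj x y}.Finite := by
  refine Set.Finite.of_finite_image (f := Subtype.val) ?_ Subtype.val_injective.injOn
  refine (Set.finite_Icc (x.1 - 1) (x.1 + 1)).subset ?_
  rintro _ ⟨y, hy, rfl⟩
  have h : ∀ i, (x.1 i - y.1 i) ^ 2 ≤ 1 := fun i => by
    have hy' : ∑ i, (x.1 i - y.1 i) ^ 2 = 1 := hy
    rw [← hy']
    exact Finset.single_le_sum (f := fun i => (x.1 i - y.1 i) ^ 2)
      (fun i _ => sq_nonneg _) (Finset.mem_univ i)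
  have h' : ∀ i, |x.1 i - y.1 i| ≤ 1 := fun i => by
    have := h i
    exact (sq_le_one_iff_abs_le_one _).1 this
  constructor <;> intro i <;> have := abs_le.1 (h' i) <;> simp <;> omega

theorem vertexWeight_ne_top (w : Env d₁ d₂) (x : OrthLat d₁ d₂) : vertexWeight w x ≠ ⊤ := by
  rw [vertexWeight, tsum_eq_sum (s := (finite_nbrs x).toFinset)]
  · exact ENNReal.sum_ne_top.2 fun y _ => ENNReal.coe_ne_top
  · intro y hy
    have : ¬ (latGraph d₁ d₂).Adj x y := by simpa using hy
    simp [conduct, this]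

/-- The graph of open edges, `𝒪₁ = {e : μ_e > 0}`. -/
def openGraph (w : Env d₁ d₂) : SimpleGraph (OrthLat d₁ d₂) where
  Adj x y := ∃ h : (latGraph d₁ d₂).Adj x y, 0 < w ⟨s(x, y), h⟩
  symm := by
    constructor
    rintro x y ⟨h, hw⟩
    refine ⟨h.symm, ?_⟩
    have : (⟨s(y, x), h.symm⟩ : (latGraph d₁ d₂).edgeSet) = ⟨s(x, y), h⟩ :=
      Subtype.ext Sym2.eq_swap
    rwa [this]
  loopless := ⟨fun x h => (latGraph d₁ d₂).loopless.irrefl x h.1⟩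

/-- `𝒞₁`: the infinite open cluster if there is exactly one, and `∅` otherwise. -/
def cluster (w : Env d₁ d₂) : Set (OrthLat d₁ d₂) :=
  {x | (∃! c : (openGraph w).ConnectedComponent, c.supp.Infinite) ∧
    ((openGraph w).connectedComponentMk x).supp.Infinite}

/-- The point `x / n` of `D̄`. -/
def scaledPt (n : ℕ) (x : OrthLat d₁ d₂) : Dbar d₁ d₂ :=
  ⟨WithLp.toLp 2 fun i => (x.1 i : ℝ) / n,
    fun i => div_nonneg (Int.cast_nonneg (x.2 i)) (Nat.cast_nonneg n)⟩

/-- `m_n = n^{-d} ν(n ·)`, `ν` the counting measure on `𝒞₁`. -/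
def scaledMeasure (w : Env d₁ d₂) (n : ℕ) : Measure (Dbar d₁ d₂) :=
  ((n : ℝ≥0∞) ^ (d₁ + d₂))⁻¹ • Measure.sum fun x : cluster w => Measure.dirac (scaledPt n x.1)

open Classical in
/-- `ℰ^{(n)}(f,f) = (n^{2-d}/2) ∑_{x,y ∈ 𝒞₁, {x,y} ∈ 𝒪₁} (f(x/n) - f(y/n))² μ_{xy}`. -/
def discreteEnergy (w : Env d₁ d₂) (n : ℕ) (f : Dbar d₁ d₂ → ℝ) : ℝ≥0∞ :=
  ENNReal.ofReal ((n : ℝ) ^ (2 - ((d₁ + d₂ : ℕ) : ℤ)) / 2) *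
    ∑' x : OrthLat d₁ d₂, ∑' y : OrthLat d₁ d₂,
      if x ∈ cluster w ∧ y ∈ cluster w ∧ (openGraph w).Adj x y then
        ENNReal.ofReal ((f (scaledPt n x) - f (scaledPt n y)) ^ 2) * conduct w x y
      else 0

/-! ### The variable speed random walk

A trajectory is the sequence of successive positions and holding times. -/

open Classical in
/-- Law of the next position: `y` with probability `μ_{xy} / μ_x` (a vertex without open edge is
absorbing). -/
def jumpLaw (w : Env d₁ d₂) (x : OrthLat d₁ d₂) : Measure (OrthLat d₁ d₂) :=
  if h : vertexWeight w x = 0 then Measure.dirac x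
  else (PMF.normalize (fun y => (conduct w x y : ℝ≥0∞)) h (vertexWeight_ne_top w x)).toMeasure

instance instProbJump (w : Env d₁ d₂) (x : OrthLat d₁ d₂) : IsProbabilityMeasure (jumpLaw w x) := by
  unfold jumpLaw
  split_ifs <;> infer_instance

open Classical in
/-- Law of the holding time at `x`: exponential with mean `1 / μ_x` (at an absorbing vertex the
walk jumps to `x` itself, so the value is immaterial there). -/
def holdLaw (w : Env d₁ d₂) (x : OrthLat d₁ d₂) : Measure ℝ :=
  if vertexWeight w x = 0 then expMeasure 1 else expMeasure (vertexWeight w x).toReal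

instance instProbHold (w : Env d₁ d₂) (x : OrthLat d₁ d₂) : IsProbabilityMeasure (holdLaw w x) := by
  unfold holdLaw
  split_ifs with h
  · exact isProbabilityMeasure_expMeasure one_pos
  · exact isProbabilityMeasure_expMeasure (ENNReal.toReal_pos h (vertexWeight_ne_top w x))

/-- A position together with its holding time, given the position. -/
def stayKernel (w : Env d₁ d₂) : Kernel (OrthLat d₁ d₂) (OrthLat d₁ d₂ × ℝ) :=
  Kernel.ofFunOfCountable fun x => (Measure.dirac x).prod (holdLaw w x)

instance instMarkovStay (w : Env d₁ d₂) : IsMarkovKernel (stayKernel w) :=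
  ⟨fun x => by
    change IsProbabilityMeasure ((Measure.dirac x).prod (holdLaw w x))
    infer_instance⟩

/-- The jump kernel of the embedded chain. -/
def jumpKernel (w : Env d₁ d₂) : Kernel (OrthLat d₁ d₂) (OrthLat d₁ d₂) :=
  Kernel.ofFunOfCountable (jumpLaw w)

instance instMarkovJump (w : Env d₁ d₂) : IsMarkovKernel (jumpKernel w) :=
  ⟨fun x => instProbJump w x⟩

/-- One step of the trajectory: jump from the current position, then draw the holding time at the
new position. -/
def stepKernel (w : Env d₁ d₂) (n : ℕ) :
    Kernel (Finset.Iic n → OrthLat d₁ d₂ × ℝ) (OrthLat d₁ d₂ × ℝ) :=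
  (stayKernel w ∘ₖ jumpKernel w).comap (fun h => (h ⟨n, Finset.mem_Iic.2 le_rfl⟩).1)
    (measurable_fst.comp (measurable_pi_apply _))

instance instMarkovStep (w : Env d₁ d₂) (n : ℕ) : IsMarkovKernel (stepKernel w n) := by
  unfold stepKernel
  infer_instance

/-- Law of the trajectory of the walk started from `x`. -/
def trajLaw (w : Env d₁ d₂) (x : OrthLat d₁ d₂) : Measure (ℕ → OrthLat d₁ d₂ × ℝ) :=
  Kernel.trajMeasure (X := fun _ => OrthLat d₁ d₂ × ℝ) (stayKernel w x) (stepKernel w)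

/-- The time of the `k`-th jump. -/
def jumpTime (h : ℕ → OrthLat d₁ d₂ × ℝ) (k : ℕ) : ℝ := ∑ i ∈ Finset.range k, (h i).2

/-- Holding times are positive and the jump times tend to infinity (no explosion). -/
def NonExplosive (h : ℕ → OrthLat d₁ d₂ × ℝ) : Prop :=
  (∀ k, 0 < (h k).2) ∧ Tendsto (jumpTime h) atTop atTop

/-- The number of jumps up to time `s`, so that `jumpTime k ≤ s < jumpTime (k + 1)`. -/
def jumpCount (h : ℕ → OrthLat d₁ d₂ × ℝ) (s : ℝ) : ℕ := sInf {k | s < jumpTime h (k + 1)}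

/-- `Y_s`. -/
def walkAt (h : ℕ → OrthLat d₁ d₂ × ℝ) (s : ℝ) : OrthLat d₁ d₂ := (h (jumpCount h s)).1

theorem NonExplosive.jumpTime_mono {h : ℕ → OrthLat d₁ d₂ × ℝ} (hh : NonExplosive h) :
    Monotone (jumpTime h) :=
  monotone_nat_of_le_succ fun k => by
    simp only [jumpTime, Finset.sum_range_succ]
    linarith [hh.1 k]

theorem NonExplosive.exists_lt {h : ℕ → OrthLat d₁ d₂ × ℝ} (hh : NonExplosive h) (s : ℝ) :
    ∃ k, s < jumpTime h (k + 1) :=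
  (((tendsto_add_atTop_iff_nat 1).2 hh.2).eventually_gt_atTop s).exists

theorem NonExplosive.right_const {h : ℕ → OrthLat d₁ d₂ × ℝ} (hh : NonExplosive h) (s : ℝ) :
    ∃ u, s < u ∧ ∀ r, s ≤ r → r < u → jumpCount h r = jumpCount h s := by
  have hk : s < jumpTime h (jumpCount h s + 1) := Nat.sInf_mem (hh.exists_lt s)
  refine ⟨_, hk, fun r h1 h2 => le_antisymm (Nat.sInf_le h2) ?_⟩
  exact Nat.sInf_le (h1.trans_lt (Nat.sInf_mem (hh.exists_lt r)))

theorem NonExplosive.left_const {h : ℕ → OrthLat d₁ d₂ × ℝ} (hh : NonExplosive h) {s : ℝ}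
    (hs : 0 < s) : ∃ u, u < s ∧ ∃ j, ∀ r, u < r → r < s → jumpCount h r = j := by
  have hne : ∃ k, s ≤ jumpTime h (k + 1) := (hh.exists_lt s).imp fun _ => le_of_lt
  classical
  refine ⟨jumpTime h (Nat.find hne), ?_, Nat.find hne, fun r h1 h2 => ?_⟩
  · rcases hj : Nat.find hne with _ | i
    · simpa [jumpTime] using hs
    · exact not_le.1 (Nat.find_min hne (m := i) (by omega))
  · refine le_antisymm (Nat.sInf_le (h2.trans_le (Nat.find_spec hne))) ?_
    by_contra hlt
    have hr : r < jumpTime h (jumpCount h r + 1) := Nat.sInf_mem (hh.exists_lt r)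
    have := hh.jumpTime_mono (Nat.succ_le_of_lt (not_le.1 hlt))
    exact absurd (hr.trans_le this) (not_lt.2 h1.le)

/-- The path of `Y^n_t = n⁻¹ Y_{n² t}`, for a non-explosive trajectory. -/
def scaledPathOf (n : ℕ) (h : ℕ → OrthLat d₁ d₂ × ℝ) (hh : NonExplosive h) :
    CadlagPath (Dbar d₁ d₂) where
  toFun t := scaledPt n (walkAt h ((n : ℝ) ^ 2 * t))
  right_cts := by
    intro t
    obtain ⟨u, hu, hc⟩ := hh.right_const ((n : ℝ) ^ 2 * t)
    have hcts : Continuous fun r : ℝ≥0 => (n : ℝ) ^ 2 * r := by fun_prop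
    refine ContinuousWithinAt.congr_of_eventuallyEq (continuousWithinAt_const
      (b := scaledPt n (walkAt h ((n : ℝ) ^ 2 * t)))) ?_ rfl
    filter_upwards [self_mem_nhdsWithin, mem_nhdsWithin_of_mem_nhds
      (hcts.continuousAt.eventually_lt continuousAt_const hu)] with r h1 h2
    have h1' : (t : ℝ) ≤ r := NNReal.coe_le_coe.2 h1
    simp only [walkAt, hc _ (mul_le_mul_of_nonneg_left h1' (by positivity)) h2]
  left_lim := by
    intro t
    have hcts : Continuous fun r : ℝ≥0 => (n : ℝ) ^ 2 * r := by fun_prop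
    rcases (show (0 : ℝ) ≤ (n : ℝ) ^ 2 by positivity).eq_or_lt with hn | hn
    · refine ⟨scaledPt n (walkAt h 0), ?_⟩
      simp only [← hn, zero_mul]
      exact tendsto_const_nhds
    rcases eq_or_ne t 0 with rfl | ht
    · refine ⟨scaledPt n (walkAt h 0), ?_⟩
      simp
    have ht' : (0 : ℝ) < t := NNReal.coe_pos.2 (pos_iff_ne_zero.2 ht)
    obtain ⟨u, hu, j, hj⟩ := hh.left_const (mul_pos hn ht')
    refine ⟨scaledPt n (h j).1, tendsto_const_nhds.congr' ?_⟩
    filter_upwards [self_mem_nhdsWithin, mem_nhdsWithin_of_mem_nhds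
      (continuousAt_const.eventually_lt hcts.continuousAt hu)] with r h1 h2
    have h1' : (r : ℝ) < t := NNReal.coe_lt_coe.2 h1
    simp only [walkAt, hj _ h2 (mul_lt_mul_of_pos_left h1' hn)]

open Classical in
/-- `scaledPathOf` as a total function; the value at an explosive trajectory is never used. -/
def scaledPath (n : ℕ) (h : ℕ → OrthLat d₁ d₂ × ℝ) : CadlagPath (Dbar d₁ d₂) :=
  if hh : NonExplosive h then scaledPathOf n h hh else CadlagPath.const ⟨0, fun _ => le_rfl⟩

/-- The quenched law on `D([0,∞), D̄)` of `Y^n` started from `x / n`. Explosive trajectories are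
discarded, so this is a probability measure exactly when the walk is conservative. -/
def scaledWalkLaw (w : Env d₁ d₂) (n : ℕ) (x : OrthLat d₁ d₂) : Measure (CadlagPath (Dbar d₁ d₂)) :=
  ((trajLaw w x).restrict {h | NonExplosive h}).map (scaledPath n)

/-! ### Symmetric diffusions on `D̄` and their Dirichlet forms -/

/-- `P_t f(x) = E_x f(X_t)`. -/
def semigroup (X : Kernel (Dbar d₁ d₂) (CadlagPath (Dbar d₁ d₂))) (t : ℝ≥0)
    (f : Dbar d₁ d₂ → ℝ) (x : Dbar d₁ d₂) : ℝ := ∫ p, f (p t) ∂(X x)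

/-- `X` is (the family of laws of) a continuous conservative `m`-symmetric Markov process. -/
structure IsSymmetricDiffusion (m : Measure (Dbar d₁ d₂))
    (X : Kernel (Dbar d₁ d₂) (CadlagPath (Dbar d₁ d₂))) : Prop where
  conservative : IsMarkovKernel X
  start : ∀ x, ∀ᵐ p ∂(X x), p 0 = x
  continuous : ∀ x, ∀ᵐ p ∂(X x), Continuous p.toFun
  markov : ∀ (x : Dbar d₁ d₂) (s t : ℝ≥0) (S : Set (CadlagPath (Dbar d₁ d₂))),
    MeasurableSet[CadlagPath.past (Dbar d₁ d₂) s] S →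
    ∀ B : Set (Dbar d₁ d₂), MeasurableSet B →
      X x (S ∩ {p | p (s + t) ∈ B}) = ∫⁻ p in S, X (p s) {q | q t ∈ B} ∂(X x)
  symmetric : ∀ (t : ℝ≥0) (f g : Dbar d₁ d₂ → ℝ≥0∞), Measurable f → Measurable g →
    ∫⁻ x, f x * ∫⁻ p, g (p t) ∂(X x) ∂m = ∫⁻ x, g x * ∫⁻ p, f (p t) ∂(X x) ∂m

/-- `ℰ̃(f,f) = sup_{t>0} t⁻¹ (f - P_t f, f)`, the inner product being that of `L²(D̄; m)`. -/
def limitEnergy (m : Measure (Dbar d₁ d₂)) (X : Kernel (Dbar d₁ d₂) (CadlagPath (Dbar d₁ d₂)))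
    (f : Dbar d₁ d₂ → ℝ) : ℝ≥0∞ :=
  ⨆ t : {t : ℝ≥0 // 0 < t},
    ENNReal.ofReal ((t.1 : ℝ)⁻¹ * ∫ x, (f x - semigroup X t.1 f x) * f x ∂m)

/-- The domain `ℱ̃` of the Dirichlet form of `X` on `L²(D̄; m)`. -/
def limitDomain (m : Measure (Dbar d₁ d₂)) (X : Kernel (Dbar d₁ d₂) (CadlagPath (Dbar d₁ d₂))) :
    Set (Dbar d₁ d₂ → ℝ) :=
  {f | MemLp f 2 m ∧ limitEnergy m X f < ⊤}

/-- Vague convergence of measures on `D̄`. -/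
def VagueConv (ν : ℕ → Measure (Dbar d₁ d₂)) (m : Measure (Dbar d₁ d₂)) : Prop :=
  ∀ g : Dbar d₁ d₂ → ℝ, Continuous g → HasCompactSupport g →
    Tendsto (fun k => ∫ x, g x ∂(ν k)) atTop (𝓝 (∫ x, g x ∂m))

/-- `X`, with symmetrizing measure `m`, is the limit of the rescaled walks in the environment `w`
along the subsequence `φ`: `m` is the vague limit of the invariant measures `m_{φ k}`, and the laws
of `Y^{φ k}` started from `x_k ∈ D_{φ k}` converge weakly to `X z` whenever `x_k → z`. -/
structure IsSubseqLimit (w : Env d₁ d₂) (φ : ℕ → ℕ) (m : Measure (Dbar d₁ d₂))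
    (X : Kernel (Dbar d₁ d₂) (CadlagPath (Dbar d₁ d₂))) : Prop where
  strictMono : StrictMono φ
  locallyFinite : IsLocallyFiniteMeasure m
  vague : VagueConv (fun k => scaledMeasure w (φ k)) m
  diffusion : IsSymmetricDiffusion m X
  weak : ∀ (x : ℕ → OrthLat d₁ d₂) (z : Dbar d₁ d₂), (∀ k, x k ∈ cluster w) →
    Tendsto (fun k => scaledPt (φ k) (x k)) atTop (𝓝 z) →
    CadlagPath.WeakConv (fun k => scaledWalkLaw w (φ k) (x k)) (X z)

/-! ### Function spaces on `D̄` and the reference Dirichlet form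

Functions on `D̄` are represented by functions on `ℝ^d`, whose values off `D̄` play no role. -/

/-- Vanishing off a bounded subset of `D̄`. -/
def CompactSuppOn (f : Euc d₁ d₂ → ℝ) : Prop := ∃ R : ℝ, ∀ x ∈ closedDom d₁ d₂, R < ‖x‖ → f x = 0

/-- `C_c²(D̄)`. -/
def Cc2 (d₁ d₂ : ℕ) : Set (Euc d₁ d₂ → ℝ) :=
  {f | ContDiffOn ℝ 2 f (closedDom d₁ d₂) ∧ CompactSuppOn f}

/-- Restriction to `D̄`. -/
def toDbar (f : Euc d₁ d₂ → ℝ) : Dbar d₁ d₂ → ℝ := fun x => f x.1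

/-- `∫_{D̄} |∇f|² dx`. -/
def gradEnergy (f : Euc d₁ d₂ → ℝ) : ℝ≥0∞ :=
  ∫⁻ x in closedDom d₁ d₂, ‖fderivWithin ℝ f (closedDom d₁ d₂) x‖ₑ ^ 2

/-- `G` is a square-integrable weak gradient of `u` on `D`. -/
def IsWeakGrad (u : Euc d₁ d₂ → ℝ) (G : Euc d₁ d₂ → Euc d₁ d₂) : Prop :=
  MemLp G 2 (volume.restrict (openDom d₁ d₂)) ∧
  ∀ ψ : Euc d₁ d₂ → ℝ, ContDiff ℝ ((⊤ : ℕ∞) : WithTop ℕ∞) ψ → HasCompactSupport ψ → tsupport ψ ⊆ openDom d₁ d₂ →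
    ∀ v : Euc d₁ d₂, ∫ x in openDom d₁ d₂, u x * fderiv ℝ ψ x v =
      -∫ x in openDom d₁ d₂, inner ℝ (G x) v * ψ x

/-- `W^{1,2}(D)`. -/
def W12 (d₁ d₂ : ℕ) : Set (Euc d₁ d₂ → ℝ) :=
  {u | MemLp u 2 (volume.restrict (openDom d₁ d₂)) ∧ ∃ G, IsWeakGrad u G}

open Classical in
/-- The weak gradient (unique up to a null set). -/
def weakGrad (u : Euc d₁ d₂ → ℝ) : Euc d₁ d₂ → Euc d₁ d₂ :=
  if h : ∃ G, IsWeakGrad u G then h.choose else 0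

/-- A measurable field of symmetric matrices with `c⁻¹ I ≤ A(x) ≤ c I` for a.e. `x ∈ D̄`. -/
def IsElliptic (A : Euc d₁ d₂ → Matrix (Fin d₁ ⊕ Fin d₂) (Fin d₁ ⊕ Fin d₂) ℝ) : Prop :=
  (∀ i j, Measurable fun x => A x i j) ∧ (∀ x, (A x).IsSymm) ∧
  ∃ c : ℝ, 1 ≤ c ∧ ∀ᵐ x ∂(volume.restrict (closedDom d₁ d₂)), ∀ ξ : Fin d₁ ⊕ Fin d₂ → ℝ,
    c⁻¹ * (ξ ⬝ᵥ ξ) ≤ ξ ⬝ᵥ (A x).mulVec ξ ∧ ξ ⬝ᵥ (A x).mulVec ξ ≤ c * (ξ ⬝ᵥ ξ)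

/-- `ℰ(u,v) = ½ ∫_D ∇u · A ∇v dx` on `W^{1,2}(D)`. -/
def refForm (A : Euc d₁ d₂ → Matrix (Fin d₁ ⊕ Fin d₂) (Fin d₁ ⊕ Fin d₂) ℝ)
    (u v : Euc d₁ d₂ → ℝ) : ℝ :=
  (1 / 2) * ∫ x in openDom d₁ d₂, (weakGrad u x).ofLp ⬝ᵥ (A x).mulVec (weakGrad v x).ofLp

/-- `𝒞` is a core of the regular Dirichlet form `(ℰ, W^{1,2}(D))` on `L²(D̄)`: a subset of
`W^{1,2}(D) ∩ C_c(D̄)`, dense in `W^{1,2}(D)` for `ℰ₁ = ℰ + (·,·)` and in `C_c(D̄)` uniformly. -/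
structure IsCore (A : Euc d₁ d₂ → Matrix (Fin d₁ ⊕ Fin d₂) (Fin d₁ ⊕ Fin d₂) ℝ)
    (𝒞 : Set (Euc d₁ d₂ → ℝ)) : Prop where
  subset : ∀ f ∈ 𝒞, f ∈ W12 d₁ d₂ ∧ ContinuousOn f (closedDom d₁ d₂) ∧ CompactSuppOn f
  dense_form : ∀ u ∈ W12 d₁ d₂, ∀ ε > 0, ∃ f ∈ 𝒞,
    refForm A (u - f) (u - f) + ∫ x in openDom d₁ d₂, (u x - f x) ^ 2 < ε
  dense_unif : ∀ g : Euc d₁ d₂ → ℝ, ContinuousOn g (closedDom d₁ d₂) → CompactSuppOn g →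
    ∀ ε > 0, ∃ f ∈ 𝒞, ∀ x ∈ closedDom d₁ d₂, |g x - f x| < ε

end

/-! ### Vague convergence and continuously converging functions -/

section VagueConvergence

variable {E : Type*} [MetricSpace E] [LocallyCompactSpace E] [MeasurableSpace E] [BorelSpace E]

/-! The comparison with the discrete energies is deterministic and runs through resolvents. Write
a(t) = (f - P_t f, f) for the limit process. Symmetry and the semigroup law make (f, P_t f) midpoint
convex in t, so a is concave with a(0) = 0 and a(t)/t is nonincreasing. Hence every a(t)/t is at
most a bound valid for all the resolvent quantities r(f - rG_r f, f), r > 0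
(`IsSymmetricDiffusion.limitEnergy_le_of_resolvent`). Here rG_r f(x) is the mean of f at an
independent exponential time of rate r.

Resolvents help twice. The exponential average of f along a path is a Skorokhod continuous
functional (`CadlagPath.continuous_expAverage`), whereas evaluation at a fixed time is not. And for
the walk rG_r f is an explicit series over the jumps, s ∑ (D⁻¹C)ᵏ D⁻¹ g, with C the conductance
matrix, D = μ_x + s and s = r/n². Positivity of D ± C then gives r(f - rG_r f, f) ≤ ℰ^{(n)}(f, f) by
algebra on finite sums (`neumann_series_energy`, `ofReal_resolvent_form_le_discreteEnergy`), without
any generator domain and without proving that the walk does not explode. The series describes the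
walk up to explosion, and the mass lost there vanishes in the limit because the limit laws are
probabilities.

To pass to the limit, weak convergence from every sequence of starting points gives continuous
convergence of the resolvents. Combined with vague convergence of the measures this yields
convergence of ∫ f · rG_r f (`tendsto_integral_mul_of_continuous_convergence`), hence ℰ̃(f, f) ≤
limsup ℰ^{(n)}(f, f).

For the upper bound on the limsup the cluster constraint is dropped. What remains is a sum over
lattice edges of squared difference quotients, uniformly close to squared partial derivatives of f,
weighted by n^{-d} μ_e. A law of large numbers holding simultaneously for all uniformly continuous
weights of bounded support (`ae_tendsto_weighted_sum`), obtained from countably many grid cells,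
replaces μ_e by C₀, and a Riemann sum gives C₀ ∫ |∇f|². No percolation input is used.

For the core, functions of W^{1,2}(D) are cut off and mollified by a kernel supported in -D: at
points of D̄ the convolution then only sees values inside D, so zero extension creates no boundary
term (`gradDom_convolution`). Ellipticity finally turns ∫ |∇f|² into ℰ(f, f). -/

theorem exists_seq_tendsto_of_mem_support {ν : ℕ → Measure E} {m : Measure E}
    [IsLocallyFiniteMeasure m] {A : ℕ → Set E} (hA : ∀ k, ∀ᵐ y ∂(ν k), y ∈ A k)
    (hvague : ∀ g : E → ℝ, Continuous g → HasCompactSupport g →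
      Tendsto (fun k => ∫ y, g y ∂(ν k)) atTop (𝓝 (∫ y, g y ∂m)))
    {z : E} (hz : z ∈ m.support) :
    ∃ y : ℕ → E, (∀ᶠ k in atTop, y k ∈ A k) ∧ Tendsto y atTop (𝓝 z) := by
  -- A bump at z has positive m-integral because z is in the support. By vague convergence its ν
  -- k-integral is eventually positive, so A k, which carries ν k, must meet the ball.
  have hnear : ∀ r > 0, ∀ᶠ k in atTop, ∃ y ∈ A k, dist y z < r := by
    intro r hr
    obtain ⟨χ, h1, h0, hc, h01⟩ := exists_continuous_one_zero_of_isCompact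
      (isCompact_singleton (x := z)) (Metric.isOpen_ball (x := z) (ε := r)).isClosed_compl
      (by simpa using hr)
    have hpos : 0 < ∫ y, χ y ∂m := by
      rw [integral_pos_iff_support_of_nonneg (fun y => (h01 y).1)
        (χ.continuous.integrable_of_hasCompactSupport hc)]
      refine (Measure.mem_support_iff_forall z).1 hz _
        (χ.continuous.isOpen_support.mem_nhds ?_)
      have : χ z = 1 := h1 rfl
      simp [this]
    filter_upwards [(hvague χ χ.continuous hc).eventually_const_lt hpos] with k hk
    by_contra! hcon
    refine hk.ne' (integral_eq_zero_of_ae ?_)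
    filter_upwards [hA k] with y hy
    exact h0 (by simpa using hcon y hy)
  have hch : ∀ k, ∃ y, (A k).Nonempty → y ∈ A k ∧ dist z y < Metric.infDist z (A k) + 1 / (k + 1) := by
    intro k
    by_cases hk : (A k).Nonempty
    · obtain ⟨y, hy, hd⟩ := (Metric.infDist_lt_iff hk).1
        (show Metric.infDist z (A k) < Metric.infDist z (A k) + 1 / ((k : ℝ) + 1) by
          linarith [Nat.one_div_pos_of_nat (α := ℝ) (n := k)])
      exact ⟨y, fun _ => ⟨hy, hd⟩⟩
    · exact ⟨z, fun h => absurd h hk⟩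
  choose y hy using hch
  refine ⟨y, ?_, ?_⟩
  · filter_upwards [hnear 1 one_pos] with k ⟨a, ha, _⟩
    exact (hy k ⟨a, ha⟩).1
  · rw [Metric.tendsto_nhds]
    intro ε hε
    filter_upwards [hnear (ε / 2) (half_pos hε),
      (tendsto_one_div_add_atTop_nhds_zero_nat (𝕜 := ℝ)).eventually_lt_const (half_pos hε)]
      with k ⟨a, ha, had⟩ hk
    have := (hy k ⟨a, ha⟩).2
    have h2 := Metric.infDist_le_dist_of_mem (x := z) ha
    rw [dist_comm] at had
    rw [dist_comm]
    linarith

/-- Otherwise there are points of A k arbitrarily close to z, along a subsequence, at which the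
values stay η away from the limit. Splicing them into one convergent sequence contradicts `hconv`;
the sequence y₀ only serves to fill the indices outside the subsequence. -/
theorem locally_uniform_of_continuous_convergence {E : Type*} [MetricSpace E]
    {A : ℕ → Set E} {v : ℕ → E → ℝ} {v₀ : E → ℝ}
    (hconv : ∀ (y : ℕ → E) (z : E), (∀ᶠ k in atTop, y k ∈ A k) → Tendsto y atTop (𝓝 z) →
      Tendsto (fun k => v k (y k)) atTop (𝓝 (v₀ z)))
    {z : E} {y₀ : ℕ → E} (hy₀ : ∀ᶠ k in atTop, y₀ k ∈ A k) (hyz : Tendsto y₀ atTop (𝓝 z))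
    {η : ℝ} (hη : 0 < η) :
    ∃ r > 0, ∀ᶠ k in atTop, ∀ y ∈ A k, dist y z < r → |v k y - v₀ z| < η := by
  by_contra! hcon
  have hfreq : ∀ j : ℕ, ∃ᶠ k in atTop,
      ∃ y ∈ A k, dist y z < 1 / ((j : ℝ) + 1) ∧ η ≤ |v k y - v₀ z| := by
    intro j
    refine (hcon _ (Nat.one_div_pos_of_nat (n := j))).mono fun k hk => ?_
    obtain ⟨y, h1, h2, h3⟩ := hk
    exact ⟨y, h1, h2, h3⟩
  obtain ⟨κ, hκ, hbad⟩ := extraction_forall_of_frequently hfreq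
  choose y hyA hyd hyb using hbad
  set Y : ℕ → E := Function.extend κ y y₀ with hY
  have hYκ : ∀ j, Y (κ j) = y j := fun j => hκ.injective.extend_apply _ _ _
  have hYn : ∀ k, (∃ j, κ j = k) ∨ Y k = y₀ k := by
    intro k
    by_cases h : ∃ j, κ j = k
    · exact Or.inl h
    · exact Or.inr (Function.extend_apply' _ _ _ h)
  have hYA : ∀ᶠ k in atTop, Y k ∈ A k := by
    filter_upwards [hy₀] with k hk
    rcases hYn k with ⟨j, rfl⟩ | h
    · rw [hYκ]; exact hyA j
    · rwa [h]
  have hYz : Tendsto Y atTop (𝓝 z) := by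
    rw [Metric.tendsto_nhds]
    intro ε hε
    obtain ⟨J, hJ⟩ := exists_nat_one_div_lt hε
    filter_upwards [(Metric.tendsto_nhds.1 hyz) ε hε, eventually_ge_atTop (κ J)] with k hk hkJ
    rcases hYn k with ⟨j, rfl⟩ | h
    · rw [hYκ]
      have hj : J ≤ j := hκ.le_iff_le.1 hkJ
      exact (hyd j).trans_le ((Nat.one_div_le_one_div hj).trans hJ.le)
    · rwa [h]
  have hlim := (hconv Y z hYA hYz).comp hκ.tendsto_atTop
  rw [Metric.tendsto_atTop] at hlim
  obtain ⟨N, hN⟩ := hlim η hη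
  have := hN N le_rfl
  simp only [Function.comp, hYκ, Real.dist_eq] at this
  exact absurd this (not_lt.2 (hyb N))

/-- The v k are meaningful only on A k and v₀ only on the support of m, where no regularity of v₀ is
assumed in advance. Continuous convergence forces v₀ to be continuous on the support; a continuous
extension u can be tested against vague convergence, and v k - u is small on the part of A k near
the support inside supp f. -/
theorem tendsto_integral_mul_of_continuous_convergence [SecondCountableTopology E]
    {ν : ℕ → Measure E} [∀ k, IsLocallyFiniteMeasure (ν k)] {m : Measure E}
    [IsLocallyFiniteMeasure m] {A : ℕ → Set E} (hA : ∀ k, ∀ᵐ y ∂(ν k), y ∈ A k)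
    (hvague : ∀ g : E → ℝ, Continuous g → HasCompactSupport g →
      Tendsto (fun k => ∫ y, g y ∂(ν k)) atTop (𝓝 (∫ y, g y ∂m)))
    {v : ℕ → E → ℝ} {v₀ : E → ℝ} {B : ℝ} (hv : ∀ k y, |v k y| ≤ B)
    (hvm : ∀ k, AEStronglyMeasurable (v k) (ν k))
    (hconv : ∀ (y : ℕ → E) (z : E), (∀ᶠ k in atTop, y k ∈ A k) → Tendsto y atTop (𝓝 z) →
      Tendsto (fun k => v k (y k)) atTop (𝓝 (v₀ z)))
    {f : E → ℝ} (hf : Continuous f) (hfc : HasCompactSupport f) :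
    Tendsto (fun k => ∫ y, f y * v k y ∂(ν k)) atTop (𝓝 (∫ y, f y * v₀ y ∂m)) := by
  have hloc : ∀ z ∈ m.support, ∀ η > 0,
      ∃ r > 0, ∀ᶠ k in atTop, ∀ y ∈ A k, dist y z < r → |v k y - v₀ z| < η := by
    intro z hz η hη
    obtain ⟨y₀, h1, h2⟩ := exists_seq_tendsto_of_mem_support hA hvague hz
    exact locally_uniform_of_continuous_convergence hconv h1 h2 hη
  have hcont : ContinuousOn v₀ m.support := by
    intro z hz
    rw [ContinuousWithinAt, Metric.tendsto_nhdsWithin_nhds]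
    intro η hη
    obtain ⟨r, hr, hk⟩ := hloc z hz (η / 2) (half_pos hη)
    refine ⟨r, hr, fun {z'} hz' hd => ?_⟩
    obtain ⟨y, h1, h2⟩ := exists_seq_tendsto_of_mem_support hA hvague hz'
    have hlim := ((hconv y z' h1 h2).sub_const (v₀ z)).abs
    refine (le_of_tendsto hlim ?_).trans_lt (half_lt_self hη)
    have hball : ∀ᶠ k in atTop, dist (y k) z < r :=
      (h2.dist tendsto_const_nhds).eventually_lt_const hd
    filter_upwards [hk, h1, hball] with k a b c
    exact (a _ b c).le
  -- Tietze extension of v₀ from the closed support of m.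
  obtain ⟨u, hu⟩ := ContinuousMap.exists_restrict_eq (s := m.support) Measure.isClosed_support
    ⟨_, continuousOn_iff_continuous_domRestrict.1 hcont⟩
  have huv : ∀ z ∈ m.support, u z = v₀ z := fun z hz => by
    have := congrArg (fun g => g ⟨z, hz⟩) hu
    simpa using this
  set K := tsupport f with hK
  have hKc : IsCompact K := hfc
  obtain ⟨Cu, hCu⟩ := hKc.exists_bound_of_continuousOn u.continuous.continuousOn
  obtain ⟨Cf, hCf⟩ := hf.bounded_above_of_compact_support hfc
  have hlimu : Tendsto (fun k => ∫ y, f y * u y ∂(ν k)) atTop (𝓝 (∫ y, f y * v₀ y ∂m)) := by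
    have : ∫ y, f y * v₀ y ∂m = ∫ y, f y * u y ∂m := by
      refine integral_congr_ae ?_
      filter_upwards [Measure.support_mem_ae (μ := m)] with y hy
      rw [huv y hy]
    rw [this]
    exact hvague _ (hf.mul u.continuous) hfc.mul_right
  suffices hdiff : Tendsto (fun k => ∫ y, f y * v k y ∂(ν k) - ∫ y, f y * u y ∂(ν k)) atTop (𝓝 0) by
    simpa using hdiff.add hlimu
  have hint1 : ∀ k, Integrable (fun y => f y * v k y) (ν k) := fun k =>
    (hf.integrable_of_hasCompactSupport hfc).mul_bdd (c := B) (hvm k) (ae_of_all _ (hv k))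
  have hint2 : ∀ k, Integrable (fun y => f y * u y) (ν k) := fun k =>
    (hf.mul u.continuous).integrable_of_hasCompactSupport hfc.mul_right
  have habs : Tendsto (fun k => ∫ y, |f y| ∂(ν k)) atTop (𝓝 (∫ y, |f y| ∂m)) :=
    hvague _ hf.abs (hfc.comp_left (g := fun x : ℝ => |x|) abs_zero)
  rw [Metric.tendsto_nhds]
  intro ε hε
  have hI : 0 ≤ ∫ y, |f y| ∂m := integral_nonneg fun y => abs_nonneg _
  set I := ∫ y, |f y| ∂m
  -- Chosen so that η ∫ |f| dν k ≤ ε/4 as soon as ∫ |f| dν k < I + 1.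
  set η : ℝ := ε / (4 * (I + 1)) with hηdef
  have hη : 0 < η := by positivity
  obtain ⟨U, hUo, hKU, hUk⟩ : ∃ U : Set E, IsOpen U ∧ K ∩ m.support ⊆ U ∧
      ∀ᶠ k in atTop, ∀ y ∈ A k, y ∈ U → |v k y - u y| < η := by
    have hloc' : ∀ z ∈ K ∩ m.support, ∃ U ∈ 𝓝 z, IsOpen U ∧
        ∀ᶠ k in atTop, ∀ y ∈ A k, y ∈ U → |v k y - u y| < η := by
      intro z hz
      obtain ⟨r, hr, hk⟩ := hloc z hz.2 (η / 2) (half_pos hη)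
      obtain ⟨r', hr', hu'⟩ := Metric.continuous_iff.1 u.continuous z (η / 2) (half_pos hη)
      refine ⟨Metric.ball z (min r r'), Metric.ball_mem_nhds _ (lt_min hr hr'),
        Metric.isOpen_ball, ?_⟩
      filter_upwards [hk] with k hk y hyA hyU
      rw [Metric.mem_ball, lt_min_iff] at hyU
      have h1 := hk y hyA hyU.1
      have h2 := hu' y hyU.2
      rw [Real.dist_eq, huv z hz.2] at h2
      have : v k y - u y = (v k y - v₀ z) - (u y - v₀ z) := by ring
      rw [this]
      exact (abs_sub _ _).trans_lt (by linarith)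
    choose! V hV hVo hVk using hloc'
    obtain ⟨t, htK, htc⟩ := (hKc.inter_right Measure.isClosed_support).elim_nhds_subcover V hV
    refine ⟨⋃ z ∈ t, V z, isOpen_biUnion fun z hz => hVo z (htK z hz), htc, ?_⟩
    have : ∀ᶠ k in atTop, ∀ z ∈ t, ∀ y ∈ A k, y ∈ V z → |v k y - u y| < η :=
      (eventually_all_finset t).2 fun z hz => hVk z (htK z hz)
    filter_upwards [this] with k hk y hyA hyU
    obtain ⟨z, hz, hy⟩ := mem_iUnion₂.1 hyU
    exact hk z hz y hyA hy
  -- On K \ U there is no closeness, but this compact set misses the support of m. The bump χ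
  -- dominates its indicator and has m-integral zero, so by vague convergence its ν k-mass tends to
  -- zero.
  obtain ⟨χ, h1, h0, hc, h01⟩ := exists_continuous_one_zero_of_isCompact
    (hKc.diff hUo) (Measure.isClosed_support (μ := m))
    (disjoint_left.2 fun y hy hys => hy.2 (hKU ⟨hy.1, hys⟩))
  have hχ0 : ∫ y, χ y ∂m = 0 := by
    refine integral_eq_zero_of_ae ?_
    filter_upwards [Measure.support_mem_ae (μ := m)] with y hy
    exact h0 hy
  have hχ := hvague χ χ.continuous hc
  rw [hχ0] at hχ
  set C := |Cf| * (|B| + |Cu|) with hCdef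
  have hC : 0 ≤ C := by positivity
  have e1 : ∀ᶠ k in atTop, C * ∫ y, χ y ∂(ν k) < ε / 2 := by
    have := hχ.const_mul C
    rw [mul_zero] at this
    exact this.eventually_lt_const (half_pos hε)
  have e2 : ∀ᶠ k in atTop, ∫ y, |f y| ∂(ν k) < I + 1 := habs.eventually_lt_const (by linarith)
  filter_upwards [hUk, e1, e2] with k hk h1k h2k
  rw [Real.dist_eq, sub_zero, ← integral_sub (hint1 k) (hint2 k)]
  have hchi : Integrable χ (ν k) := χ.continuous.integrable_of_hasCompactSupport hc
  have hfab : Integrable (fun y => |f y|) (ν k) := (hf.integrable_of_hasCompactSupport hfc).abs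
  calc |∫ y, (f y * v k y - f y * u y) ∂(ν k)|
      ≤ ∫ y, (η * |f y| + C * χ y) ∂(ν k) := by
        rw [← Real.norm_eq_abs]
        refine norm_integral_le_of_norm_le ((hfab.const_mul η).add (hchi.const_mul C)) ?_
        filter_upwards [hA k] with y hyA
        rw [← mul_sub, norm_mul, Real.norm_eq_abs, Real.norm_eq_abs]
        by_cases hyK : y ∈ K
        · by_cases hyU : y ∈ U
          · have := (hk y hyA hyU).le
            have h3 : 0 ≤ C * χ y := mul_nonneg hC (h01 y).1
            nlinarith [abs_nonneg (f y)]
          · have hx : χ y = 1 := h1 ⟨hyK, hyU⟩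
            have h3 : |f y| * |v k y - u y| ≤ C := by
              rw [hCdef]
              refine mul_le_mul ((hCf y).trans (le_abs_self _)) ?_ (abs_nonneg _) (abs_nonneg _)
              exact (abs_sub _ _).trans (add_le_add ((hv k y).trans (le_abs_self _))
                ((hCu y hyK).trans (le_abs_self _)))
            rw [hx, mul_one]
            nlinarith [mul_nonneg hη.le (abs_nonneg (f y))]
        · rw [image_eq_zero_of_notMem_tsupport hyK]
          simpa using mul_nonneg hC (h01 y).1
    _ = η * ∫ y, |f y| ∂(ν k) + C * ∫ y, χ y ∂(ν k) := by
        rw [integral_add (hfab.const_mul η) (hchi.const_mul C), integral_const_mul,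
          integral_const_mul]
    _ < ε := by
        have : η * ∫ y, |f y| ∂(ν k) ≤ η * (I + 1) := mul_le_mul_of_nonneg_left h2k.le hη.le
        have h4 : η * (I + 1) = ε / 4 := by rw [hηdef]; field_simp
        linarith

end VagueConvergence

noncomputable section

/-! ### Exponentially averaged path functionals -/

/-- Points whose oscillation exceeds a fixed level are isolated from the right: right continuity at
x makes p nearly constant on some interval just after x. Such a set is countable, and left limits
are not involved. -/
theorem countable_not_continuousAt_of_rightContinuous {E : Type*} [PseudoMetricSpace E]
    {p : ℝ≥0 → E} (hp : ∀ t, ContinuousWithinAt p (Ici t) t) :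
    {t | ¬ ContinuousAt p t}.Countable := by
  set J : ℕ → Set ℝ≥0 := fun k => {t | ¬ ∃ U ∈ 𝓝 t, ∀ s ∈ U, dist (p s) (p t) < 1 / ((k : ℝ) + 1)}
  have hJ : ∀ k, (J k).Countable := by
    intro k
    refine (countable_setOfPred_isolated_right_within (s := J k)).mono fun x hx => ?_
    refine mem_ofPred_eq.mpr ⟨hx, ?_⟩
    have hk : (0 : ℝ) < 1 / ((k : ℝ) + 1) := Nat.one_div_pos_of_nat
    have h1 := (Metric.continuousWithinAt_iff'.1 (hp x)) _ (half_pos hk)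
    obtain ⟨y, hy, hyU⟩ := (mem_nhdsGE_iff_exists_Ico_subset (a := x)).1 h1
    refine empty_mem_iff_bot.1 (mem_nhdsWithin.2 ⟨Iio y, isOpen_Iio, hy, ?_⟩)
    rintro t ⟨hty, htJ, htx'⟩
    have htx : t ∈ Ioo x y := ⟨htx', hty⟩
    exfalso
    refine htJ ⟨Ioo x y, Ioo_mem_nhds htx.1 htx.2, fun s hs => ?_⟩
    have a := hyU (Ioo_subset_Ico_self hs)
    have b := hyU (Ioo_subset_Ico_self htx)
    simp only [mem_ofPred_eq] at a b
    calc dist (p s) (p t) ≤ dist (p s) (p x) + dist (p t) (p x) := dist_triangle_right _ _ _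
      _ < _ := by linarith
  refine (countable_iUnion hJ).mono fun t ht => ?_
  by_contra hcon
  rw [mem_iUnion, not_exists] at hcon
  refine ht (Metric.continuousAt_iff'.2 fun ε hε => ?_)
  obtain ⟨k, hk⟩ := exists_nat_one_div_lt hε
  obtain ⟨U, hU, h⟩ := not_not.1 (hcon k)
  filter_upwards [hU] with s hs
  exact (h s hs).trans hk

namespace CadlagPath

variable {E : Type*}

theorem measurable_eval [TopologicalSpace E] [MeasurableSpace E] (t : ℝ≥0) :
    Measurable fun p : CadlagPath E => p t :=
  (measurable_pi_apply t).comp (comap_measurable _)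

/-- Right continuity makes evaluation at t the limit of evaluations at grid times (⌊(j+1)t⌋ +
1)/(j+1), which decrease in distance to t from the right and take countably many values for each j.
-/
theorem measurable_uncurry [PseudoMetricSpace E] [MeasurableSpace E] [BorelSpace E] :
    Measurable fun q : CadlagPath E × ℝ≥0 => q.1 q.2 := by
  have hmeas : ∀ j : ℕ, Measurable fun q : CadlagPath E × ℝ≥0 =>
      q.1 ((⌊((j : ℝ≥0) + 1) * q.2⌋₊ + 1 : ℝ≥0) / (j + 1)) := by
    intro j
    have h1 : Measurable fun q : CadlagPath E × ℕ => q.1 (((q.2 : ℝ≥0) + 1) / (j + 1)) :=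
      measurable_from_prod_countable_left fun n => measurable_eval (((n : ℝ≥0) + 1) / (j + 1))
    have h2 : Measurable fun q : CadlagPath E × ℝ≥0 => (q.1, ⌊((j : ℝ≥0) + 1) * q.2⌋₊) :=
      measurable_fst.prodMk (Nat.measurable_floor.comp (measurable_snd.const_mul _))
    exact h1.comp h2
  refine measurable_of_tendsto_metrizable hmeas (tendsto_pi_nhds.2 fun q => ?_)
  have hr := q.1.right_cts q.2
  refine hr.tendsto.comp (tendsto_nhdsWithin_iff.2 ⟨?_, ?_⟩)
  · have h0 : Tendsto (fun j : ℕ => q.2 + 1 / ((j : ℝ≥0) + 1)) atTop (𝓝 q.2) := by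
      have : Tendsto (fun j : ℕ => 1 / ((j : ℝ≥0) + 1)) atTop (𝓝 0) :=
        tendsto_one_div_add_atTop_nhds_zero_nat
      simpa using tendsto_const_nhds.add this
    refine tendsto_of_tendsto_of_tendsto_of_le_of_le tendsto_const_nhds h0 (fun j => ?_)
      fun j => ?_
    · rw [le_div_iff₀ (by positivity), mul_comm]
      exact (Nat.lt_floor_add_one _).le
    · change _ / _ ≤ _
      have hj : (j : ℝ≥0) + 1 ≠ 0 := by positivity
      rw [div_le_iff₀ (by positivity), add_mul q.2, div_mul_cancel₀ _ hj, mul_comm q.2]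
      gcongr
      exact Nat.floor_le (by positivity)
  · refine Eventually.of_forall fun j => ?_
    rw [mem_Ici, le_div_iff₀ (by positivity), mul_comm]
    exact (Nat.lt_floor_add_one _).le

/-- The average of `f` along the path, at an independent exponential time of rate `r`. -/
def expAverage (r : ℝ) (f : E → ℝ) [TopologicalSpace E] (p : CadlagPath E) : ℝ :=
  ∫ t, f (p t.toNNReal) ∂(expMeasure r)

theorem measurable_expAverage [PseudoMetricSpace E] [MeasurableSpace E] [BorelSpace E]
    {r : ℝ} (hr : 0 < r) {f : E → ℝ} (hf : Continuous f) :
    Measurable (expAverage (E := E) r f) := by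
  have := isProbabilityMeasure_expMeasure hr
  have : Measurable fun q : CadlagPath E × ℝ => f (q.1 q.2.toNNReal) :=
    hf.measurable.comp (measurable_uncurry.comp
      (measurable_fst.prodMk (measurable_real_toNNReal.comp measurable_snd)))
  exact (this.stronglyMeasurable.integral_prod_right' (ν := expMeasure r)).measurable

theorem abs_expAverage_le [TopologicalSpace E] {r : ℝ} (hr : 0 < r) {f : E → ℝ} {B : ℝ}
    (hB : ∀ y, |f y| ≤ B) (p : CadlagPath E) : |expAverage r f p| ≤ B := by
  have := isProbabilityMeasure_expMeasure hr
  have := norm_integral_le_of_norm_le_const (μ := expMeasure r) (f := fun t => f (p t.toNNReal))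
    (C := B) (ae_of_all _ fun t => hB _)
  simpa [expAverage] using this

/-- If q j is Skorokhod close to p, then f(q j t) → f(p t) at every continuity point t of p. These
are almost all times for the exponential law, so dominated convergence applies. -/
theorem continuous_expAverage [PseudoMetricSpace E] [MeasurableSpace E] [BorelSpace E]
    {r : ℝ} (hr : 0 < r) {f : E → ℝ} (hf : UniformContinuous f) {B : ℝ}
    (hB : ∀ y, |f y| ≤ B) : Continuous (expAverage (E := E) r f) := by
  have := isProbabilityMeasure_expMeasure hr
  have key : ∀ p : CadlagPath E, ∀ δ > 0, ∃ T : ℝ≥0, ∃ ε : ℝ, 0 < ε ∧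
      ∀ q ∈ skorokhodNhd p T ε, |expAverage r f q - expAverage r f p| < δ := by
    intro p δ hδ
    by_contra! hcon
    have hpos : ∀ j : ℕ, (0 : ℝ) < 1 / ((j : ℝ) + 1) := fun j => Nat.one_div_pos_of_nat
    -- The horizon T = j grows while ε = 1/(j+1) shrinks, so each fixed time is eventually covered.
    choose q hq hqd using fun j : ℕ => hcon (j : ℝ≥0) (1 / ((j : ℝ) + 1)) (hpos j)
    choose γ hγ using hq
    have hlim : Tendsto (fun j => expAverage r f (q j)) atTop (𝓝 (expAverage r f p)) := by
      have hm : ∀ p : CadlagPath E, Measurable fun t : ℝ => f (p t.toNNReal) := fun p =>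
        hf.continuous.measurable.comp (measurable_uncurry.comp
          (measurable_const.prodMk measurable_real_toNNReal))
      refine tendsto_integral_of_dominated_convergence (fun _ => B)
        (fun j => (hm _).aestronglyMeasurable) (integrable_const _)
        (fun j => ae_of_all _ fun t => hB _) ?_
      have hnull : ∀ᵐ t ∂(expMeasure r), ContinuousAt p t.toNNReal := by
        have hac : expMeasure r ≪ (volume : Measure ℝ) := by
          unfold expMeasure gammaMeasure
          exact withDensity_absolutelyContinuous _ _
        have hae : ∀ᵐ t ∂(expMeasure r), 0 ≤ t := by
          rw [ae_iff]
          simp only [not_le]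
          unfold expMeasure gammaMeasure
          rw [show {a : ℝ | a < 0} = Iio 0 from rfl, withDensity_apply _ measurableSet_Iio]
          exact setLIntegral_eq_zero measurableSet_Iio fun x hx => gammaPDF_of_neg hx
        have hc : ((fun s : ℝ≥0 => (s : ℝ)) '' {t | ¬ ContinuousAt p t}).Countable :=
          (countable_not_continuousAt_of_rightContinuous p.right_cts).image _
        filter_upwards [hac.ae_le (hc.ae_notMem volume), hae] with t ht h0
        by_contra hcont
        exact ht ⟨_, hcont, Real.coe_toNNReal t h0⟩
      filter_upwards [hnull] with t ht
      have hev : ∀ᶠ j : ℕ in atTop, t.toNNReal ≤ (j : ℝ≥0) :=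
        (tendsto_natCast_atTop_atTop (R := ℝ≥0)).eventually_ge_atTop _
      have h0 := tendsto_one_div_add_atTop_nhds_zero_nat (𝕜 := ℝ)
      have hγt : Tendsto (fun j => γ j t.toNNReal) atTop (𝓝 t.toNNReal) := by
        rw [tendsto_iff_dist_tendsto_zero]
        refine squeeze_zero' (Eventually.of_forall fun j => dist_nonneg) ?_ h0
        filter_upwards [hev] with j hj
        exact (hγ j _ hj).1.le
      have h1 : Tendsto (fun j => f (p (γ j t.toNNReal))) atTop (𝓝 (f (p t.toNNReal))) :=
        (hf.continuous.continuousAt.tendsto.comp ht.tendsto).comp hγt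
      have h2 : Tendsto (fun j => dist (q j t.toNNReal) (p (γ j t.toNNReal))) atTop (𝓝 0) := by
        refine squeeze_zero' (Eventually.of_forall fun j => dist_nonneg) ?_ h0
        filter_upwards [hev] with j hj
        exact (hγ j _ hj).2.le
      -- Only the distance from q j t to p (γ j t) is controlled; uniform continuity of f transfers
      -- it to the values of f.
      refine (tendsto_iff_of_dist ?_).2 h1
      rw [Metric.uniformContinuous_iff] at hf
      rw [Metric.tendsto_nhds]
      intro ε hε
      obtain ⟨d, hd, hfd⟩ := hf ε hε
      filter_upwards [h2.eventually_lt_const hd] with j hj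
      rw [Real.dist_0_eq_abs, abs_of_nonneg dist_nonneg]
      exact hfd hj
    rw [Metric.tendsto_atTop] at hlim
    obtain ⟨N, hN⟩ := hlim δ hδ
    exact absurd (hN N le_rfl) (not_lt.2 (hqd N))
  -- Openness means containing a basic set around each point, so it suffices that the preimage of V
  -- contains one.
  refine continuous_def.2 fun V hV => ?_
  intro p hp
  obtain ⟨δ, hδ, hball⟩ := Metric.isOpen_iff.1 hV _ hp
  obtain ⟨T, ε, hε, h⟩ := key p δ hδ
  exact ⟨T, ε, hε, fun q hq => hball (h q hq)⟩

end CadlagPath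

end

/-! ### The resolvent of a weighted graph -/

section Resolvent

variable {V : Type*}

theorem sum_sum_mul_symm {T : Finset V} {c : V → V → ℝ} (hsymm : ∀ x y, c x y = c y x)
    (u v : V → ℝ) :
    ∑ x ∈ T, ∑ y ∈ T, c x y * u x * v y = ∑ x ∈ T, ∑ y ∈ T, c x y * v x * u y := by
  rw [Finset.sum_comm]
  refine Finset.sum_congr rfl fun x _ => Finset.sum_congr rfl fun y _ => ?_
  rw [hsymm]
  ring

theorem half_sum_sum_sq_add {T : Finset V} {c : V → V → ℝ} (hsymm : ∀ x y, c x y = c y x)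
    (s : ℝ) (hs : s ^ 2 = 1) (u : V → ℝ) :
    (∑ x ∈ T, ∑ y ∈ T, c x y * (u x + s * u y) ^ 2) / 2 =
      ∑ x ∈ T, (∑ y ∈ T, c x y) * u x ^ 2 + s * ∑ x ∈ T, ∑ y ∈ T, c x y * u x * u y := by
  have h1 : ∑ x ∈ T, ∑ y ∈ T, c x y * (u x + s * u y) ^ 2 =
      ∑ x ∈ T, ∑ y ∈ T, c x y * u x ^ 2 + ∑ x ∈ T, ∑ y ∈ T, c x y * u y ^ 2 +
        2 * s * ∑ x ∈ T, ∑ y ∈ T, c x y * u x * u y := by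
    simp only [Finset.mul_sum, ← Finset.sum_add_distrib]
    refine Finset.sum_congr rfl fun x _ => Finset.sum_congr rfl fun y _ => ?_
    linear_combination c x y * u y ^ 2 * hs
  have h2 : ∑ x ∈ T, ∑ y ∈ T, c x y * u y ^ 2 = ∑ x ∈ T, ∑ y ∈ T, c x y * u x ^ 2 := by
    rw [Finset.sum_comm]
    simp only [hsymm]
  have h3 : ∑ x ∈ T, (∑ y ∈ T, c x y) * u x ^ 2 = ∑ x ∈ T, ∑ y ∈ T, c x y * u x ^ 2 := by
    simp only [Finset.sum_mul]
  rw [h1, h2, h3]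
  ring

/-- Diagonal dominance: diag(q) + sC is positive semidefinite for s = ±1. The sign -1 gives the
energy inequality, the sign +1 the positivity of the Neumann remainder. -/
theorem abs_sum_sum_mul_le {T : Finset V} {c : V → V → ℝ} (hsymm : ∀ x y, c x y = c y x)
    (hc : ∀ x y, 0 ≤ c x y) {q : V → ℝ} (hq : ∀ x ∈ T, ∑ y ∈ T, c x y ≤ q x) (s : ℝ)
    (hs : s ^ 2 = 1) (u : V → ℝ) :
    0 ≤ ∑ x ∈ T, q x * u x ^ 2 + s * ∑ x ∈ T, ∑ y ∈ T, c x y * u x * u y := by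
  have h1 : 0 ≤ (∑ x ∈ T, ∑ y ∈ T, c x y * (u x + s * u y) ^ 2) / 2 :=
    div_nonneg (Finset.sum_nonneg fun x _ => Finset.sum_nonneg fun y _ =>
      mul_nonneg (hc x y) (sq_nonneg _)) two_pos.le
  rw [half_sum_sum_sq_add hsymm s hs] at h1
  have h2 : ∑ x ∈ T, (∑ y ∈ T, c x y) * u x ^ 2 ≤ ∑ x ∈ T, q x * u x ^ 2 :=
    Finset.sum_le_sum fun x hx => mul_le_mul_of_nonneg_right (hq x hx) (sq_nonneg _)
  linarith

/-- Energy bound for the partial sums of the Neumann series of the resolvent. -/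
theorem neumann_partial_sum_energy {T : Finset V} {c : V → V → ℝ}
    (hsymm : ∀ x y, c x y = c y x) (hc : ∀ x y, 0 ≤ c x y) {q : V → ℝ}
    (hq : ∀ x ∈ T, ∑ y ∈ T, c x y ≤ q x) {r : ℝ} (hr : 0 < r) {g : V → ℝ} {h : ℕ → V → ℝ}
    {N : ℕ} (h0 : ∀ x ∈ T, (q x + r) * h 0 x = g x)
    (hstep : ∀ j ≤ 4 * N, ∀ x ∈ T, (q x + r) * h (j + 1) x = ∑ y ∈ T, c x y * h j y) :
    r * ∑ x ∈ T, g x ^ 2 - r ^ 2 * ∑ x ∈ T, g x * ∑ j ∈ Finset.range (2 * N), h j x ≤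
      (∑ x ∈ T, q x * g x ^ 2 - ∑ x ∈ T, ∑ y ∈ T, c x y * g x * g y) +
        2 * r * ∑ x ∈ T, g x * ((q x + r) * h (2 * N) x) := by
  have hq' : ∀ x ∈ T, ∑ y ∈ T, c x y ≤ q x + r := fun x hx => (hq x hx).trans (by linarith)
  -- `B u j` is the pairing of `u` with `D h_j`.
  set B : (V → ℝ) → ℕ → ℝ := fun u j => ∑ x ∈ T, u x * ((q x + r) * h j x) with hB
  have hBC : ∀ u, ∀ j ≤ 4 * N, ∑ x ∈ T, ∑ y ∈ T, c x y * u x * h j y = B u (j + 1) := by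
    intro u j hj
    refine Finset.sum_congr rfl fun x hx => ?_
    rw [hstep j hj x hx, Finset.mul_sum]
    exact Finset.sum_congr rfl fun y _ => by ring
  have hBsymm : ∀ i j, B (h i) j = B (h j) i := fun i j =>
    Finset.sum_congr rfl fun x _ => by ring
  -- Self-adjointness of D⁻¹C for the D-weighted product: ⟨h i, D h j⟩ depends only on i + j.
  have hshift : ∀ i j, i ≤ 4 * N → j ≤ 4 * N → B (h i) (j + 1) = B (h (i + 1)) j := by
    intro i j hi hj
    rw [← hBC _ j hj, sum_sum_mul_symm hsymm, hBC _ i hi, hBsymm]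
  have hσ : ∀ i j, i + j ≤ 4 * N + 1 → B (h i) j = B (h 0) (i + j) := by
    intro i
    induction i with
    | zero => intro j _; rw [zero_add]
    | succ i ih =>
      intro j hj
      rw [← hshift i j (by omega) (by omega), ih (j + 1) (by omega)]
      congr 1; omega
  -- The two terms are ⟨D h l, h l⟩ and ⟨C h l, h l⟩, and D + C is positive. An even number of terms
  -- is summed so that they can be paired in this way.
  have hpair : ∀ l, 2 * l ≤ 4 * N → 0 ≤ B (h 0) (2 * l) + B (h 0) (2 * l + 1) := by
    intro l hl
    have e1 : B (h 0) (2 * l) = ∑ x ∈ T, (q x + r) * h l x ^ 2 := by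
      rw [two_mul, ← hσ l l (by omega)]
      exact Finset.sum_congr rfl fun x _ => by ring
    have e2 : B (h 0) (2 * l + 1) = ∑ x ∈ T, ∑ y ∈ T, c x y * h l x * h l y := by
      rw [hBC _ l (by omega), hσ l (l + 1) (by omega)]
      congr 1; omega
    have := abs_sum_sum_mul_le hsymm hc hq' 1 (by norm_num) (h l)
    rw [e1, e2]
    linarith
  have hrem : 0 ≤ ∑ j ∈ Finset.range (2 * N), B (h j) (2 * N) := by
    have : ∀ n ≤ N, 0 ≤ ∑ j ∈ Finset.range (2 * n), B (h j) (2 * N) := by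
      intro n
      induction n with
      | zero => intro _; simp
      | succ n ih =>
        intro hn
        rw [show 2 * (n + 1) = 2 * n + 1 + 1 by ring, Finset.sum_range_succ, Finset.sum_range_succ]
        have h1 := ih (by omega)
        have h2 := hpair (N + n) (by omega)
        rw [hσ (2 * n) (2 * N) (by omega), hσ (2 * n + 1) (2 * N) (by omega),
          show 2 * n + 2 * N = 2 * (N + n) by ring, show 2 * n + 1 + 2 * N = 2 * (N + n) + 1 by ring]
        linarith
    exact this N le_rfl
  set G : V → ℝ := fun x => ∑ j ∈ Finset.range (2 * N), h j x with hG
  -- `(D - C) G = g - D h_{2N}` in weak form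
  have hres : ∀ u : V → ℝ, ∑ x ∈ T, (q x + r) * u x * G x - ∑ x ∈ T, ∑ y ∈ T, c x y * u x * G y =
      ∑ x ∈ T, u x * g x - B u (2 * N) := by
    intro u
    have e1 : ∑ x ∈ T, (q x + r) * u x * G x = ∑ j ∈ Finset.range (2 * N), B u j := by
      simp only [hG, hB, Finset.mul_sum]
      rw [Finset.sum_comm]
      exact Finset.sum_congr rfl fun j _ => Finset.sum_congr rfl fun x _ => by ring
    have e2 : ∑ x ∈ T, ∑ y ∈ T, c x y * u x * G y = ∑ j ∈ Finset.range (2 * N), B u (j + 1) := by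
      rw [← Finset.sum_congr rfl fun j hj => hBC u j (by have := Finset.mem_range.1 hj; omega)]
      simp only [hG, Finset.mul_sum]
      symm
      rw [Finset.sum_comm]
      exact Finset.sum_congr rfl fun x _ => Finset.sum_comm
    have e3 : B u 0 = ∑ x ∈ T, u x * g x :=
      Finset.sum_congr rfl fun x hx => by rw [h0 x hx]
    rw [e1, e2, ← Finset.sum_sub_distrib, Finset.sum_range_sub' (fun j => B u j), e3]
  -- Positivity of D - C at g - rG. Expanding with (D - C)G = g - D h_{2N} gives the claim up to
  -- -r²⟨G, D h_{2N}⟩, which has the favourable sign by `hrem`.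
  have hpos := abs_sum_sum_mul_le hsymm hc hq' (-1) (by norm_num) (fun x => g x - r * G x)
  have hg := hres g
  have hGG := hres G
  have hBG : B G (2 * N) = ∑ j ∈ Finset.range (2 * N), B (h j) (2 * N) := by
    simp only [hG, hB, Finset.sum_mul]
    rw [Finset.sum_comm]
  have hGg : ∑ x ∈ T, G x * g x = ∑ x ∈ T, g x * G x :=
    Finset.sum_congr rfl fun x _ => mul_comm _ _
  have hexp1 : ∑ x ∈ T, (q x + r) * (g x - r * G x) ^ 2 =
      ∑ x ∈ T, q x * g x ^ 2 + r * ∑ x ∈ T, g x ^ 2 - 2 * r * ∑ x ∈ T, (q x + r) * g x * G x +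
        r ^ 2 * ∑ x ∈ T, (q x + r) * G x * G x := by
    simp only [Finset.mul_sum, ← Finset.sum_add_distrib, ← Finset.sum_sub_distrib]
    exact Finset.sum_congr rfl fun x _ => by ring
  have hexp2 : ∑ x ∈ T, ∑ y ∈ T, c x y * (g x - r * G x) * (g y - r * G y) =
      ∑ x ∈ T, ∑ y ∈ T, c x y * g x * g y - r * ∑ x ∈ T, ∑ y ∈ T, c x y * g x * G y -
        r * ∑ x ∈ T, ∑ y ∈ T, c x y * G x * g y +
        r ^ 2 * ∑ x ∈ T, ∑ y ∈ T, c x y * G x * G y := by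
    simp only [Finset.mul_sum, ← Finset.sum_add_distrib, ← Finset.sum_sub_distrib]
    exact Finset.sum_congr rfl fun x _ => Finset.sum_congr rfl fun y _ => by ring
  rw [sum_sum_mul_symm hsymm G g] at hexp2
  rw [hexp1, hexp2] at hpos
  rw [hBG] at hGG
  have e4 : ∑ x ∈ T, g x * g x = ∑ x ∈ T, g x ^ 2 :=
    Finset.sum_congr rfl fun x _ => by ring
  rw [e4] at hg
  rw [hGg] at hGG
  have e5 : ∑ x ∈ T, g x * ((q x + r) * h (2 * N) x) = B g (2 * N) := rfl
  rw [e5]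
  have := mul_nonneg (sq_nonneg r) hrem
  linear_combination hpos + this - 2 * r * hg + r ^ 2 * hGG

/-- If `G = ∑ h_j` is the Neumann series of the resolvent `(r - L)⁻¹ g` then
`r ‖g‖² - r² ⟨g, G⟩ ≤ ℰ(g, g)`. -/
theorem neumann_series_energy {c : V → V → ℝ} (hsymm : ∀ x y, c x y = c y x)
    (hc : ∀ x y, 0 ≤ c x y) {nb : V → Finset V} (hnb : ∀ x y, c x y ≠ 0 → y ∈ nb x) {q : V → ℝ}
    (hq : ∀ x, q x = ∑ y ∈ nb x, c x y) {r : ℝ} (hr : 0 < r) {g : V → ℝ} {h : ℕ → V → ℝ}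
    (h0 : ∀ x, (q x + r) * h 0 x = g x)
    (hstep : ∀ j x, (q x + r) * h (j + 1) x = ∑ y ∈ nb x, c x y * h j y)
    (hsum : ∀ x, Summable fun j => h j x) {S₀ S : Finset V} (hg : ∀ x ∉ S₀, g x = 0)
    (hS₀ : S₀ ⊆ S) (hS : ∀ x ∈ S₀, nb x ⊆ S) :
    r * ∑ x ∈ S₀, g x ^ 2 - r ^ 2 * ∑ x ∈ S₀, g x * ∑' j, h j x ≤
      (∑ x ∈ S, ∑ y ∈ S, c x y * (g x - g y) ^ 2) / 2 := by
  classical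
  have hq0 : ∀ x, 0 ≤ q x := fun x => by
    rw [hq]; exact Finset.sum_nonneg fun y _ => hc x y
  have hsumle : ∀ (T : Finset V) x, ∑ y ∈ T, c x y ≤ q x := by
    intro T x
    rw [hq, ← Finset.sum_filter_ne_zero]
    refine Finset.sum_le_sum_of_subset_of_nonneg (fun y hy => hnb x y (Finset.mem_filter.1 hy).2)
      fun y _ _ => hc x y
  have hsumeq : ∀ (T : Finset V) x (u : V → ℝ), (∀ y ∈ nb x, y ∉ T → u y = 0) →
      ∑ y ∈ nb x, c x y * u y = ∑ y ∈ T, c x y * u y := by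
    intro T x u hu
    refine Finset.sum_congr_of_eq_on_inter (fun y hy hyT => by rw [hu y hy hyT, mul_zero])
      (fun y hyT hy => ?_) fun _ _ _ => rfl
    have : c x y = 0 := by by_contra hne; exact hy (hnb x y hne)
    rw [this, zero_mul]
  -- a growing family of finite sets carrying the terms of the series
  let U : ℕ → Finset V := fun n => n.rec S fun _ s => s ∪ s.biUnion nb
  have hUsucc : ∀ n, U (n + 1) = U n ∪ (U n).biUnion nb := fun n => rfl
  have hUmono : Monotone U := monotone_nat_of_le_succ fun n => by
    rw [hUsucc]; exact Finset.subset_union_left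
  have hsuppU : ∀ j, ∀ x ∉ U j, h j x = 0 := by
    intro j
    induction j with
    | zero =>
      intro x hx
      have := h0 x
      rw [hg x fun h => hx (hS₀ h)] at this
      exact (mul_eq_zero.1 this).resolve_left (by linarith [hq0 x])
    | succ j ih =>
      intro x hx
      rw [hUsucc, Finset.mem_union, Finset.mem_biUnion] at hx
      push Not at hx
      have hz : ∀ y ∈ nb x, c x y * h j y = 0 := by
        intro y _
        rcases Classical.em (y ∈ U j) with hyU | hyU
        · have : c x y = 0 := by
            by_contra hne
            exact hx.2 y hyU (hnb y x (by rwa [hsymm]))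
          rw [this, zero_mul]
        · rw [ih y hyU, mul_zero]
      have h2 := hstep j x
      rw [Finset.sum_eq_zero hz] at h2
      exact (mul_eq_zero.1 h2).resolve_left (by linarith [hq0 x])
  -- Since S contains the support of g and its neighbours, the quadratic form of g with the full
  -- weights q on any larger set is already the energy over S × S.
  have hEn : ∀ T : Finset V, S ⊆ T →
      ∑ x ∈ T, q x * g x ^ 2 - ∑ x ∈ T, ∑ y ∈ T, c x y * g x * g y =
        (∑ x ∈ S, ∑ y ∈ S, c x y * (g x - g y) ^ 2) / 2 := by
    intro T hT
    have e := half_sum_sum_sq_add (T := S) hsymm (-1) (by norm_num) g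
    have e0 : ∀ x y, (g x + -1 * g y) ^ 2 = (g x - g y) ^ 2 := fun x y => by ring
    simp only [e0] at e
    rw [e]
    have e1 : ∑ x ∈ T, q x * g x ^ 2 = ∑ x ∈ S, (∑ y ∈ S, c x y) * g x ^ 2 := by
      rw [← Finset.sum_subset hT fun x _ hx => by rw [hg x fun h => hx (hS₀ h)]; ring]
      refine Finset.sum_congr rfl fun x _ => ?_
      by_cases hx : x ∈ S₀
      · have := hsumeq S x (fun _ => 1) fun y hy hyS => absurd (hS x hx hy) hyS
        simp only [mul_one] at this
        rw [hq, this]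
      · rw [hg x hx]; ring
    have e2 : ∑ x ∈ T, ∑ y ∈ T, c x y * g x * g y = ∑ x ∈ S, ∑ y ∈ S, c x y * g x * g y := by
      rw [← Finset.sum_subset hT fun x _ hx => by
        simp [hg x fun h => hx (hS₀ h)]]
      refine Finset.sum_congr rfl fun x _ => ?_
      rw [← Finset.sum_subset hT fun y _ hy => by simp [hg y fun h => hy (hS₀ h)]]
    rw [e1, e2]
    ring
  have hST : ∀ n, S ⊆ U n := fun n => hUmono (Nat.zero_le n)
  have hkey : ∀ N : ℕ,
      r * ∑ x ∈ S₀, g x ^ 2 - r ^ 2 * ∑ x ∈ S₀, g x * ∑ j ∈ Finset.range (2 * N), h j x ≤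
      (∑ x ∈ S, ∑ y ∈ S, c x y * (g x - g y) ^ 2) / 2 +
        2 * r * ∑ x ∈ S₀, g x * ((q x + r) * h (2 * N) x) := by
    intro N
    -- Each step enlarges the support by one layer of neighbours, so U (4N) carries all terms h j
    -- with j ≤ 4N and the recursion restricts to it exactly.
    have key := neumann_partial_sum_energy (T := U (4 * N)) hsymm hc (fun x _ => hsumle _ x) hr
      (N := N) (g := g) (h := h) (fun x _ => h0 x) fun j hj x _ => by
        rw [hstep]
        exact hsumeq _ _ _ fun y _ hy => hsuppU j y fun h => hy (hUmono hj h)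
    rw [hEn _ (hST _)] at key
    have hsub : S₀ ⊆ U (4 * N) := hS₀.trans (hST _)
    rw [← Finset.sum_subset hsub fun x _ hx => by simp [hg x hx],
      ← Finset.sum_subset hsub fun x _ hx => by simp [hg x hx],
      ← Finset.sum_subset hsub fun x _ hx => by simp [hg x hx]] at key
    exact key
  have h2N : Tendsto (fun N : ℕ => 2 * N) atTop atTop :=
    tendsto_id.const_mul_atTop' two_pos
  have hL : Tendsto (fun N : ℕ =>
      r * ∑ x ∈ S₀, g x ^ 2 - r ^ 2 * ∑ x ∈ S₀, g x * ∑ j ∈ Finset.range (2 * N), h j x) atTop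
      (𝓝 (r * ∑ x ∈ S₀, g x ^ 2 - r ^ 2 * ∑ x ∈ S₀, g x * ∑' j, h j x)) := by
    refine tendsto_const_nhds.sub (Tendsto.const_mul _ (tendsto_finsetSum _ fun x _ => ?_))
    exact ((hsum x).hasSum.tendsto_sum_nat.comp h2N).const_mul _
  have hR : Tendsto (fun N : ℕ => (∑ x ∈ S, ∑ y ∈ S, c x y * (g x - g y) ^ 2) / 2 +
        2 * r * ∑ x ∈ S₀, g x * ((q x + r) * h (2 * N) x)) atTop
      (𝓝 ((∑ x ∈ S, ∑ y ∈ S, c x y * (g x - g y) ^ 2) / 2 +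
        2 * r * ∑ x ∈ S₀, g x * ((q x + r) * 0))) := by
    -- The remainder involves h_{2N} only on the fixed finite set S₀, where it tends to zero because
    -- the series is summable.
    refine tendsto_const_nhds.add (Tendsto.const_mul _ (tendsto_finsetSum _ fun x _ => ?_))
    exact (((hsum x).tendsto_atTop_zero.comp h2N).const_mul _).const_mul _
  simpa using le_of_tendsto_of_tendsto' hL hR hkey

end Resolvent

noncomputable section

variable {d₁ d₂ : ℕ}

/-! ### Exponential laws -/

theorem expMeasure_absolutelyContinuous (r : ℝ) : expMeasure r ≪ (volume : Measure ℝ) := by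
  unfold expMeasure gammaMeasure
  exact withDensity_absolutelyContinuous _ _

theorem ae_expMeasure_pos (r : ℝ) : ∀ᵐ t ∂(expMeasure r), 0 < t := by
  have h1 : ∀ᵐ t ∂(expMeasure r), 0 ≤ t := by
    rw [ae_iff]
    simp only [not_le]
    unfold expMeasure gammaMeasure
    rw [show {a : ℝ | a < 0} = Iio 0 from rfl, withDensity_apply _ measurableSet_Iio]
    exact setLIntegral_eq_zero measurableSet_Iio fun x hx => gammaPDF_of_neg hx
  have h2 : ∀ᵐ t ∂(expMeasure r), t ≠ 0 :=
    (expMeasure_absolutelyContinuous r).ae_le ((countable_singleton (0 : ℝ)).ae_notMem volume)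
  filter_upwards [h1, h2] with t a b
  exact lt_of_le_of_ne a b.symm

theorem lintegral_exp_neg_expMeasure {r s : ℝ} (hr : 0 < r) (hs : 0 ≤ s) :
    ∫⁻ t, ENNReal.ofReal (Real.exp (-(s * t))) ∂(expMeasure r) = ENNReal.ofReal (r / (r + s)) := by
  have hrs : 0 < r + s := by linarith
  have hden : ∀ t, exponentialPDF r t * ENNReal.ofReal (Real.exp (-(s * t))) =
      ENNReal.ofReal (r / (r + s)) * exponentialPDF (r + s) t := by
    intro t
    rw [exponentialPDF_eq, exponentialPDF_eq, ← ENNReal.ofReal_mul' (Real.exp_pos _).le,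
      ← ENNReal.ofReal_mul (by positivity)]
    congr 1
    split_ifs with ht
    · rw [show -((r + s) * t) = -(r * t) + -(s * t) by ring, Real.exp_add]
      field_simp
    · simp
  have hme : Measurable (exponentialPDF r) := (measurable_exponentialPDFReal r).ennreal_ofReal
  change ∫⁻ t, _ ∂((volume : Measure ℝ).withDensity (exponentialPDF r)) = _
  rw [lintegral_withDensity_eq_lintegral_mul _ hme (by fun_prop)]
  simp only [Pi.mul_apply, hden]
  have hme' : Measurable (exponentialPDF (r + s)) :=
    (measurable_exponentialPDFReal _).ennreal_ofReal
  rw [lintegral_const_mul _ hme', lintegral_exponentialPDF_eq_one hrs, mul_one]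

theorem expMeasure_real_Ico {r a b : ℝ} (hr : 0 < r) (ha : 0 ≤ a) (hab : a ≤ b) :
    (expMeasure r).real (Ico a b) = Real.exp (-(r * a)) - Real.exp (-(r * b)) := by
  have := isProbabilityMeasure_expMeasure hr
  have hae : Ico a b =ᵐ[expMeasure r] Ioc a b :=
    (expMeasure_absolutelyContinuous r).ae_eq Ico_ae_eq_Ioc
  have hcdf := cdf_expMeasure_eq hr
  simp only [cdf_eq_real] at hcdf
  rw [measureReal_congr hae, show Ioc a b = Iic b \ Iic a by ext; simp [and_comm],
    measureReal_sdiff (Iic_subset_Iic.2 hab) measurableSet_Iic, hcdf, hcdf, if_pos ha,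
    if_pos (ha.trans hab)]
  ring

/-! ### The trajectory of the walk -/

instance (w : Env d₁ d₂) (x : OrthLat d₁ d₂) : IsProbabilityMeasure (trajLaw w x) := by
  unfold trajLaw
  infer_instance

/-- Integration over the holding time. -/
def holdAvg (w : Env d₁ d₂) (G : OrthLat d₁ d₂ × ℝ → ℝ≥0∞) (x : OrthLat d₁ d₂) : ℝ≥0∞ :=
  ∫⁻ t, G (x, t) ∂(holdLaw w x)

theorem lintegral_stayKernel (w : Env d₁ d₂) (x : OrthLat d₁ d₂) {G : OrthLat d₁ d₂ × ℝ → ℝ≥0∞}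
    (hG : Measurable G) : ∫⁻ z, G z ∂(stayKernel w x) = holdAvg w G x := by
  change ∫⁻ z, G z ∂((Measure.dirac x).prod (holdLaw w x)) = _
  rw [lintegral_prod _ hG.aemeasurable, lintegral_dirac]
  rfl

/-- One step of the walk, discounted at rate `s` over the holding time. -/
def discountStep (w : Env d₁ d₂) (s : ℝ) (ψ : OrthLat d₁ d₂ → ℝ≥0∞) (x : OrthLat d₁ d₂) : ℝ≥0∞ :=
  (∫⁻ t, ENNReal.ofReal (Real.exp (-(s * t))) ∂(holdLaw w x)) * ∫⁻ y, ψ y ∂(jumpLaw w x)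

theorem measurable_jumpTime (k : ℕ) :
    Measurable fun h : ℕ → OrthLat d₁ d₂ × ℝ => jumpTime h k := by
  unfold jumpTime
  fun_prop

theorem map_zero_trajLaw (w : Env d₁ d₂) (x : OrthLat d₁ d₂) :
    (trajLaw w x).map (fun h => h 0) = stayKernel w x := by
  have h0 : (fun h : ℕ → OrthLat d₁ d₂ × ℝ => h 0) =
      (MeasurableEquiv.piUnique (fun _ : Finset.Iic 0 => OrthLat d₁ d₂ × ℝ)) ∘
        (Preorder.frestrictLe (π := fun _ : ℕ => OrthLat d₁ d₂ × ℝ) 0) := rfl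
  rw [h0, ← Measure.map_map (MeasurableEquiv.measurable _) (by fun_prop), trajLaw,
    Kernel.trajMeasure, Measure.map_comp _ _ (by fun_prop), Kernel.traj_map_frestrictLe,
    Kernel.partialTraj_self, Measure.id_comp,
    Measure.map_map (MeasurableEquiv.measurable _) (MeasurableEquiv.measurable _)]
  have hid : (MeasurableEquiv.piUnique (fun _ : Finset.Iic 0 => OrthLat d₁ d₂ × ℝ)) ∘
      (MeasurableEquiv.piUnique (fun _ : Finset.Iic 0 => OrthLat d₁ d₂ × ℝ)).symm = id :=
    MeasurableEquiv.self_comp_symm _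
  exact (congrArg (fun f => Measure.map f (stayKernel w x)) hid).trans Measure.map_id

/-- The (k+1)-st jump time depends only on coordinates 0, …, k, so the Markov property integrates
out coordinate k + 1: a jump, followed by a holding time at the new vertex. -/
theorem lintegral_trajLaw_succ (w : Env d₁ d₂) (x : OrthLat d₁ d₂) (s : ℝ) (k : ℕ)
    {G : OrthLat d₁ d₂ × ℝ → ℝ≥0∞} (hG : Measurable G) :
    ∫⁻ h, ENNReal.ofReal (Real.exp (-(s * jumpTime h (k + 1)))) * G (h (k + 1)) ∂(trajLaw w x) =
      ∫⁻ h, ENNReal.ofReal (Real.exp (-(s * jumpTime h (k + 1)))) *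
        ∫⁻ y, holdAvg w G y ∂(jumpLaw w (h k).1) ∂(trajLaw w x) := by
  set A : (Finset.Iic k → OrthLat d₁ d₂ × ℝ) → ℝ≥0∞ := fun a =>
    ENNReal.ofReal (Real.exp (-(s * ∑ i, (a i).2))) with hAdef
  have hA : Measurable A := by
    refine ENNReal.measurable_ofReal.comp (Real.measurable_exp.comp ?_)
    fun_prop
  have hAj : ∀ h : ℕ → OrthLat d₁ d₂ × ℝ,
      A (Preorder.frestrictLe (π := fun _ : ℕ => OrthLat d₁ d₂ × ℝ) k h) =
        ENNReal.ofReal (Real.exp (-(s * jumpTime h (k + 1)))) := by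
    intro h
    have : ∑ i : Finset.Iic k, (h i).2 = jumpTime h (k + 1) := by
      rw [jumpTime, Finset.sum_coe_sort (Finset.Iic k) (fun i => (h i).2)]
      refine Finset.sum_congr ?_ fun _ _ => rfl
      ext i
      simp
    simp only [hAdef, Preorder.frestrictLe_apply, this]
  have hstep : ∀ a : Finset.Iic k → OrthLat d₁ d₂ × ℝ, ∫⁻ z, G z ∂(stepKernel w k a) =
      ∫⁻ y, holdAvg w G y ∂(jumpLaw w (a ⟨k, Finset.mem_Iic.2 le_rfl⟩).1) := by
    intro a
    rw [stepKernel, Kernel.comap_apply, Kernel.lintegral_comp _ _ _ hG]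
    simp only [lintegral_stayKernel w _ hG]
    rfl
  have hF : Measurable fun q : (Finset.Iic k → OrthLat d₁ d₂ × ℝ) × (OrthLat d₁ d₂ × ℝ) =>
      A q.1 * G q.2 := (hA.comp measurable_fst).mul (hG.comp measurable_snd)
  have hm : Measurable fun h : ℕ → OrthLat d₁ d₂ × ℝ =>
      (Preorder.frestrictLe (π := fun _ : ℕ => OrthLat d₁ d₂ × ℝ) k h, h (k + 1)) := by fun_prop
  have key := congrArg (fun μ => ∫⁻ q, A q.1 * G q.2 ∂μ)
    (Kernel.map_frestrictLe_trajMeasure_compProd_eq_map_trajMeasure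
      (X := fun _ => OrthLat d₁ d₂ × ℝ) (κ := stepKernel w) (μ₀ := stayKernel w x) (a := k))
  beta_reduce at key
  rw [lintegral_map hF hm, Measure.lintegral_compProd hF] at key
  simp only [hAj] at key
  rw [trajLaw, ← key, lintegral_map ?_ (by fun_prop)]
  · refine lintegral_congr fun h => ?_
    rw [lintegral_const_mul _ hG, hstep, hAj]
    rfl
  · exact hF.lintegral_kernel_prod_right'

/-- The discounted expectation at the `k`-th jump. -/
theorem lintegral_trajLaw (w : Env d₁ d₂) (x : OrthLat d₁ d₂) (s : ℝ) (k : ℕ)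
    {G : OrthLat d₁ d₂ × ℝ → ℝ≥0∞} (hG : Measurable G) :
    ∫⁻ h, ENNReal.ofReal (Real.exp (-(s * jumpTime h k))) * G (h k) ∂(trajLaw w x) =
      (discountStep w s)^[k] (holdAvg w G) x := by
  induction k generalizing G with
  | zero =>
    simp only [jumpTime, Finset.range_zero, Finset.sum_empty, mul_zero, neg_zero, Real.exp_zero,
      ENNReal.ofReal_one, one_mul, Function.iterate_zero, id]
    rw [← lintegral_stayKernel w x hG, ← map_zero_trajLaw w x,
      lintegral_map hG (measurable_pi_apply 0)]
  | succ k ih =>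
    rw [lintegral_trajLaw_succ w x s k hG, Function.iterate_succ_apply]
    -- The discount over the last stay is absorbed into a new reward at time k, whose average over
    -- the holding time is one `discountStep`.
    have hG' : Measurable fun z : OrthLat d₁ d₂ × ℝ => ENNReal.ofReal (Real.exp (-(s * z.2))) *
        ∫⁻ y, holdAvg w G y ∂(jumpLaw w z.1) := by
      refine Measurable.mul (by fun_prop) ?_
      exact (measurable_of_countable (fun x => ∫⁻ y, holdAvg w G y ∂(jumpLaw w x))).comp
        measurable_fst
    have := ih hG'
    have h2 : holdAvg w (fun z : OrthLat d₁ d₂ × ℝ => ENNReal.ofReal (Real.exp (-(s * z.2))) *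
        ∫⁻ y, holdAvg w G y ∂(jumpLaw w z.1)) = discountStep w s (holdAvg w G) := by
      funext y
      simp only [holdAvg, discountStep]
      rw [lintegral_mul_const _ (by fun_prop)]
    rw [← h2, ← this]
    refine lintegral_congr fun h => ?_
    rw [← mul_assoc, ← ENNReal.ofReal_mul (Real.exp_pos _).le, ← Real.exp_add]
    congr 4
    simp only [jumpTime, Finset.sum_range_succ]
    ring

theorem ae_holdLaw_pos (w : Env d₁ d₂) (x : OrthLat d₁ d₂) : ∀ᵐ t ∂(holdLaw w x), 0 < t := by
  unfold holdLaw
  split_ifs <;> exact ae_expMeasure_pos _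

theorem discountStep_iterate_zero (w : Env d₁ d₂) (s : ℝ) (k : ℕ) :
    (discountStep w s)^[k] 0 = 0 := by
  refine Function.iterate_fixed ?_ k
  funext x
  simp [discountStep]

theorem ae_holding_pos (w : Env d₁ d₂) (x : OrthLat d₁ d₂) :
    ∀ᵐ h ∂(trajLaw w x), ∀ k, 0 < (h k).2 := by
  rw [ae_all_iff]
  intro k
  have hset : MeasurableSet {z : OrthLat d₁ d₂ × ℝ | z.2 ≤ 0} :=
    measurableSet_le measurable_snd measurable_const
  have hG : Measurable (({z : OrthLat d₁ d₂ × ℝ | z.2 ≤ 0}).indicator (1 : OrthLat d₁ d₂ × ℝ → ℝ≥0∞)) :=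
    measurable_one.indicator hset
  -- At discount rate s = 0 the formula is the plain expectation at step k.
  have h1 := lintegral_trajLaw w x 0 k hG
  have h2 : holdAvg w
      (({z : OrthLat d₁ d₂ × ℝ | z.2 ≤ 0}).indicator (1 : OrthLat d₁ d₂ × ℝ → ℝ≥0∞)) = 0 := by
    funext y
    refine lintegral_eq_zero_of_ae_eq_zero ?_
    filter_upwards [ae_holdLaw_pos w y] with t ht
    simp [ht]
  rw [h2, discountStep_iterate_zero] at h1
  simp only [zero_mul, neg_zero, Real.exp_zero, ENNReal.ofReal_one, one_mul, Pi.zero_apply] at h1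
  replace h1 := (lintegral_eq_zero_iff (hG.comp (measurable_pi_apply k))).1 h1
  filter_upwards [h1] with h hh
  by_contra hcon
  simp [not_lt.1 hcon] at hh

end

noncomputable section

variable {d₁ d₂ : ℕ}

/-! ### The Neumann series of the walk -/

/-- The nearest neighbours of `x`. -/
def nbrs (x : OrthLat d₁ d₂) : Finset (OrthLat d₁ d₂) := (finite_nbrs x).toFinset

theorem mem_nbrs {x y : OrthLat d₁ d₂} : y ∈ nbrs x ↔ (latGraph d₁ d₂).Adj x y := by
  simp [nbrs]

theorem conduct_eq_zero {w : Env d₁ d₂} {x y : OrthLat d₁ d₂} (h : y ∉ nbrs x) :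
    conduct w x y = 0 := by
  rw [mem_nbrs] at h
  simp [conduct, h]

theorem conduct_comm (w : Env d₁ d₂) (x y : OrthLat d₁ d₂) : conduct w x y = conduct w y x := by
  by_cases h : (latGraph d₁ d₂).Adj x y
  · have : (⟨s(x, y), h⟩ : (latGraph d₁ d₂).edgeSet) = ⟨s(y, x), h.symm⟩ :=
      Subtype.ext Sym2.eq_swap
    simp [conduct, h, h.symm, this]
  · have h' : ¬ (latGraph d₁ d₂).Adj y x := fun h2 => h h2.symm
    simp [conduct, h, h']

/-- `μ_x` as a real number. -/
def vweight (w : Env d₁ d₂) (x : OrthLat d₁ d₂) : ℝ := (vertexWeight w x).toReal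

theorem vweight_eq (w : Env d₁ d₂) (x : OrthLat d₁ d₂) :
    vweight w x = ∑ y ∈ nbrs x, (conduct w x y : ℝ) := by
  rw [vweight, vertexWeight, tsum_eq_sum (s := nbrs x)
    (fun y hy => by rw [conduct_eq_zero hy, ENNReal.coe_zero]),
    ENNReal.toReal_sum fun _ _ => ENNReal.coe_ne_top]
  simp

theorem vweight_nonneg (w : Env d₁ d₂) (x : OrthLat d₁ d₂) : 0 ≤ vweight w x :=
  ENNReal.toReal_nonneg

theorem vweight_pos {w : Env d₁ d₂} {x : OrthLat d₁ d₂} (hx : vertexWeight w x ≠ 0) :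
    0 < vweight w x := ENNReal.toReal_pos hx (vertexWeight_ne_top w x)

theorem vertexWeight_ne_zero_of_conduct {w : Env d₁ d₂} {x y : OrthLat d₁ d₂}
    (h : conduct w x y ≠ 0) : vertexWeight w y ≠ 0 := by
  intro h0
  rw [vertexWeight, ENNReal.tsum_eq_zero] at h0
  have := h0 x
  rw [conduct_comm] at this
  exact h (by simpa using this)

/-- The terms of the Neumann series `∑ (D⁻¹ C)ᵏ D⁻¹ g`, where `C` is the conductance matrix and
`D` is multiplication by `μ_x + s`. -/
def neumannTerm (w : Env d₁ d₂) (s : ℝ) (g : OrthLat d₁ d₂ → ℝ) : ℕ → OrthLat d₁ d₂ → ℝ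
  | 0, x => g x / (vweight w x + s)
  | k + 1, x => (∑ y ∈ nbrs x, (conduct w x y : ℝ) * neumannTerm w s g k y) / (vweight w x + s)

theorem neumannTerm_nonneg (w : Env d₁ d₂) {s : ℝ} (hs : 0 < s) {g : OrthLat d₁ d₂ → ℝ}
    (hg : ∀ x, 0 ≤ g x) (k : ℕ) (x : OrthLat d₁ d₂) : 0 ≤ neumannTerm w s g k x := by
  induction k generalizing x with
  | zero => exact div_nonneg (hg x) (by linarith [vweight_nonneg w x])
  | succ k ih =>
    exact div_nonneg (Finset.sum_nonneg fun y _ => mul_nonneg (NNReal.coe_nonneg _) (ih y))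
      (by linarith [vweight_nonneg w x])

theorem neumannTerm_sub (w : Env d₁ d₂) (s : ℝ) (g g' : OrthLat d₁ d₂ → ℝ) (k : ℕ)
    (x : OrthLat d₁ d₂) :
    neumannTerm w s (fun x => g x - g' x) k x = neumannTerm w s g k x - neumannTerm w s g' k x := by
  induction k generalizing x with
  | zero => simp only [neumannTerm, sub_div]
  | succ k ih => simp only [neumannTerm, ih, mul_sub, Finset.sum_sub_distrib, sub_div]

theorem jumpLaw_singleton {w : Env d₁ d₂} {x : OrthLat d₁ d₂} (hx : vertexWeight w x ≠ 0)
    (y : OrthLat d₁ d₂) : jumpLaw w x {y} = conduct w x y / vertexWeight w x := by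
  rw [jumpLaw, dif_neg hx, PMF.toMeasure_apply_singleton _ _ (measurableSet_singleton _)]
  exact PMF.normalize_apply hx (vertexWeight_ne_top w x) y

/-- The Laplace transform μ_x/(μ_x + s) of the holding time cancels the normalisation μ_{xy}/μ_x of
the jump, which leaves the matrix D⁻¹C. -/
theorem discountStep_eq {w : Env d₁ d₂} {x : OrthLat d₁ d₂} (hx : vertexWeight w x ≠ 0) {s : ℝ}
    (hs : 0 < s) (ψ : OrthLat d₁ d₂ → ℝ≥0∞) :
    discountStep w s ψ x =
      ∑ y ∈ nbrs x, ENNReal.ofReal (conduct w x y / (vweight w x + s)) * ψ y := by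
  have hq := vweight_pos hx
  have h1 : ∫⁻ t, ENNReal.ofReal (Real.exp (-(s * t))) ∂(holdLaw w x) =
      ENNReal.ofReal (vweight w x / (vweight w x + s)) := by
    rw [holdLaw, if_neg hx]
    exact lintegral_exp_neg_expMeasure hq hs.le
  have h2 : ∫⁻ y, ψ y ∂(jumpLaw w x) =
      ∑ y ∈ nbrs x, ENNReal.ofReal (conduct w x y / vweight w x) * ψ y := by
    rw [lintegral_countable', tsum_eq_sum (s := nbrs x)]
    · refine Finset.sum_congr rfl fun y _ => ?_
      rw [jumpLaw_singleton hx, mul_comm, ENNReal.ofReal_div_of_pos hq, div_eq_mul_inv,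
        div_eq_mul_inv, vweight, ENNReal.ofReal_toReal (vertexWeight_ne_top w x)]
      simp
    · intro y hy
      rw [jumpLaw_singleton hx, conduct_eq_zero hy]
      simp
  rw [discountStep, h1, h2, Finset.mul_sum]
  refine Finset.sum_congr rfl fun y _ => ?_
  rw [← mul_assoc, ← ENNReal.ofReal_mul (by positivity)]
  congr 2
  field_simp

/-- The discounted reward collected during a stay. -/
def stayReward (s : ℝ) (g : OrthLat d₁ d₂ → ℝ) (z : OrthLat d₁ d₂ × ℝ) : ℝ :=
  g z.1 * (1 - Real.exp (-(s * z.2)))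

theorem measurable_stayReward (s : ℝ) (g : OrthLat d₁ d₂ → ℝ) : Measurable (stayReward s g) :=
  ((measurable_of_countable g).comp measurable_fst).mul (by fun_prop)

theorem holdAvg_stayReward {w : Env d₁ d₂} {x : OrthLat d₁ d₂} (hx : vertexWeight w x ≠ 0) {s : ℝ}
    (hs : 0 < s) {g : OrthLat d₁ d₂ → ℝ} (hg : ∀ x, 0 ≤ g x) :
    holdAvg w (fun z => ENNReal.ofReal (stayReward s g z)) x =
      ENNReal.ofReal (s * neumannTerm w s g 0 x) := by
  have hq := vweight_pos hx
  have h1 : ∫⁻ t, ENNReal.ofReal (Real.exp (-(s * t))) ∂(holdLaw w x) =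
      ENNReal.ofReal (vweight w x / (vweight w x + s)) := by
    rw [holdLaw, if_neg hx]
    exact lintegral_exp_neg_expMeasure hq hs.le
  simp only [holdAvg, stayReward, neumannTerm]
  simp only [ENNReal.ofReal_mul (hg x), ENNReal.ofReal_sub _ (Real.exp_pos _).le]
  rw [lintegral_const_mul _ (by fun_prop), lintegral_sub (by fun_prop) (by rw [h1]; simp), h1]
  · rw [ENNReal.ofReal_one, lintegral_one, measure_univ, ← ENNReal.ofReal_one,
      ← ENNReal.ofReal_sub _ (by positivity), ← ENNReal.ofReal_mul (hg x)]
    congr 1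
    field_simp
    ring
  · filter_upwards [ae_holdLaw_pos w x] with t ht
    refine ENNReal.ofReal_le_ofReal (Real.exp_le_one_iff.2 ?_)
    nlinarith

/-- One stay at x earns g(x)(1 - μ_x/(μ_x + s)) = s g(x)/(μ_x + s) on average, and each earlier jump
applies D⁻¹C. Vertices of zero weight are never reached: a neighbour joined by a positive
conductance has positive weight. -/
theorem discountStep_iterate_stayReward {w : Env d₁ d₂} {s : ℝ} (hs : 0 < s)
    {g : OrthLat d₁ d₂ → ℝ} (hg : ∀ x, 0 ≤ g x) (k : ℕ) {x : OrthLat d₁ d₂}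
    (hx : vertexWeight w x ≠ 0) :
    (discountStep w s)^[k] (holdAvg w fun z => ENNReal.ofReal (stayReward s g z)) x =
      ENNReal.ofReal (s * neumannTerm w s g k x) := by
  induction k generalizing x with
  | zero => exact holdAvg_stayReward hx hs hg
  | succ k ih =>
    have hq := vweight_pos hx
    rw [Function.iterate_succ_apply', discountStep_eq hx hs, neumannTerm, Finset.sum_div,
      Finset.mul_sum, ENNReal.ofReal_sum_of_nonneg]
    · refine Finset.sum_congr rfl fun y _ => ?_
      by_cases hc : conduct w x y = 0
      · simp [hc]
      · rw [ih (vertexWeight_ne_zero_of_conduct hc), ← ENNReal.ofReal_mul (by positivity)]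
        congr 1
        ring
    · intro y _
      have := neumannTerm_nonneg w hs hg k y
      positivity

/-- The discounted reward collected between the `k`-th and the `k + 1`-st jump. -/
def discountedReward (s : ℝ) (g : OrthLat d₁ d₂ → ℝ) (k : ℕ) (h : ℕ → OrthLat d₁ d₂ × ℝ) : ℝ :=
  g (h k).1 * (Real.exp (-(s * jumpTime h k)) - Real.exp (-(s * jumpTime h (k + 1))))

theorem discountedReward_eq (s : ℝ) (g : OrthLat d₁ d₂ → ℝ) (k : ℕ)
    (h : ℕ → OrthLat d₁ d₂ × ℝ) :
    discountedReward s g k h = Real.exp (-(s * jumpTime h k)) * stayReward s g (h k) := by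
  have : jumpTime h (k + 1) = jumpTime h k + (h k).2 := by
    simp only [jumpTime, Finset.sum_range_succ]
  rw [discountedReward, stayReward, this, mul_add, neg_add, Real.exp_add]
  ring

theorem measurable_discountedReward (s : ℝ) (g : OrthLat d₁ d₂ → ℝ) (k : ℕ) :
    Measurable (discountedReward s g k) := by
  have h1 := measurable_jumpTime (d₁ := d₁) (d₂ := d₂) k
  have h2 := measurable_jumpTime (d₁ := d₁) (d₂ := d₂) (k + 1)
  have h3 : Measurable fun h : ℕ → OrthLat d₁ d₂ × ℝ => g (h k).1 :=
    (measurable_of_countable g).comp (measurable_fst.comp (measurable_pi_apply k))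
  unfold discountedReward
  fun_prop

theorem jumpTime_le_succ {h : ℕ → OrthLat d₁ d₂ × ℝ} (hh : ∀ k, 0 < (h k).2) (k : ℕ) :
    jumpTime h k ≤ jumpTime h (k + 1) := by
  simp only [jumpTime, Finset.sum_range_succ]
  linarith [hh k]

theorem abs_discountedReward_le {s : ℝ} (hs : 0 < s) {g : OrthLat d₁ d₂ → ℝ} {B : ℝ}
    (hB : ∀ x, |g x| ≤ B) {h : ℕ → OrthLat d₁ d₂ × ℝ} (hh : ∀ k, 0 < (h k).2) (k : ℕ) :
    |discountedReward s g k h| ≤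
      B * (Real.exp (-(s * jumpTime h k)) - Real.exp (-(s * jumpTime h (k + 1)))) := by
  have : 0 ≤ Real.exp (-(s * jumpTime h k)) - Real.exp (-(s * jumpTime h (k + 1))) := by
    rw [sub_nonneg, Real.exp_le_exp]
    nlinarith [jumpTime_le_succ hh k]
  rw [discountedReward, abs_mul, abs_of_nonneg this]
  exact mul_le_mul_of_nonneg_right (hB _) this

/-- The discount differences telescope to at most 1. Only positivity of the holding times is needed,
so explosive trajectories are covered. -/
theorem sum_abs_discountedReward_le {s : ℝ} (hs : 0 < s) {g : OrthLat d₁ d₂ → ℝ} {B : ℝ}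
    (hB : ∀ x, |g x| ≤ B) {h : ℕ → OrthLat d₁ d₂ × ℝ} (hh : ∀ k, 0 < (h k).2) (n : ℕ) :
    ∑ k ∈ Finset.range n, |discountedReward s g k h| ≤ B := by
  have hB0 : 0 ≤ B := (abs_nonneg _).trans (hB (h 0).1)
  calc ∑ k ∈ Finset.range n, |discountedReward s g k h|
      ≤ ∑ k ∈ Finset.range n,
        B * (Real.exp (-(s * jumpTime h k)) - Real.exp (-(s * jumpTime h (k + 1)))) :=
        Finset.sum_le_sum fun k _ => abs_discountedReward_le hs hB hh k
    _ = B * (1 - Real.exp (-(s * jumpTime h n))) := by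
        rw [← Finset.mul_sum, Finset.sum_range_sub' (fun k => Real.exp (-(s * jumpTime h k)))]
        simp [jumpTime]
    _ ≤ B := by nlinarith [Real.exp_pos (-(s * jumpTime h n))]

theorem summable_abs_discountedReward {s : ℝ} (hs : 0 < s) {g : OrthLat d₁ d₂ → ℝ} {B : ℝ}
    (hB : ∀ x, |g x| ≤ B) {h : ℕ → OrthLat d₁ d₂ × ℝ} (hh : ∀ k, 0 < (h k).2) :
    Summable fun k => |discountedReward s g k h| :=
  summable_of_sum_range_le (fun _ => abs_nonneg _) (sum_abs_discountedReward_le hs hB hh)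

theorem abs_tsum_discountedReward_le {s : ℝ} (hs : 0 < s) {g : OrthLat d₁ d₂ → ℝ} {B : ℝ}
    (hB : ∀ x, |g x| ≤ B) {h : ℕ → OrthLat d₁ d₂ × ℝ} (hh : ∀ k, 0 < (h k).2) :
    |∑' k, discountedReward s g k h| ≤ B := by
  have h1 := summable_abs_discountedReward hs hB hh
  have h2 := norm_tsum_le_tsum_norm (f := fun k => discountedReward s g k h) h1
  exact h2.trans (Real.tsum_le_of_sum_range_le (fun _ => abs_nonneg _)
    (sum_abs_discountedReward_le hs hB hh))

theorem integrable_discountedReward (w : Env d₁ d₂) (x : OrthLat d₁ d₂) {s : ℝ} (hs : 0 < s)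
    {g : OrthLat d₁ d₂ → ℝ} {B : ℝ} (hB : ∀ x, |g x| ≤ B) (k : ℕ) :
    Integrable (discountedReward s g k) (trajLaw w x) := by
  refine Integrable.of_bound (measurable_discountedReward s g k).aestronglyMeasurable B ?_
  filter_upwards [ae_holding_pos w x] with h hh
  have h1 := sum_abs_discountedReward_le hs hB hh (k + 1)
  rw [Finset.sum_range_succ] at h1
  have h2 : 0 ≤ ∑ i ∈ Finset.range k, |discountedReward s g i h| :=
    Finset.sum_nonneg fun _ _ => abs_nonneg _
  rw [Real.norm_eq_abs]
  linarith

theorem integral_discountedReward {w : Env d₁ d₂} {x : OrthLat d₁ d₂} (hx : vertexWeight w x ≠ 0)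
    {s : ℝ} (hs : 0 < s) {g : OrthLat d₁ d₂ → ℝ} {B : ℝ} (hB : ∀ x, |g x| ≤ B) (k : ℕ) :
    ∫ h, discountedReward s g k h ∂(trajLaw w x) = s * neumannTerm w s g k x := by
  have hnonneg : ∀ g : OrthLat d₁ d₂ → ℝ, (∀ x, 0 ≤ g x) →
      ∫ h, discountedReward s g k h ∂(trajLaw w x) = s * neumannTerm w s g k x := by
    intro g hg
    rw [integral_eq_lintegral_of_nonneg_ae]
    · have h1 := lintegral_trajLaw w x s k (measurable_stayReward s g).ennreal_ofReal
      rw [discountStep_iterate_stayReward hs hg k hx] at h1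
      simp only [discountedReward_eq, ENNReal.ofReal_mul (Real.exp_pos _).le]
      rw [h1, ENNReal.toReal_ofReal (mul_nonneg hs.le (neumannTerm_nonneg w hs hg k x))]
    · filter_upwards [ae_holding_pos w x] with h hh
      rw [Pi.zero_apply, discountedReward]
      refine mul_nonneg (hg _) ?_
      rw [sub_nonneg, Real.exp_le_exp]
      nlinarith [jumpTime_le_succ hh k]
    · exact (measurable_discountedReward s g k).aestronglyMeasurable
  have hsplit : g = fun x => (g x)⁺ - (g x)⁻ := by
    funext x; exact (posPart_sub_negPart _).symm
  have hp : ∀ x, |(g x)⁺| ≤ B := fun x => by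
    rw [abs_of_nonneg (posPart_nonneg _)]
    exact (sup_le (le_abs_self _) (abs_nonneg _)).trans (hB x)
  have hn : ∀ x, |(g x)⁻| ≤ B := fun x => by
    rw [abs_of_nonneg (negPart_nonneg _)]
    exact (sup_le (neg_le_abs _) (abs_nonneg _)).trans (hB x)
  have e1 : ∀ h, discountedReward s g k h =
      discountedReward s (fun x => (g x)⁺) k h - discountedReward s (fun x => (g x)⁻) k h := by
    intro h
    simp only [discountedReward, ← sub_mul, posPart_sub_negPart]
  simp only [e1]
  rw [integral_sub (integrable_discountedReward w x hs hp k)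
    (integrable_discountedReward w x hs hn k), hnonneg _ fun x => posPart_nonneg _,
    hnonneg _ fun x => negPart_nonneg _, ← mul_sub, ← neumannTerm_sub, ← hsplit]

/-- Probabilistic meaning of the Neumann series: the expected discounted reward collected up to the
possibly finite explosion time. The telescoping bound justifies exchanging sum and expectation. -/
theorem hasSum_neumannTerm {w : Env d₁ d₂} {x : OrthLat d₁ d₂} (hx : vertexWeight w x ≠ 0)
    {s : ℝ} (hs : 0 < s) {g : OrthLat d₁ d₂ → ℝ} {B : ℝ} (hB : ∀ x, |g x| ≤ B) :
    HasSum (fun k => s * neumannTerm w s g k x)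
      (∫ h, ∑' k, discountedReward s g k h ∂(trajLaw w x)) := by
  simp only [← integral_discountedReward hx hs hB]
  refine hasSum_integral_of_summable_integral_norm
    (fun k => integrable_discountedReward w x hs hB k) ?_
  refine summable_of_sum_range_le (c := B) (fun k => integral_nonneg fun _ => norm_nonneg _)
    fun n => ?_
  rw [← integral_finsetSum _ fun k _ => (integrable_discountedReward w x hs hB k).norm]
  have h1 : ∫ h, (∑ k ∈ Finset.range n, ‖discountedReward s g k h‖) ∂(trajLaw w x) ≤
      ∫ _, B ∂(trajLaw w x) := by
    refine integral_mono_ae (integrable_finsetSum _ fun k _ =>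
      (integrable_discountedReward w x hs hB k).norm) (integrable_const _) ?_
    filter_upwards [ae_holding_pos w x] with h hh
    exact sum_abs_discountedReward_le hs hB hh n
  simpa using h1

theorem summable_neumannTerm (w : Env d₁ d₂) (x : OrthLat d₁ d₂) {s : ℝ} (hs : 0 < s)
    {g : OrthLat d₁ d₂ → ℝ} {B : ℝ} (hB : ∀ x, |g x| ≤ B) :
    Summable fun k => neumannTerm w s g k x := by
  by_cases hx : vertexWeight w x = 0
  -- At a vertex without open edges only the term k = 0 can be nonzero.
  · refine summable_of_hasFiniteSupport ((finite_singleton 0).subset fun k hk => ?_)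
    rcases k with _ | k
    · rfl
    · refine absurd ?_ hk
      have hc : ∀ y, conduct w x y = 0 := by
        rw [vertexWeight, ENNReal.tsum_eq_zero] at hx
        exact fun y => by simpa using hx y
      simp [neumannTerm, hc]
  · have := (hasSum_neumannTerm hx hs hB).summable.mul_left s⁻¹
    simpa [← mul_assoc, inv_mul_cancel₀ hs.ne'] using this

end

noncomputable section

variable {d₁ d₂ : ℕ}

/-! ### The rescaled path and its exponential averages -/

theorem measurableSet_nonExplosive :
    MeasurableSet {h : ℕ → OrthLat d₁ d₂ × ℝ | NonExplosive h} := by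
  have h1 : MeasurableSet {h : ℕ → OrthLat d₁ d₂ × ℝ | ∀ k, 0 < (h k).2} := by
    have : {h : ℕ → OrthLat d₁ d₂ × ℝ | ∀ k, 0 < (h k).2} = ⋂ k, {h | 0 < (h k).2} := by
      ext; simp
    rw [this]
    exact MeasurableSet.iInter fun k => measurableSet_lt measurable_const
      (measurable_snd.comp (measurable_pi_apply k))
  have h2 : MeasurableSet {h : ℕ → OrthLat d₁ d₂ × ℝ | Tendsto (jumpTime h) atTop atTop} :=
    measurableSet_tendsto (f := fun k h => jumpTime h k) atTop
      (fun k => measurable_jumpTime (d₁ := d₁) (d₂ := d₂) k)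
  exact h1.inter h2

theorem measurable_jumpCount (u : ℝ) :
    Measurable fun h : ℕ → OrthLat d₁ d₂ × ℝ => jumpCount h u := by
  refine measurable_of_Iic fun n => ?_
  have hlt : ∀ k, MeasurableSet {h : ℕ → OrthLat d₁ d₂ × ℝ | u < jumpTime h (k + 1)} := fun k =>
    measurableSet_lt measurable_const (measurable_jumpTime (k + 1))
  -- The second set accounts for trajectories on which no jump time exceeds u, where the infimum of
  -- the empty set is 0.
  have : (fun h : ℕ → OrthLat d₁ d₂ × ℝ => jumpCount h u) ⁻¹' Iic n =
      (⋃ k ∈ Iic n, {h | u < jumpTime h (k + 1)}) ∪ ⋂ k, {h | u < jumpTime h (k + 1)}ᶜ := by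
    ext h
    simp only [mem_preimage, mem_Iic, mem_union, mem_iUnion, mem_iInter, exists_prop]
    constructor
    · intro hle
      by_cases hne : ∃ k, u < jumpTime h (k + 1)
      · exact Or.inl ⟨_, hle, Nat.sInf_mem (s := {k | u < jumpTime h (k + 1)}) hne⟩
      · right
        push Not at hne
        intro k hk
        exact absurd hk (not_lt.2 (hne k))
    · rintro (⟨k, hk, hu⟩ | hall)
      · exact (Nat.sInf_le (s := {k | u < jumpTime h (k + 1)}) hu).trans hk
      · have : {k | u < jumpTime h (k + 1)} = ∅ :=
          eq_empty_of_forall_notMem fun k hk => hall k hk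
        simp [jumpCount, this]
  rw [this]
  exact (MeasurableSet.biUnion (to_countable _) fun k _ => hlt k).union
    (MeasurableSet.iInter fun k => (hlt k).compl)

theorem measurable_walkAt (u : ℝ) :
    Measurable fun h : ℕ → OrthLat d₁ d₂ × ℝ => walkAt h u := by
  have h1 : Measurable fun q : (ℕ → OrthLat d₁ d₂ × ℝ) × ℕ => (q.1 q.2).1 :=
    measurable_from_prod_countable_left fun k => measurable_fst.comp (measurable_pi_apply k)
  exact h1.comp (measurable_id.prodMk (measurable_jumpCount u))

theorem measurable_scaledPath (n : ℕ) :
    Measurable (scaledPath (d₁ := d₁) (d₂ := d₂) n) := by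
  classical
  refine measurable_comap_iff.2 (measurable_pi_lambda _ fun t => ?_)
  have : (fun h => (CadlagPath.toFun ∘ scaledPath (d₁ := d₁) (d₂ := d₂) n) h t) = fun h =>
      if NonExplosive h then scaledPt n (walkAt h ((n : ℝ) ^ 2 * t)) else ⟨0, fun _ => le_rfl⟩ := by
    funext h
    simp only [Function.comp, scaledPath]
    split_ifs <;> rfl
  rw [this]
  exact Measurable.ite measurableSet_nonExplosive
    ((measurable_of_countable (scaledPt n)).comp (measurable_walkAt _)) measurable_const

theorem integral_scaledWalkLaw (w : Env d₁ d₂) (n : ℕ) (x : OrthLat d₁ d₂)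
    {F : CadlagPath (Dbar d₁ d₂) → ℝ} (hF : Measurable F) :
    ∫ p, F p ∂(scaledWalkLaw w n x) =
      ∫ h in {h | NonExplosive h}, F (scaledPath n h) ∂(trajLaw w x) :=
  integral_map (measurable_scaledPath n).aemeasurable hF.aestronglyMeasurable

theorem jumpCount_eq {h : ℕ → OrthLat d₁ d₂ × ℝ} (hh : NonExplosive h) {u : ℝ} {k : ℕ}
    (h1 : jumpTime h k ≤ u) (h2 : u < jumpTime h (k + 1)) : jumpCount h u = k := by
  refine le_antisymm (Nat.sInf_le h2) ?_
  by_contra hlt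
  have hr : u < jumpTime h (jumpCount h u + 1) := Nat.sInf_mem (hh.exists_lt u)
  have := hh.jumpTime_mono (Nat.succ_le_of_lt (not_le.1 hlt))
  exact absurd (hr.trans_le this) (not_lt.2 h1)

theorem jumpTime_jumpCount_le {h : ℕ → OrthLat d₁ d₂ × ℝ} {u : ℝ} (hu : 0 ≤ u) :
    jumpTime h (jumpCount h u) ≤ u := by
  rcases hj : jumpCount h u with _ | j
  · simpa [jumpTime] using hu
  · by_contra hlt
    have := Nat.sInf_le (s := {k | u < jumpTime h (k + 1)}) (not_le.1 hlt)
    change jumpCount h u ≤ j at this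
    omega

/-- The rescaled path is constant on [T_k/n², T_{k+1}/n²), T_k being the k-th jump time, and the
exponential law of rate r gives this interval the mass e^{-sT_k} - e^{-sT_{k+1}} with s = r/n².
Non-explosion makes these intervals exhaust the half-line. -/
theorem expAverage_scaledPath {n : ℕ} (hn : n ≠ 0) {h : ℕ → OrthLat d₁ d₂ × ℝ}
    (hh : NonExplosive h) {r : ℝ} (hr : 0 < r) {f : Dbar d₁ d₂ → ℝ} (hf : Continuous f) {B : ℝ}
    (hB : ∀ y, |f y| ≤ B) :
    CadlagPath.expAverage r f (scaledPath n h) =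
      ∑' k, discountedReward (r / (n : ℝ) ^ 2) (fun x => f (scaledPt n x)) k h := by
  have := isProbabilityMeasure_expMeasure hr
  have hn2 : (0 : ℝ) < (n : ℝ) ^ 2 := by positivity
  set a : ℕ → ℝ := fun k => jumpTime h k / (n : ℝ) ^ 2 with ha
  have ha0 : ∀ k, 0 ≤ a k := fun k => by
    have h1 := hh.jumpTime_mono (Nat.zero_le k)
    have h2 : jumpTime h 0 = 0 := by simp [jumpTime]
    exact div_nonneg (by linarith) hn2.le
  have hamono : Monotone a := fun i j hij =>
    div_le_div_of_nonneg_right (hh.jumpTime_mono hij) hn2.le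
  set φ : ℝ → ℝ := fun t => f (scaledPath n h t.toNNReal) with hφ
  have hφm : Measurable φ := hf.measurable.comp (CadlagPath.measurable_uncurry.comp
    (measurable_const.prodMk measurable_real_toNNReal))
  have hφi : Integrable φ (expMeasure r) :=
    Integrable.of_bound hφm.aestronglyMeasurable B (ae_of_all _ fun t => hB _)
  have hpath : ∀ t : ℝ≥0, scaledPath n h t = scaledPt n (walkAt h ((n : ℝ) ^ 2 * t)) := by
    intro t
    simp only [scaledPath, dif_pos hh]
    rfl
  have hU : ⋃ k, Ico (a k) (a (k + 1)) = Ici 0 := by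
    ext t
    simp only [mem_iUnion, mem_Ici]
    constructor
    · rintro ⟨k, hk⟩
      exact (ha0 k).trans hk.1
    · intro ht
      refine ⟨jumpCount h ((n : ℝ) ^ 2 * t), ?_, ?_⟩
      · rw [ha, div_le_iff₀ hn2, mul_comm]
        exact jumpTime_jumpCount_le (by positivity)
      · rw [ha, lt_div_iff₀ hn2, mul_comm]
        exact Nat.sInf_mem (hh.exists_lt _)
  have hsum := hasSum_integral_iUnion (f := φ) (μ := expMeasure r)
    (fun k => measurableSet_Ico (a := a k) (b := a (k + 1)))
    hamono.pairwise_disjoint_on_Ico_succ hφi.integrableOn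
  rw [hU] at hsum
  have hres : ∫ t in Ici 0, φ t ∂(expMeasure r) = CadlagPath.expAverage r f (scaledPath n h) := by
    rw [Measure.restrict_eq_self_of_ae_mem]
    · rfl
    · filter_upwards [ae_expMeasure_pos r] with t ht
      exact ht.le
  rw [hres] at hsum
  rw [← hsum.tsum_eq]
  refine tsum_congr fun k => ?_
  have hconst : ∀ t ∈ Ico (a k) (a (k + 1)), φ t = f (scaledPt n (h k).1) := by
    intro t ht
    have ht0 : 0 ≤ t := (ha0 k).trans ht.1
    have h1 : jumpTime h k ≤ (n : ℝ) ^ 2 * t := by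
      have := ht.1
      rw [ha, div_le_iff₀ hn2] at this
      linarith
    have h2 : (n : ℝ) ^ 2 * t < jumpTime h (k + 1) := by
      have := ht.2
      rw [ha, lt_div_iff₀ hn2] at this
      linarith
    simp only [hφ, hpath, Real.coe_toNNReal t ht0, walkAt, jumpCount_eq hh h1 h2]
  rw [setIntegral_congr_fun measurableSet_Ico hconst, setIntegral_const,
    expMeasure_real_Ico hr (ha0 k) (hamono (Nat.le_succ k)), discountedReward, smul_eq_mul, mul_comm]
  simp only [ha]
  congr 4 <;> ring

/-- The resolvent of the walk, compared with the exponential average over its path. -/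
theorem abs_integral_expAverage_sub_le {w : Env d₁ d₂} {x : OrthLat d₁ d₂}
    (hx : vertexWeight w x ≠ 0) {n : ℕ} (hn : n ≠ 0) {r : ℝ} (hr : 0 < r) {f : Dbar d₁ d₂ → ℝ}
    (hf : Continuous f) {B : ℝ} (hB : ∀ y, |f y| ≤ B) :
    |∫ p, CadlagPath.expAverage r f p ∂(scaledWalkLaw w n x) -
      r / (n : ℝ) ^ 2 * ∑' k, neumannTerm w (r / (n : ℝ) ^ 2) (fun x => f (scaledPt n x)) k x| ≤
      B * (1 - ∫ _, (1 : ℝ) ∂(scaledWalkLaw w n x)) := by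
  have hs : 0 < r / (n : ℝ) ^ 2 := by positivity
  set s := r / (n : ℝ) ^ 2
  have hB' : ∀ x : OrthLat d₁ d₂, |f (scaledPt n x)| ≤ B := fun x => hB _
  set S : Set (ℕ → OrthLat d₁ d₂ × ℝ) := {h | NonExplosive h} with hS
  have hSm : MeasurableSet S := measurableSet_nonExplosive
  set Φ : (ℕ → OrthLat d₁ d₂ × ℝ) → ℝ := fun h =>
    ∑' k, discountedReward s (fun x => f (scaledPt n x)) k h with hΦ
  have hΦm : Measurable Φ := Measurable.tsum fun k => measurable_discountedReward s _ k
  have hΦb : ∀ᵐ h ∂(trajLaw w x), ‖Φ h‖ ≤ B := by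
    filter_upwards [ae_holding_pos w x] with h hh
    exact abs_tsum_discountedReward_le hs hB' hh
  have hΦi : Integrable Φ (trajLaw w x) := Integrable.of_bound hΦm.aestronglyMeasurable B hΦb
  -- Both quantities are integrals of Φ, one over the non-explosive trajectories and one over all of
  -- them. The difference is carried by the explosive ones, whose probability is the mass missing
  -- from `scaledWalkLaw`.
  rw [← tsum_mul_left, (hasSum_neumannTerm hx hs hB').tsum_eq,
    integral_scaledWalkLaw w n x (CadlagPath.measurable_expAverage hr hf),
    integral_scaledWalkLaw w n x measurable_const,
    setIntegral_congr_fun hSm fun h hh => expAverage_scaledPath hn hh hr hf hB,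
    ← integral_add_compl hSm hΦi, sub_add_cancel_left, abs_neg, setIntegral_const, smul_eq_mul,
    mul_one, ← probReal_compl_eq_one_sub hSm]
  exact norm_setIntegral_le_of_norm_le_const_ae (measure_lt_top _ _)
    (ae_restrict_of_ae hΦb)

end

noncomputable section

variable {d₁ d₂ : ℕ}

/-! ### The Dirichlet form of a symmetric diffusion, from its resolvent -/

/-- A concave sequence starting at 0 has nonincreasing slopes a n / n. -/
theorem le_mul_of_midpoint_concave {a : ℕ → ℝ} (h0 : a 0 = 0)
    (hconc : ∀ j, a j + a (j + 2) ≤ 2 * a (j + 1)) {i n : ℕ} (hin : i ≤ n) :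
    i * a n ≤ n * a i := by
  have hstep : ∀ n : ℕ, n * a (n + 1) ≤ (n + 1) * a n := by
    intro n
    induction n with
    | zero => simp [h0]
    | succ n ih =>
      have := hconc n
      push_cast
      nlinarith
  induction n, hin using Nat.le_induction with
  | base => exact le_rfl
  | succ n hin ih =>
    rcases Nat.eq_zero_or_pos n with rfl | hn
    · obtain rfl : i = 0 := by omega
      simp [h0]
    · have h1 := hstep n
      have hn' : (0 : ℝ) < n := by exact_mod_cast hn
      have hi : (0 : ℝ) ≤ i := Nat.cast_nonneg i
      push_cast
      have h2 : (n : ℝ) * (i * a (n + 1)) ≤ n * ((n + 1) * a i) := by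
        nlinarith [mul_le_mul_of_nonneg_left h1 hi]
      exact le_of_mul_le_mul_left h2 hn'

namespace IsSymmetricDiffusion

variable {m : Measure (Dbar d₁ d₂)} {X : Kernel (Dbar d₁ d₂) (CadlagPath (Dbar d₁ d₂))}

theorem integrable_eval (hX : IsSymmetricDiffusion m X) {f : Dbar d₁ d₂ → ℝ} (hf : Measurable f)
    {B : ℝ} (hB : ∀ y, |f y| ≤ B) (t : ℝ≥0) (x : Dbar d₁ d₂) :
    Integrable (fun p : CadlagPath (Dbar d₁ d₂) => f (p t)) (X x) := by
  have := hX.conservative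
  exact Integrable.of_bound (hf.comp (CadlagPath.measurable_eval t)).aestronglyMeasurable B
    (ae_of_all _ fun p => hB _)

theorem measurable_semigroup (hX : IsSymmetricDiffusion m X) {f : Dbar d₁ d₂ → ℝ}
    (hf : Measurable f) (t : ℝ≥0) : Measurable (semigroup X t f) := by
  have := hX.conservative
  have h : StronglyMeasurable fun p : CadlagPath (Dbar d₁ d₂) => f (p t) :=
    (hf.comp (CadlagPath.measurable_eval t)).stronglyMeasurable
  exact h.integral_kernel.measurable

theorem abs_semigroup_le (hX : IsSymmetricDiffusion m X) {f : Dbar d₁ d₂ → ℝ}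
    {B : ℝ} (hB : ∀ y, |f y| ≤ B) (t : ℝ≥0) (x : Dbar d₁ d₂) : |semigroup X t f x| ≤ B := by
  have := hX.conservative
  have := norm_integral_le_of_norm_le_const (μ := X x)
    (f := fun p : CadlagPath (Dbar d₁ d₂) => f (p t)) (C := B) (ae_of_all _ fun p => hB _)
  simpa [semigroup] using this

theorem semigroup_sub (hX : IsSymmetricDiffusion m X) {f g : Dbar d₁ d₂ → ℝ} (hf : Measurable f)
    (hg : Measurable g) {B : ℝ} (hB : ∀ y, |f y| ≤ B) (hB' : ∀ y, |g y| ≤ B) (t : ℝ≥0)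
    (x : Dbar d₁ d₂) :
    semigroup X t (fun y => f y - g y) x = semigroup X t f x - semigroup X t g x :=
  integral_sub (hX.integrable_eval hf hB t x) (hX.integrable_eval hg hB' t x)

theorem semigroup_add (hX : IsSymmetricDiffusion m X) {f : Dbar d₁ d₂ → ℝ} (hf : Measurable f)
    {B : ℝ} (hB : ∀ y, |f y| ≤ B) (s t : ℝ≥0) (x : Dbar d₁ d₂) :
    semigroup X s (semigroup X t f) x = semigroup X (s + t) f x := by
  have := hX.conservative
  have hev : ∀ t, Measurable fun p : CadlagPath (Dbar d₁ d₂) => p t := CadlagPath.measurable_eval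
  have hK : ∀ t, IsMarkovKernel (X.map fun p => p t) := fun t => Kernel.IsMarkovKernel.map _ (hev t)
  have hcomp : (X.map fun p => p t) ∘ₖ (X.map fun p => p s) = X.map fun p => p (s + t) := by
    ext y B hB
    have h1 := hX.markov y s t univ MeasurableSet.univ B hB
    rw [Kernel.comp_apply' _ _ _ hB, Kernel.map_apply' _ (hev _) _ hB, Kernel.map_apply _ (hev _),
      lintegral_map ((X.map fun p => p t).measurable_coe hB) (hev s)]
    simp only [univ_inter, Measure.restrict_univ] at h1
    refine Eq.trans ?_ h1.symm
    refine lintegral_congr fun p => ?_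
    rw [Kernel.map_apply' _ (hev _) _ hB]
    rfl
  have hsg : ∀ t (g : Dbar d₁ d₂ → ℝ), Measurable g → ∀ y,
      ∫ z, g z ∂((X.map fun p => p t) y) = semigroup X t g y := by
    intro t g hg y
    rw [Kernel.map_apply _ (hev t), integral_map (hev t).aemeasurable hg.aestronglyMeasurable]
    rfl
  rw [← hsg (s + t) f hf, ← hcomp, Kernel.integral_comp, ← hsg s _ (hX.measurable_semigroup hf t)]
  · simp only [hsg t f hf]
  · exact Integrable.of_bound hf.aestronglyMeasurable B (ae_of_all _ hB)

theorem ofReal_semigroup (hX : IsSymmetricDiffusion m X) {f : Dbar d₁ d₂ → ℝ} (hf : Measurable f)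
    (hf0 : ∀ y, 0 ≤ f y) {B : ℝ} (hB : ∀ y, |f y| ≤ B) (t : ℝ≥0) (x : Dbar d₁ d₂) :
    ENNReal.ofReal (semigroup X t f x) = ∫⁻ p, ENNReal.ofReal (f (p t)) ∂(X x) :=
  ofReal_integral_eq_lintegral_ofReal (hX.integrable_eval hf hB t x) (ae_of_all _ fun _ => hf0 _)

theorem semigroup_nonneg {f : Dbar d₁ d₂ → ℝ} (hf0 : ∀ y, 0 ≤ f y) (t : ℝ≥0) (x : Dbar d₁ d₂) :
    0 ≤ semigroup X t f x := integral_nonneg fun _ => hf0 _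

theorem semigroup_one (hX : IsSymmetricDiffusion m X) (t : ℝ≥0) (x : Dbar d₁ d₂) :
    semigroup X t (fun _ => 1) x = 1 := by
  have := hX.conservative
  simp [semigroup]

theorem lintegral_symm (hX : IsSymmetricDiffusion m X) {f g : Dbar d₁ d₂ → ℝ} (hf : Measurable f)
    (hg : Measurable g) (hf0 : ∀ y, 0 ≤ f y) (hg0 : ∀ y, 0 ≤ g y) {B : ℝ} (hB : ∀ y, |f y| ≤ B)
    (hB' : ∀ y, |g y| ≤ B) (t : ℝ≥0) :
    ∫⁻ x, ENNReal.ofReal (f x * semigroup X t g x) ∂m =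
      ∫⁻ x, ENNReal.ofReal (g x * semigroup X t f x) ∂m := by
  have := hX.symmetric t (fun y => ENNReal.ofReal (f y)) (fun y => ENNReal.ofReal (g y))
    hf.ennreal_ofReal hg.ennreal_ofReal
  simp only [← hX.ofReal_semigroup hf hf0 hB, ← hX.ofReal_semigroup hg hg0 hB',
    ← ENNReal.ofReal_mul (hf0 _), ← ENNReal.ofReal_mul (hg0 _)] at this
  exact this

/-- Symmetry against the constant 1, together with conservativeness, gives ∫ P_t|f| dm = ∫ |f| dm
even when m is infinite. The bound max B 1 covers |f| and the constant at once. -/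
theorem integrable_semigroup (hX : IsSymmetricDiffusion m X) {f : Dbar d₁ d₂ → ℝ}
    (hf : Measurable f) {B : ℝ} (hB : ∀ y, |f y| ≤ B) (hfi : Integrable f m) (t : ℝ≥0) :
    Integrable (semigroup X t f) m := by
  have hB0 : ∀ y, |(|f y|)| ≤ max B 1 := fun y => by rw [abs_abs]; exact (hB y).trans (le_max_left _ _)
  have h1 := hX.lintegral_symm (t := t) (f := fun _ => 1) (g := fun y => |f y|) measurable_const
    hf.abs (fun _ => zero_le_one) (fun _ => abs_nonneg _) (B := max B 1)
    (fun y => by simp) hB0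
  simp only [one_mul, hX.semigroup_one, mul_one] at h1
  refine ⟨(hX.measurable_semigroup hf t).aestronglyMeasurable, ?_⟩
  rw [hasFiniteIntegral_iff_norm]
  refine lt_of_le_of_lt ?_ (hfi.norm.lintegral_lt_top)
  simp only [Real.norm_eq_abs]
  rw [← h1]
  refine lintegral_mono fun x => ENNReal.ofReal_le_ofReal ?_
  exact abs_integral_le_integral_abs

/-- Symmetry is given for nonnegative extended functions only. It extends to signed ones by
splitting into positive and negative parts; integrability of one factor and boundedness of both
suffice. -/
theorem integral_symm (hX : IsSymmetricDiffusion m X) {f g : Dbar d₁ d₂ → ℝ} (hf : Measurable f)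
    (hg : Measurable g) {B : ℝ} (hB : ∀ y, |f y| ≤ B) (hB' : ∀ y, |g y| ≤ B) (hfi : Integrable f m)
    (t : ℝ≥0) : ∫ x, f x * semigroup X t g x ∂m = ∫ x, g x * semigroup X t f x ∂m := by
  have hint1 : ∀ f g : Dbar d₁ d₂ → ℝ, Measurable g → (∀ y, |g y| ≤ B) →
      Integrable f m → Integrable (fun x => f x * semigroup X t g x) m := fun f g hg hB' hfi =>
    hfi.mul_bdd (c := B) (hX.measurable_semigroup hg t).aestronglyMeasurable
      (ae_of_all _ fun x => hX.abs_semigroup_le hB' t x)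
  have hint2 : ∀ f g : Dbar d₁ d₂ → ℝ, Measurable f → Measurable g → (∀ y, |f y| ≤ B) →
      (∀ y, |g y| ≤ B) → Integrable f m → Integrable (fun x => g x * semigroup X t f x) m :=
    fun f g hf hg hB hB' hfi => (hX.integrable_semigroup hf hB hfi t).bdd_mul (c := B)
      hg.aestronglyMeasurable (ae_of_all _ hB')
  have hnn : ∀ f g : Dbar d₁ d₂ → ℝ, Measurable f → Measurable g → (∀ y, 0 ≤ f y) → (∀ y, 0 ≤ g y) →
      (∀ y, |f y| ≤ B) → (∀ y, |g y| ≤ B) → Integrable f m →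
      ∫ x, f x * semigroup X t g x ∂m = ∫ x, g x * semigroup X t f x ∂m := by
    intro f g hf hg hf0 hg0 hB hB' hfi
    rw [integral_eq_lintegral_of_nonneg_ae (ae_of_all _ fun x =>
        mul_nonneg (hf0 x) (semigroup_nonneg hg0 t x)) (hint1 f g hg hB' hfi).aestronglyMeasurable,
      integral_eq_lintegral_of_nonneg_ae (ae_of_all _ fun x =>
        mul_nonneg (hg0 x) (semigroup_nonneg hf0 t x))
        (hint2 f g hf hg hB hB' hfi).aestronglyMeasurable,
      hX.lintegral_symm hf hg hf0 hg0 hB hB']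
  have hpm : ∀ {f : Dbar d₁ d₂ → ℝ}, Measurable f → Measurable fun y => (f y)⁺ := fun hf =>
    hf.max measurable_const
  have hnm : ∀ {f : Dbar d₁ d₂ → ℝ}, Measurable f → Measurable fun y => (f y)⁻ := fun hf =>
    hf.neg.max measurable_const
  have hpb : ∀ {f : Dbar d₁ d₂ → ℝ}, (∀ y, |f y| ≤ B) → ∀ y, |(f y)⁺| ≤ B := fun hB y => by
    rw [abs_of_nonneg (posPart_nonneg _)]
    exact (sup_le (le_abs_self _) (abs_nonneg _)).trans (hB y)
  have hnb : ∀ {f : Dbar d₁ d₂ → ℝ}, (∀ y, |f y| ≤ B) → ∀ y, |(f y)⁻| ≤ B := fun hB y => by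
    rw [abs_of_nonneg (negPart_nonneg _)]
    exact (sup_le (neg_le_abs _) (abs_nonneg _)).trans (hB y)
  have hg1 : ∀ f : Dbar d₁ d₂ → ℝ, Measurable f → (∀ y, 0 ≤ f y) → (∀ y, |f y| ≤ B) →
      Integrable f m → ∫ x, f x * semigroup X t g x ∂m = ∫ x, g x * semigroup X t f x ∂m := by
    intro f hf hf0 hB hfi
    have e1 : ∀ x, semigroup X t g x =
        semigroup X t (fun y => (g y)⁺) x - semigroup X t (fun y => (g y)⁻) x := fun x => by
      rw [← hX.semigroup_sub (hpm hg) (hnm hg) (hpb hB') (hnb hB')]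
      simp only [posPart_sub_negPart]
    have e2 : ∀ x, g x * semigroup X t f x =
        (g x)⁺ * semigroup X t f x - (g x)⁻ * semigroup X t f x := fun x => by
      rw [← sub_mul, posPart_sub_negPart]
    simp only [e2]
    simp only [e1, mul_sub]
    rw [integral_sub (hint1 _ _ (hpm hg) (hpb hB') hfi) (hint1 _ _ (hnm hg) (hnb hB') hfi),
      integral_sub (hint2 _ _ hf (hpm hg) hB (hpb hB') hfi)
        (hint2 _ _ hf (hnm hg) hB (hnb hB') hfi),
      hnn _ _ hf (hpm hg) hf0 (fun _ => posPart_nonneg _) hB (hpb hB') hfi,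
      hnn _ _ hf (hnm hg) hf0 (fun _ => negPart_nonneg _) hB (hnb hB') hfi]
  have e1 : ∀ x, semigroup X t f x =
      semigroup X t (fun y => (f y)⁺) x - semigroup X t (fun y => (f y)⁻) x := fun x => by
    rw [← hX.semigroup_sub (hpm hf) (hnm hf) (hpb hB) (hnb hB)]
    simp only [posPart_sub_negPart]
  have e2 : ∀ x, f x * semigroup X t g x =
      (f x)⁺ * semigroup X t g x - (f x)⁻ * semigroup X t g x := fun x => by
    rw [← sub_mul, posPart_sub_negPart]
  have hpi : Integrable (fun x => (f x)⁺) m := hfi.pos_part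
  have hni : Integrable (fun x => (f x)⁻) m := hfi.neg_part
  simp only [e2]
  simp only [e1, mul_sub]
  rw [integral_sub (hint1 _ _ hg hB' hpi) (hint1 _ _ hg hB' hni),
    integral_sub (hint2 _ _ (hpm hf) hg (hpb hB) hB' hpi) (hint2 _ _ (hnm hf) hg (hnb hB) hB' hni),
    hg1 _ (hpm hf) (fun _ => posPart_nonneg _) (hpb hB) hpi,
    hg1 _ (hnm hf) (fun _ => negPart_nonneg _) (hnb hB) hni]

end IsSymmetricDiffusion

end

/-! ### Concavity of (f - P_t f, f) in time, and recovery of the form from the resolvent. -/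

noncomputable section

variable {d₁ d₂ : ℕ}

namespace IsSymmetricDiffusion

variable {m : Measure (Dbar d₁ d₂)} {X : Kernel (Dbar d₁ d₂) (CadlagPath (Dbar d₁ d₂))}

theorem integral_semigroup_mul_semigroup (hX : IsSymmetricDiffusion m X) {f : Dbar d₁ d₂ → ℝ}
    (hf : Measurable f) {B : ℝ} (hB : ∀ y, |f y| ≤ B) (hfi : Integrable f m) (s t : ℝ≥0) :
    ∫ x, semigroup X s f x * semigroup X t f x ∂m = ∫ x, f x * semigroup X (s + t) f x ∂m := by
  rw [hX.integral_symm (hX.measurable_semigroup hf s) hf (hX.abs_semigroup_le hB s) hB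
    (hX.integrable_semigroup hf hB hfi s), add_comm s t]
  simp only [hX.semigroup_add hf hB]

theorem semigroup_zero (hX : IsSymmetricDiffusion m X) (f : Dbar d₁ d₂ → ℝ) (x : Dbar d₁ d₂) :
    semigroup X 0 f x = f x := by
  have := hX.conservative
  have : semigroup X 0 f x = ∫ _, f x ∂(X x) := by
    refine integral_congr_ae ?_
    filter_upwards [hX.start x] with p hp
    rw [hp]
  simpa using this

theorem integrable_semigroup_mul (hX : IsSymmetricDiffusion m X) {f : Dbar d₁ d₂ → ℝ}
    (hf : Measurable f) {B : ℝ} (hB : ∀ y, |f y| ≤ B) (hfi : Integrable f m) (s t : ℝ≥0) :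
    Integrable (fun x => semigroup X s f x * semigroup X t f x) m :=
  (hX.integrable_semigroup hf hB hfi s).mul_bdd (c := B)
    (hX.measurable_semigroup hf t).aestronglyMeasurable
    (ae_of_all _ fun x => hX.abs_semigroup_le hB t x)

/-- This is ‖P_s f - P_t f‖² ≥ 0, expanded with (P_s f, P_t f) = (f, P_{s+t} f). -/
theorem midpoint_convex (hX : IsSymmetricDiffusion m X) {f : Dbar d₁ d₂ → ℝ}
    (hf : Measurable f) {B : ℝ} (hB : ∀ y, |f y| ≤ B) (hfi : Integrable f m) (s t : ℝ≥0) :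
    2 * ∫ x, f x * semigroup X (s + t) f x ∂m ≤
      ∫ x, f x * semigroup X (s + s) f x ∂m + ∫ x, f x * semigroup X (t + t) f x ∂m := by
  have h0 : 0 ≤ ∫ x, (semigroup X s f x - semigroup X t f x) ^ 2 ∂m :=
    integral_nonneg fun x => sq_nonneg _
  have e : ∀ x, (semigroup X s f x - semigroup X t f x) ^ 2 =
      (semigroup X s f x * semigroup X s f x + semigroup X t f x * semigroup X t f x) -
        2 * (semigroup X s f x * semigroup X t f x) := fun x => by ring
  have hi := fun s t => hX.integrable_semigroup_mul hf hB hfi s t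
  simp only [e] at h0
  rw [integral_sub ((hi s s).fun_add (hi t t)) ((hi s t).const_mul 2),
    integral_add (hi s s) (hi t t), integral_const_mul] at h0
  simp only [hX.integral_semigroup_mul_semigroup hf hB hfi] at h0
  linarith

/-- The left side is ‖P_{t/2} f‖². Pointwise (P_{t/2} f)² ≤ P_{t/2}(f²), since a variance is
nonnegative, and P_{t/2} preserves the m-integral of f². -/
theorem integral_mul_semigroup_le (hX : IsSymmetricDiffusion m X) {f : Dbar d₁ d₂ → ℝ}
    (hf : Measurable f) {B : ℝ} (hB : ∀ y, |f y| ≤ B) (hfi : Integrable f m) (t : ℝ≥0) :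
    ∫ x, f x * semigroup X t f x ∂m ≤ ∫ x, f x ^ 2 ∂m := by
  have := hX.conservative
  have hB1 : ∀ y, |f y ^ 2| ≤ max (B ^ 2) 1 := fun y => by
    rw [abs_pow]
    exact (pow_le_pow_left₀ (abs_nonneg _) (hB y) 2).trans (le_max_left _ _)
  have hf2 : Measurable fun y => f y ^ 2 := hf.pow_const 2
  have hf2i : Integrable (fun y => f y ^ 2) m := by
    simp only [sq]
    exact hfi.mul_bdd (c := B) hf.aestronglyMeasurable (ae_of_all _ hB)
  have hhalf : t / 2 + t / 2 = t := add_halves t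
  conv_lhs => rw [← hhalf]
  rw [← hX.integral_semigroup_mul_semigroup hf hB hfi]
  have hsym := hX.integral_symm (t := t / 2) hf2 (g := fun _ => 1) measurable_const hB1
    (fun y => by simp) hf2i
  simp only [hX.semigroup_one, mul_one, one_mul] at hsym
  rw [hsym]
  refine integral_mono (hX.integrable_semigroup_mul hf hB hfi _ _)
    (hX.integrable_semigroup hf2 hB1 hf2i _) fun x => ?_
  set c := semigroup X (t / 2) f x with hc
  have h0 : 0 ≤ ∫ p, (f (p (t / 2)) - c) ^ 2 ∂(X x) := integral_nonneg fun p => sq_nonneg _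
  have e : ∀ p : CadlagPath (Dbar d₁ d₂), (f (p (t / 2)) - c) ^ 2 =
      (f (p (t / 2)) ^ 2 - 2 * c * f (p (t / 2))) + c ^ 2 := fun p => by ring
  simp only [e] at h0
  have i1 := hX.integrable_eval hf2 hB1 (t / 2) x
  have i2 := (hX.integrable_eval hf hB (t / 2) x).const_mul (2 * c)
  have i3 : Integrable (fun p : CadlagPath (Dbar d₁ d₂) =>
      f (p (t / 2)) ^ 2 - 2 * c * f (p (t / 2))) (X x) := i1.sub i2
  rw [integral_add i3 (integrable_const _), integral_sub i1 i2, integral_const_mul] at h0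
  simp only [integral_const, probReal_univ, smul_eq_mul, one_mul] at h0
  change c * c ≤ ∫ p, f (p (t / 2)) ^ 2 ∂(X x)
  have : ∫ p, f (p (t / 2)) ∂(X x) = c := rfl
  rw [this] at h0
  linarith [sq c]

/-- `(f - P_t f, f)`. -/
theorem energy_increment_nonneg (hX : IsSymmetricDiffusion m X) {f : Dbar d₁ d₂ → ℝ}
    (hf : Measurable f) {B : ℝ} (hB : ∀ y, |f y| ≤ B) (hfi : Integrable f m) (t : ℝ≥0) :
    0 ≤ ∫ x, f x ^ 2 ∂m - ∫ x, f x * semigroup X t f x ∂m :=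
  sub_nonneg.2 (hX.integral_mul_semigroup_le hf hB hfi t)

theorem tendsto_integral_mul_semigroup (hX : IsSymmetricDiffusion m X) {f : Dbar d₁ d₂ → ℝ}
    (hf : Continuous f) {B : ℝ} (hB : ∀ y, |f y| ≤ B) (hfi : Integrable f m) {s : ℝ≥0}
    {u : ℕ → ℝ≥0} (hu : Tendsto u atTop (𝓝[≥] s)) :
    Tendsto (fun k => ∫ x, f x * semigroup X (u k) f x ∂m) atTop
      (𝓝 (∫ x, f x * semigroup X s f x ∂m)) := by
  have := hX.conservative
  have hpt : ∀ x, Tendsto (fun k => semigroup X (u k) f x) atTop (𝓝 (semigroup X s f x)) := by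
    intro x
    refine tendsto_integral_of_dominated_convergence (fun _ => B)
      (fun k => (hX.integrable_eval hf.measurable hB _ x).aestronglyMeasurable)
      (integrable_const _) (fun k => ae_of_all _ fun p => hB _) (ae_of_all _ fun p => ?_)
    exact (hf.continuousAt.tendsto.comp (p.right_cts s).tendsto).comp hu
  refine tendsto_integral_of_dominated_convergence (fun x => |f x| * B) (fun k => ?_)
    (hfi.abs.mul_const B) (fun k => ae_of_all _ fun x => ?_) (ae_of_all _ fun x => ?_)
  · exact (hf.measurable.mul (hX.measurable_semigroup hf.measurable _)).aestronglyMeasurable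
  · rw [norm_mul]
    exact mul_le_mul_of_nonneg_left (hX.abs_semigroup_le hB _ x) (abs_nonneg _)
  · exact (hpt x).const_mul _

/-- Monotonicity of a(t)/t, without the spectral theorem: midpoint concavity gives it on grids that
subdivide [0, t], and right continuity of a carries it to every s. -/
theorem mul_energy_increment_le (hX : IsSymmetricDiffusion m X) {f : Dbar d₁ d₂ → ℝ}
    (hf : Continuous f) {B : ℝ} (hB : ∀ y, |f y| ≤ B) (hfi : Integrable f m) {s t : ℝ≥0}
    (hst : s ≤ t) :
    s * (∫ x, f x ^ 2 ∂m - ∫ x, f x * semigroup X t f x ∂m) ≤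
      t * (∫ x, f x ^ 2 ∂m - ∫ x, f x * semigroup X s f x ∂m) := by
  set a : ℝ≥0 → ℝ := fun t => ∫ x, f x ^ 2 ∂m - ∫ x, f x * semigroup X t f x ∂m with ha
  change s * a t ≤ t * a s
  rcases hst.eq_or_lt with rfl | hlt
  · exact le_rfl
  have ht : 0 < t := pos_of_gt hlt
  have hgrid : ∀ (N : ℕ), ∀ i ≤ N + 1, (i : ℝ) * a t ≤ (N + 1 : ℕ) * a (i * (t / (N + 1 : ℕ))) := by
    intro N i hi
    have h := le_mul_of_midpoint_concave (a := fun j : ℕ => a (j * (t / (N + 1 : ℕ)))) ?_ ?_ hi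
    · have : ((N + 1 : ℕ) : ℝ≥0) * (t / (N + 1 : ℕ)) = t := by
        field_simp
      simpa only [this] using h
    · simp only [ha, Nat.cast_zero, zero_mul, hX.semigroup_zero, ← sq, sub_self]
    · intro j
      set δ := t / ((N + 1 : ℕ) : ℝ≥0)
      -- Half times, because midpoint convexity compares the times 2s, s + t and 2t.
      have h2 := hX.midpoint_convex hf.measurable hB hfi (j * δ / 2) ((j + 2 : ℕ) * δ / 2)
      rw [add_halves, add_halves, show (j : ℝ≥0) * δ / 2 + (j + 2 : ℕ) * δ / 2 = (j + 1 : ℕ) * δ by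
        rw [← add_div]; push_cast; rw [div_eq_iff two_ne_zero]; ring] at h2
      simp only [ha]
      linarith
  -- Rounding up places the grid points at or to the right of s, the side on which a is known to be
  -- continuous; s < t keeps the index within N + 1.
  set i : ℕ → ℕ := fun N => ⌊((N + 1 : ℕ) : ℝ≥0) * (s / t)⌋₊ + 1 with hi
  have hiN : ∀ N, i N ≤ N + 1 := by
    intro N
    rw [hi, Nat.add_le_add_iff_right]
    refine Nat.lt_succ_iff.1 ((Nat.floor_lt' (Nat.succ_ne_zero N)).2 ?_)
    have h1 : s / t < 1 := (div_lt_one ht).2 hlt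
    calc ((N + 1 : ℕ) : ℝ≥0) * (s / t) < ((N + 1 : ℕ) : ℝ≥0) * 1 := by
          gcongr
      _ = _ := by simp
  set u : ℕ → ℝ≥0 := fun N => i N * (t / (N + 1 : ℕ)) with hu
  have hus : ∀ N, s ≤ u N := by
    intro N
    have h1 : ((N + 1 : ℕ) : ℝ≥0) * (s / t) ≤ i N := by
      rw [hi]; push_cast; exact (Nat.lt_floor_add_one _).le
    calc s = ((N + 1 : ℕ) : ℝ≥0) * (s / t) * (t / (N + 1 : ℕ)) := by field_simp
      _ ≤ i N * (t / (N + 1 : ℕ)) := by gcongr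
  have hus' : ∀ N, u N ≤ s + t * (1 / ((N : ℝ≥0) + 1)) := by
    intro N
    have h1 : (i N : ℝ≥0) ≤ ((N + 1 : ℕ) : ℝ≥0) * (s / t) + 1 := by
      rw [hi]; push_cast; gcongr; exact Nat.floor_le (zero_le)
    calc u N ≤ (((N + 1 : ℕ) : ℝ≥0) * (s / t) + 1) * (t / (N + 1 : ℕ)) := by
          change i N * (t / ((N + 1 : ℕ) : ℝ≥0)) ≤ _
          gcongr
      _ = _ := by push_cast; field_simp
  have hulim : Tendsto u atTop (𝓝[≥] s) := by
    refine tendsto_nhdsWithin_iff.2 ⟨?_, Eventually.of_forall hus⟩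
    refine tendsto_of_tendsto_of_tendsto_of_le_of_le tendsto_const_nhds ?_ hus hus'
    have h0 : Tendsto (fun N : ℕ => 1 / ((N : ℝ≥0) + 1)) atTop (𝓝 0) :=
      tendsto_one_div_add_atTop_nhds_zero_nat
    simpa using tendsto_const_nhds.add (h0.const_mul t)
  have halim : Tendsto (fun N => t * a (u N)) atTop (𝓝 (t * a s)) :=
    (tendsto_const_nhds.sub (hX.tendsto_integral_mul_semigroup hf hB hfi hulim)).const_mul _
  refine ge_of_tendsto' halim fun N => ?_
  have h1 := hgrid N (i N) (hiN N)
  have hat : 0 ≤ a t := hX.energy_increment_nonneg hf.measurable hB hfi t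
  have hN : (0 : ℝ) < ((N + 1 : ℕ) : ℝ) := by positivity
  have h2 : (s : ℝ) * (N + 1 : ℕ) ≤ i N * t := by
    have : s ≤ i N * (t / ((N + 1 : ℕ) : ℝ≥0)) := hus N
    rw [← mul_div_assoc, le_div_iff₀ (by positivity)] at this
    exact_mod_cast this
  have h3 : ((N + 1 : ℕ) : ℝ) * (s * a t) ≤ (N + 1 : ℕ) * (t * a (u N)) := by
    calc ((N + 1 : ℕ) : ℝ) * (s * a t) = (s * (N + 1 : ℕ)) * a t := by ring
      _ ≤ (i N * t) * a t := by gcongr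
      _ = t * (i N * a t) := by ring
      _ ≤ t * ((N + 1 : ℕ) * a (u N)) := by gcongr
      _ = _ := by ring
  exact le_of_mul_le_mul_left h3 hN

theorem integral_mul_expAverage (hX : IsSymmetricDiffusion m X) [SigmaFinite m]
    {f : Dbar d₁ d₂ → ℝ} (hf : Continuous f) {B : ℝ} (hB : ∀ y, |f y| ≤ B)
    (hfi : Integrable f m) {r : ℝ} (hr : 0 < r) :
    ∫ y, f y * ∫ p, CadlagPath.expAverage r f p ∂(X y) ∂m =
      ∫ t, ∫ y, f y * semigroup X t.toNNReal f y ∂m ∂(expMeasure r) := by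
  have := hX.conservative
  have := isProbabilityMeasure_expMeasure hr
  have hm1 : Measurable fun q : CadlagPath (Dbar d₁ d₂) × ℝ => f (q.1 q.2.toNNReal) :=
    hf.measurable.comp (CadlagPath.measurable_uncurry.comp
      (measurable_fst.prodMk (measurable_real_toNNReal.comp measurable_snd)))
  have h1 : ∀ y, ∫ p, CadlagPath.expAverage r f p ∂(X y) =
      ∫ t, semigroup X t.toNNReal f y ∂(expMeasure r) := by
    intro y
    exact integral_integral_swap (Integrable.of_bound hm1.aestronglyMeasurable B
      (ae_of_all _ fun q => hB _))
  have hm2 : StronglyMeasurable fun q : Dbar d₁ d₂ × ℝ => semigroup X q.2.toNNReal f q.1 := by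
    have hm3 : StronglyMeasurable fun q : (Dbar d₁ d₂ × ℝ) × CadlagPath (Dbar d₁ d₂) =>
        f (q.2 q.1.2.toNNReal) :=
      (hm1.comp (measurable_snd.prodMk (measurable_snd.comp measurable_fst))).stronglyMeasurable
    exact hm3.integral_kernel_prod_right' (κ := Kernel.prodMkRight ℝ X)
  simp only [h1, ← integral_const_mul]
  refine integral_integral_swap ?_
  exact (hfi.comp_fst (expMeasure r)).mul_bdd (c := B) hm2.aestronglyMeasurable
    (ae_of_all _ fun q => hX.abs_semigroup_le hB _ _)

/-- The hypothesis bounds r times the mean of a at an exponential time of rate r. For s ≤ t one has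
a(s) ≥ s a(t)/t, and as r → ∞ the exponential time has mean 1/r and concentrates below t, so a(t)/t
≤ M. -/
theorem limitEnergy_le_of_resolvent (hX : IsSymmetricDiffusion m X) [SigmaFinite m]
    {f : Dbar d₁ d₂ → ℝ} (hf : Continuous f) {B : ℝ} (hB : ∀ y, |f y| ≤ B)
    (hfi : Integrable f m) {M : ℝ}
    (hM : ∀ r > 0, r * (∫ y, f y ^ 2 ∂m -
      ∫ y, f y * ∫ p, CadlagPath.expAverage r f p ∂(X y) ∂m) ≤ M) :
    limitEnergy m X f ≤ ENNReal.ofReal M := by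
  refine iSup_le fun ⟨t, ht⟩ => ENNReal.ofReal_le_ofReal ?_
  have hf2i : Integrable (fun y => f y ^ 2) m := by
    simp only [sq]
    exact hfi.mul_bdd (c := B) hf.measurable.aestronglyMeasurable (ae_of_all _ hB)
  have hbi : ∀ t, Integrable (fun x => f x * semigroup X t f x) m := fun t =>
    hfi.mul_bdd (c := B) (hX.measurable_semigroup hf.measurable t).aestronglyMeasurable
      (ae_of_all _ fun x => hX.abs_semigroup_le hB t x)
  set a : ℝ≥0 → ℝ := fun t => ∫ x, f x ^ 2 ∂m - ∫ x, f x * semigroup X t f x ∂m with ha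
  have e1 : ∫ x, (f x - semigroup X t f x) * f x ∂m = a t := by
    simp only [ha]
    rw [← integral_sub hf2i (hbi t)]
    exact integral_congr_ae (ae_of_all _ fun x => by ring)
  change (t : ℝ)⁻¹ * ∫ x, (f x - semigroup X t f x) * f x ∂m ≤ M
  rw [e1]
  have ht' : (0 : ℝ) < t := ht
  have hat : 0 ≤ a t := hX.energy_increment_nonneg hf.measurable hB hfi t
  -- The factor s is weakened to 1 - e^{-s}, a bounded function whose exponential average is a
  -- Laplace transform. Subtracting the indicator of s > t makes the bound nonpositive there, where
  -- a ≥ 0 suffices.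
  have hlow : ∀ s : ℝ, 0 < s → (t : ℝ)⁻¹ * a t * (1 - Real.exp (-(1 * s)) -
      (Ioi (t : ℝ)).indicator 1 s) ≤ a s.toNNReal := by
    intro s hs
    have has : 0 ≤ a s.toNNReal := hX.energy_increment_nonneg hf.measurable hB hfi _
    have hc : 0 ≤ (t : ℝ)⁻¹ * a t := by positivity
    by_cases hst : s ≤ t
    · have hst' : s.toNNReal ≤ t := Real.toNNReal_le_iff_le_coe.2 hst
      have h1 := hX.mul_energy_increment_le hf hB hfi hst'
      rw [Real.coe_toNNReal s hs.le] at h1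
      have h2 : 1 - Real.exp (-(1 * s)) ≤ s := by linarith [Real.add_one_le_exp (-(1 * s))]
      have h3 : (t : ℝ)⁻¹ * a t * s ≤ a s.toNNReal := by
        rw [inv_mul_eq_div, div_mul_eq_mul_div, div_le_iff₀ ht']
        linarith
      rw [indicator_of_notMem (by simpa using hst), sub_zero]
      exact (mul_le_mul_of_nonneg_left h2 hc).trans h3
    · rw [indicator_of_mem (by simpa using hst)]
      refine le_trans ?_ has
      have := Real.exp_pos (-(1 * s))
      simp only [Pi.one_apply]
      nlinarith
  have hbound : ∀ r : ℝ, 0 < r → (t : ℝ)⁻¹ * a t * (r * (1 / (r + 1)) - r * Real.exp (-(r * t))) ≤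
      M := by
    intro r hr
    have := isProbabilityMeasure_expMeasure hr
    refine le_trans ?_ (hM r hr)
    rw [hX.integral_mul_expAverage hf hB hfi hr]
    have hmb : Measurable fun s : ℝ => ∫ y, f y * semigroup X s.toNNReal f y ∂m := by
      have hm1 : Measurable fun q : CadlagPath (Dbar d₁ d₂) × ℝ => f (q.1 q.2.toNNReal) :=
        hf.measurable.comp (CadlagPath.measurable_uncurry.comp
          (measurable_fst.prodMk (measurable_real_toNNReal.comp measurable_snd)))
      have := hX.conservative
      have hm2 : StronglyMeasurable fun q : ℝ × Dbar d₁ d₂ => semigroup X q.1.toNNReal f q.2 := by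
        have hm3 : StronglyMeasurable fun q : (ℝ × Dbar d₁ d₂) × CadlagPath (Dbar d₁ d₂) =>
            f (q.2 q.1.1.toNNReal) :=
          (hm1.comp (measurable_snd.prodMk (measurable_fst.comp measurable_fst))).stronglyMeasurable
        exact hm3.integral_kernel_prod_right' (κ := Kernel.prodMkLeft ℝ X)
      have hm4 : StronglyMeasurable fun q : ℝ × Dbar d₁ d₂ =>
          f q.2 * semigroup X q.1.toNNReal f q.2 :=
        (hf.measurable.comp measurable_snd).stronglyMeasurable.mul hm2
      exact (hm4.integral_prod_right' (ν := m)).measurable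
    have hbb : ∀ s : ℝ≥0, ‖∫ y, f y * semigroup X s f y ∂m‖ ≤ ∫ y, |f y| * B ∂m := by
      intro s
      refine norm_integral_le_of_norm_le (hfi.abs.mul_const B) (ae_of_all _ fun y => ?_)
      rw [norm_mul]
      exact mul_le_mul_of_nonneg_left (hX.abs_semigroup_le hB _ y) (abs_nonneg _)
    have hib : Integrable (fun s : ℝ => ∫ y, f y * semigroup X s.toNNReal f y ∂m) (expMeasure r) :=
      Integrable.of_bound hmb.aestronglyMeasurable _ (ae_of_all _ fun s => hbb _)
    have hia : Integrable (fun s : ℝ => a s.toNNReal) (expMeasure r) :=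
      (integrable_const _).sub hib
    have e2 : ∫ y, f y ^ 2 ∂m - ∫ s, ∫ y, f y * semigroup X s.toNNReal f y ∂m ∂(expMeasure r) =
        ∫ s, a s.toNNReal ∂(expMeasure r) := by
      rw [ha, integral_sub (integrable_const _) hib]
      simp
    rw [e2]
    have hexpi : Integrable (fun s : ℝ => Real.exp (-(1 * s))) (expMeasure r) := by
      refine Integrable.of_bound (by fun_prop) 1 ?_
      filter_upwards [ae_expMeasure_pos r] with s hs
      rw [Real.norm_eq_abs, Real.abs_exp, Real.exp_le_one_iff]
      linarith
    have hexp : ∫ s, Real.exp (-(1 * s)) ∂(expMeasure r) = r / (r + 1) := by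
      rw [integral_eq_lintegral_of_nonneg_ae (ae_of_all _ fun s => (Real.exp_pos _).le)
        (by fun_prop), lintegral_exp_neg_expMeasure hr zero_le_one,
        ENNReal.toReal_ofReal (by positivity)]
    have hindi : Integrable ((Ioi (t : ℝ)).indicator (1 : ℝ → ℝ)) (expMeasure r) :=
      (integrable_const (1 : ℝ)).indicator measurableSet_Ioi
    have hind : ∫ s, (Ioi (t : ℝ)).indicator (1 : ℝ → ℝ) s ∂(expMeasure r) =
        Real.exp (-(r * t)) := by
      rw [integral_indicator_one measurableSet_Ioi, ← compl_Iic,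
        probReal_compl_eq_one_sub measurableSet_Iic, ← cdf_eq_real, cdf_expMeasure_eq hr,
        if_pos ht'.le]
      ring
    have i1 : Integrable (fun s : ℝ => 1 - Real.exp (-(1 * s))) (expMeasure r) :=
      (integrable_const _).sub hexpi
    have i2 : Integrable (fun s : ℝ => 1 - Real.exp (-(1 * s)) -
      (Ioi (t : ℝ)).indicator (1 : ℝ → ℝ) s) (expMeasure r) := i1.sub hindi
    have h1 : ∫ s, (t : ℝ)⁻¹ * a t * (1 - Real.exp (-(1 * s)) -
        (Ioi (t : ℝ)).indicator 1 s) ∂(expMeasure r) ≤ ∫ s, a s.toNNReal ∂(expMeasure r) := by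
      refine integral_mono_ae (i2.const_mul _) hia ?_
      filter_upwards [ae_expMeasure_pos r] with s hs
      exact hlow s hs
    rw [integral_const_mul, integral_sub i1 hindi, integral_sub (integrable_const _) hexpi, hexp,
      hind, integral_const, probReal_univ, one_smul] at h1
    have h2 := mul_le_mul_of_nonneg_left h1 hr.le
    refine le_trans (le_of_eq ?_) h2
    field_simp
    ring
  -- Here r(1 - r/(r+1)) = r/(r+1) tends to 1, and the loss r e^{-rt} tends to 0.
  have hlim : Tendsto (fun r : ℝ => (t : ℝ)⁻¹ * a t * (r * (1 / (r + 1)) -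
      r * Real.exp (-(r * t)))) atTop (𝓝 ((t : ℝ)⁻¹ * a t * (1 - 0))) := by
    refine Tendsto.const_mul _ (Tendsto.sub ?_ ?_)
    · have h0 : Tendsto (fun r : ℝ => 1 - 1 / (r + 1)) atTop (𝓝 (1 - 0)) := by
        refine tendsto_const_nhds.sub ?_
        simpa [Function.comp_def] using
          (tendsto_inv_atTop_zero.comp (tendsto_atTop_add_const_right _ (1 : ℝ) tendsto_id))
      rw [sub_zero] at h0
      refine h0.congr' ?_
      filter_upwards [eventually_gt_atTop 0] with r hr
      field_simp
      ring
    · have h0 := (Real.tendsto_pow_mul_exp_neg_atTop_nhds_zero 1).comp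
        (tendsto_id.atTop_mul_const ht')
      have h1 := h0.const_mul (t : ℝ)⁻¹
      rw [mul_zero] at h1
      refine h1.congr fun r => ?_
      simp only [Function.comp, id, pow_one]
      field_simp
  rw [sub_zero, mul_one] at hlim
  refine le_of_tendsto hlim ?_
  filter_upwards [eventually_gt_atTop 0] with r hr
  exact hbound r hr

end IsSymmetricDiffusion

end

noncomputable section

variable {d₁ d₂ : ℕ}

/-! ### The cluster and the rescaled counting measures -/

theorem scaledPt_injective {n : ℕ} (hn : n ≠ 0) :
    Function.Injective (scaledPt (d₁ := d₁) (d₂ := d₂) n) := by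
  intro x y hxy
  refine Subtype.ext (funext fun i => ?_)
  have h1 : (scaledPt n x).1 i = (scaledPt n y).1 i := by rw [hxy]
  have hn' : (n : ℝ) ≠ 0 := by exact_mod_cast hn
  have h2 : (x.1 i : ℝ) / n = (y.1 i : ℝ) / n := h1
  rw [div_left_inj' hn'] at h2
  exact_mod_cast h2

theorem finite_scaledPt_preimage {n : ℕ} (hn : n ≠ 0) {K : Set (Dbar d₁ d₂)}
    (hK : Bornology.IsBounded K) : (scaledPt (d₁ := d₁) (d₂ := d₂) n ⁻¹' K).Finite := by
  have hn' : (0 : ℝ) < n := by positivity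
  obtain ⟨R, hR⟩ := hK.subset_closedBall ⟨0, fun _ => le_rfl⟩
  refine Set.Finite.of_finite_image (f := Subtype.val) ?_ Subtype.val_injective.injOn
  refine (Set.finite_Icc (fun _ => -⌈n * R⌉) (fun _ => ⌈n * R⌉)).subset ?_
  rintro _ ⟨x, hx, rfl⟩
  have h1 : ‖(scaledPt n x).1‖ ≤ R := by
    have := hR hx
    rwa [Metric.mem_closedBall, Subtype.dist_eq, dist_zero_right] at this
  have h2 : ∀ i, |(x.1 i : ℝ)| ≤ n * R := fun i => by
    have h3 : ‖(scaledPt n x).1 i‖ ≤ ‖(scaledPt n x).1‖ := PiLp.norm_apply_le _ _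
    have h4 : ‖(scaledPt n x).1 i‖ = |(x.1 i : ℝ)| / n := by
      change |(x.1 i : ℝ) / n| = _
      rw [abs_div, abs_of_pos hn']
    rw [h4] at h3
    have := h3.trans h1
    rw [div_le_iff₀ hn'] at this
    linarith
  constructor <;> intro i <;> have h3 := abs_le.1 (h2 i)
  · have : (-(⌈n * R⌉ : ℤ) : ℝ) ≤ x.1 i := by linarith [Int.le_ceil (n * R)]
    exact_mod_cast this
  · have : (x.1 i : ℝ) ≤ (⌈n * R⌉ : ℤ) := by linarith [Int.le_ceil (n * R)]
    exact_mod_cast this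

theorem openGraph_adj_of_conduct {w : Env d₁ d₂} {x y : OrthLat d₁ d₂} (h : conduct w x y ≠ 0) :
    (openGraph w).Adj x y := by
  unfold conduct at h
  split_ifs at h with hadj
  · exact ⟨hadj, pos_iff_ne_zero.2 h⟩
  · exact absurd rfl h

theorem mem_cluster_iff_of_conduct {w : Env d₁ d₂} {x y : OrthLat d₁ d₂} (h : conduct w x y ≠ 0) :
    x ∈ cluster w ↔ y ∈ cluster w := by
  have : (openGraph w).connectedComponentMk x = (openGraph w).connectedComponentMk y :=
    SimpleGraph.ConnectedComponent.sound (openGraph_adj_of_conduct h).reachable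
  change (_ ∧ _) ↔ (_ ∧ _)
  rw [this]

/-- An infinite component contains a second vertex, and the first edge of a path to it is open. -/
theorem vertexWeight_ne_zero_of_mem_cluster {w : Env d₁ d₂} {x : OrthLat d₁ d₂}
    (hx : x ∈ cluster w) : vertexWeight w x ≠ 0 := by
  obtain ⟨y, hy, hyx⟩ := hx.2.exists_notMem_finset {x}
  have hr : (openGraph w).Reachable x y :=
    (SimpleGraph.ConnectedComponent.exact hy).symm
  obtain ⟨p⟩ := hr
  cases p with
  | nil => simp at hyx
  | cons hadj _ =>
    rename_i v _
    obtain ⟨h, hw⟩ := hadj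
    refine vertexWeight_ne_zero_of_conduct (x := v) ?_
    rw [conduct_comm, conduct, dif_pos h]
    exact hw.ne'

theorem scaledMeasure_lt_top (w : Env d₁ d₂) {n : ℕ} (hn : n ≠ 0) {K : Set (Dbar d₁ d₂)}
    (hK : Bornology.IsBounded K) (hKm : MeasurableSet K) : scaledMeasure w n K < ⊤ := by
  rw [scaledMeasure, Measure.smul_apply, Measure.sum_apply _ hKm, smul_eq_mul]
  refine ENNReal.mul_lt_top (ENNReal.inv_lt_top.2 (by positivity)) ?_
  have hfin : ((Subtype.val : cluster w → OrthLat d₁ d₂) ⁻¹' (scaledPt n ⁻¹' K)).Finite :=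
    (finite_scaledPt_preimage hn hK).preimage Subtype.val_injective.injOn
  rw [tsum_eq_sum (s := hfin.toFinset)]
  · exact ENNReal.sum_lt_top.2 fun x _ => measure_lt_top _ _
  · intro x hx
    rw [Measure.dirac_apply' _ hKm]
    exact indicator_of_notMem (by simpa using hx) _

theorem isLocallyFiniteMeasure_scaledMeasure (w : Env d₁ d₂) {n : ℕ} (hn : n ≠ 0) :
    IsLocallyFiniteMeasure (scaledMeasure w n) :=
  ⟨fun x => ⟨Metric.ball x 1, Metric.ball_mem_nhds x one_pos,
    scaledMeasure_lt_top w hn Metric.isBounded_ball measurableSet_ball⟩⟩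

theorem ae_scaledMeasure (w : Env d₁ d₂) (n : ℕ) :
    ∀ᵐ y ∂(scaledMeasure w n), y ∈ scaledPt n '' cluster w := by
  refine Measure.ae_smul_measure ?_ _
  rw [Measure.ae_sum_iff]
  intro x
  rw [ae_dirac_eq]
  exact mem_image_of_mem _ x.2

/-- A countable sum of Dirac masses imposes no measurability constraint, so the resolvent may be
extended off the lattice arbitrarily. -/
theorem aestronglyMeasurable_scaledMeasure (w : Env d₁ d₂) (n : ℕ) (v : Dbar d₁ d₂ → ℝ) :
    AEStronglyMeasurable v (scaledMeasure w n) := by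
  refine AEStronglyMeasurable.smul_measure ?_ _
  rw [aestronglyMeasurable_sum_measure_iff]
  exact fun x => aestronglyMeasurable_dirac

theorem integral_scaledMeasure (w : Env d₁ d₂) {n : ℕ} {g : Dbar d₁ d₂ → ℝ}
    {S : Finset (OrthLat d₁ d₂)} (hS : ∀ x ∈ S, x ∈ cluster w)
    (hg : ∀ x ∈ cluster w, x ∉ S → g (scaledPt n x) = 0) :
    ∫ y, g y ∂(scaledMeasure w n) = ((n : ℝ) ^ (d₁ + d₂))⁻¹ * ∑ x ∈ S, g (scaledPt n x) := by
  classical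
  have hint : Integrable g (Measure.sum fun x : cluster w => Measure.dirac (scaledPt n x.1)) := by
    refine ⟨?_, ?_⟩
    · rw [aestronglyMeasurable_sum_measure_iff]
      exact fun x => aestronglyMeasurable_dirac
    · rw [HasFiniteIntegral, lintegral_sum_measure]
      simp only [lintegral_dirac]
      rw [tsum_eq_sum (s := S.subtype (· ∈ cluster w))]
      · exact ENNReal.sum_lt_top.2 fun x _ => enorm_lt_top
      · intro x hx
        rw [hg x.1 x.2 (by simpa using hx), enorm_zero]
  rw [scaledMeasure, integral_smul_measure, integral_sum_measure hint, smul_eq_mul]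
  simp only [integral_dirac]
  rw [tsum_eq_sum (s := S.subtype (· ∈ cluster w))
    fun x hx => hg x.1 x.2 (by simpa using hx)]
  congr 1
  · simp
  · rw [Finset.sum_subtype_of_mem (fun x => g (scaledPt n x)) hS]

theorem neumannTerm_congr {w : Env d₁ d₂} {s : ℝ} {g g' : OrthLat d₁ d₂ → ℝ}
    (hgg : ∀ x ∈ cluster w, g x = g' x) (k : ℕ) {x : OrthLat d₁ d₂} (hx : x ∈ cluster w) :
    neumannTerm w s g k x = neumannTerm w s g' k x := by
  induction k generalizing x with
  | zero => simp only [neumannTerm, hgg x hx]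
  | succ k ih =>
    simp only [neumannTerm]
    congr 1
    refine Finset.sum_congr rfl fun y _ => ?_
    by_cases hc : conduct w x y = 0
    · simp [hc]
    · rw [ih ((mem_cluster_iff_of_conduct hc).1 hx)]

/-- The resolvent of the rescaled walk, as a function on the cluster. -/
def walkResolvent (w : Env d₁ d₂) (n : ℕ) (r : ℝ) (f : Dbar d₁ d₂ → ℝ) (x : OrthLat d₁ d₂) : ℝ :=
  r / (n : ℝ) ^ 2 * ∑' k, neumannTerm w (r / (n : ℝ) ^ 2) (fun x => f (scaledPt n x)) k x

theorem abs_walkResolvent_le {w : Env d₁ d₂} {n : ℕ} (hn : n ≠ 0) {r : ℝ} (hr : 0 < r)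
    {f : Dbar d₁ d₂ → ℝ} {B : ℝ} (hB : ∀ y, |f y| ≤ B) {x : OrthLat d₁ d₂} (hx : x ∈ cluster w) :
    |walkResolvent w n r f x| ≤ B := by
  have hs : 0 < r / (n : ℝ) ^ 2 := by positivity
  have hB' : ∀ x : OrthLat d₁ d₂, |f (scaledPt n x)| ≤ B := fun x => hB _
  rw [walkResolvent, ← tsum_mul_left,
    (hasSum_neumannTerm (vertexWeight_ne_zero_of_mem_cluster hx) hs hB').tsum_eq]
  have := norm_integral_le_of_norm_le_const (μ := trajLaw w x) (C := B)
    (f := fun h => ∑' k, discountedReward (r / (n : ℝ) ^ 2) (fun x => f (scaledPt n x)) k h) (by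
      filter_upwards [ae_holding_pos w x] with h hh
      exact abs_tsum_discountedReward_le hs hB' hh)
  simpa using this

/-- `neumann_series_energy` at rate s = r/n², multiplied by n^{2-d}. One factor n² turns s into r,
and n^{-d} is the mass of an atom of m_n. -/
theorem ofReal_resolvent_form_le_discreteEnergy (w : Env d₁ d₂) {n : ℕ} (hn : n ≠ 0) {r : ℝ}
    (hr : 0 < r) {f : Dbar d₁ d₂ → ℝ} {B : ℝ} (hB : ∀ y, |f y| ≤ B) (hfc : HasCompactSupport f)
    {v : Dbar d₁ d₂ → ℝ} (hv : ∀ x ∈ cluster w, v (scaledPt n x) = walkResolvent w n r f x) :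
    ENNReal.ofReal (r * (∫ y, f y ^ 2 ∂(scaledMeasure w n) - ∫ y, f y * v y ∂(scaledMeasure w n))) ≤
      discreteEnergy w n f := by
  classical
  have hn' : (0 : ℝ) < n := by positivity
  have hs : 0 < r / (n : ℝ) ^ 2 := by positivity
  set s := r / (n : ℝ) ^ 2 with hsdef
  have hfin : {x | x ∈ cluster w ∧ f (scaledPt n x) ≠ 0}.Finite :=
    (finite_scaledPt_preimage hn hfc.isBounded).subset fun x hx =>
      subset_tsupport _ hx.2
  set S₀ := hfin.toFinset with hS₀
  have hmem : ∀ x, x ∈ S₀ ↔ x ∈ cluster w ∧ f (scaledPt n x) ≠ 0 := fun x => by simp [hS₀]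
  -- No positive conductance joins the cluster to its complement, so killing f off the cluster
  -- changes nothing in the series on it and removes every other component from the energy.
  set g : OrthLat d₁ d₂ → ℝ := fun x => if x ∈ cluster w then f (scaledPt n x) else 0 with hg
  have hgin : ∀ x ∈ cluster w, g x = f (scaledPt n x) := fun x hx => by simp [hg, hx]
  have hgout : ∀ x ∉ cluster w, g x = 0 := fun x hx => by simp [hg, hx]
  have hg0 : ∀ x ∉ S₀, g x = 0 := by
    intro x hx
    by_cases hc : x ∈ cluster w
    · rw [hgin x hc]
      by_contra hne
      exact hx ((hmem x).2 ⟨hc, hne⟩)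
    · exact hgout x hc
  have hB0 : 0 ≤ B := (abs_nonneg _).trans (hB ⟨0, fun _ => le_rfl⟩)
  have hgB : ∀ x, |g x| ≤ B := fun x => by
    by_cases hc : x ∈ cluster w
    · rw [hgin x hc]; exact hB _
    · rw [hgout x hc, abs_zero]; exact hB0
  set S := S₀ ∪ S₀.biUnion nbrs with hS
  have key := neumann_series_energy (c := fun x y => (conduct w x y : ℝ))
    (fun x y => by rw [conduct_comm]) (fun x y => NNReal.coe_nonneg _) (nb := nbrs)
    (fun x y h => by
      by_contra hne
      exact h (by rw [conduct_eq_zero hne, NNReal.coe_zero]))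
    (q := vweight w) (vweight_eq w) hs (g := g) (h := neumannTerm w s g)
    (fun x => by
      have : vweight w x + s ≠ 0 := by linarith [vweight_nonneg w x]
      simp only [neumannTerm]
      field_simp)
    (fun j x => by
      have : vweight w x + s ≠ 0 := by linarith [vweight_nonneg w x]
      simp only [neumannTerm]
      field_simp)
    (fun x => summable_neumannTerm w x hs hgB) hg0 (S := S) Finset.subset_union_left
    (fun x hx => (Finset.subset_biUnion_of_mem nbrs hx).trans Finset.subset_union_right)
  have hclu : ∀ x ∈ S₀, x ∈ cluster w := fun x hx => ((hmem x).1 hx).1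
  have e1 : ∫ y, f y ^ 2 ∂(scaledMeasure w n) =
      ((n : ℝ) ^ (d₁ + d₂))⁻¹ * ∑ x ∈ S₀, g x ^ 2 := by
    rw [integral_scaledMeasure w hclu]
    · congr 1
      exact Finset.sum_congr rfl fun x hx => by rw [hgin x (hclu x hx)]
    · intro x hx hxS
      rw [← hgin x hx, hg0 x hxS]; ring
  have e2 : ∫ y, f y * v y ∂(scaledMeasure w n) =
      ((n : ℝ) ^ (d₁ + d₂))⁻¹ * (s * ∑ x ∈ S₀, g x * ∑' k, neumannTerm w s g k x) := by
    rw [integral_scaledMeasure w hclu]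
    · congr 1
      rw [Finset.mul_sum]
      refine Finset.sum_congr rfl fun x hx => ?_
      rw [hv x (hclu x hx), walkResolvent, hgin x (hclu x hx),
        tsum_congr fun k => neumannTerm_congr (s := s) hgin k (hclu x hx)]
      ring
    · intro x hx hxS
      rw [← hgin x hx, hg0 x hxS, zero_mul]
  have e3 : r * (∫ y, f y ^ 2 ∂(scaledMeasure w n) - ∫ y, f y * v y ∂(scaledMeasure w n)) ≤
      (n : ℝ) ^ (2 - ((d₁ + d₂ : ℕ) : ℤ)) / 2 *
        ∑ x ∈ S, ∑ y ∈ S, (g x - g y) ^ 2 * (conduct w x y : ℝ) := by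
    have hpow : (n : ℝ) ^ (2 - ((d₁ + d₂ : ℕ) : ℤ)) = (n : ℝ) ^ 2 * ((n : ℝ) ^ (d₁ + d₂))⁻¹ := by
      rw [zpow_sub₀ hn'.ne', zpow_natCast, div_eq_mul_inv]
      norm_cast
    have hr' : r = (n : ℝ) ^ 2 * s := by rw [hsdef]; field_simp
    rw [e1, e2, hpow]
    conv_lhs => rw [hr']
    have h1 := mul_le_mul_of_nonneg_left key
      (show 0 ≤ (n : ℝ) ^ 2 * ((n : ℝ) ^ (d₁ + d₂))⁻¹ by positivity)
    have h2 : ∑ x ∈ S, ∑ y ∈ S, (g x - g y) ^ 2 * (conduct w x y : ℝ) =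
        ∑ x ∈ S, ∑ y ∈ S, (conduct w x y : ℝ) * (g x - g y) ^ 2 :=
      Finset.sum_congr rfl fun x _ => Finset.sum_congr rfl fun y _ => mul_comm _ _
    rw [h2]
    refine le_trans (le_of_eq ?_) (h1.trans (le_of_eq ?_)) <;> ring
  refine (ENNReal.ofReal_le_ofReal e3).trans ?_
  rw [ENNReal.ofReal_mul (by positivity), discreteEnergy]
  gcongr
  rw [ENNReal.ofReal_sum_of_nonneg fun x _ => Finset.sum_nonneg fun y _ => by positivity]
  refine le_trans (Finset.sum_le_sum fun x _ => ?_) (ENNReal.sum_le_tsum S)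
  rw [ENNReal.ofReal_sum_of_nonneg fun y _ => by positivity]
  refine le_trans (Finset.sum_le_sum fun y _ => ?_) (ENNReal.sum_le_tsum S)
  by_cases hc : conduct w x y = 0
  · simp [hc]
  · by_cases hx : x ∈ cluster w
    · have hy := (mem_cluster_iff_of_conduct hc).1 hx
      rw [if_pos ⟨hx, hy, openGraph_adj_of_conduct hc⟩, hgin x hx, hgin y hy,
        ENNReal.ofReal_mul (sq_nonneg _), ENNReal.ofReal_coe_nnreal]
    · have hy : y ∉ cluster w := fun h => hx ((mem_cluster_iff_of_conduct hc).2 h)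
      rw [hgout x hx, hgout y hy]
      simp

/-! ### Convergence of the resolvents and of the resolvent forms along a subsequence. -/

theorem isClosed_closedDom (d₁ d₂ : ℕ) : IsClosed (closedDom d₁ d₂) := by
  have : closedDom d₁ d₂ = ⋂ i, {x : Euc d₁ d₂ | 0 ≤ x (Sum.inl i)} := by
    ext; simp [closedDom]
  rw [this]
  exact isClosed_iInter fun i => isClosed_le continuous_const (by fun_prop)

instance (d₁ d₂ : ℕ) : LocallyCompactSpace (Dbar d₁ d₂) :=
  (isClosed_closedDom d₁ d₂).isClosedEmbedding_subtypeVal.locallyCompactSpace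

/-- The resolvents of the rescaled walks converge continuously along the subsequence. -/
theorem IsSubseqLimit.tendsto_walkResolvent {w : Env d₁ d₂} {φ : ℕ → ℕ} {m : Measure (Dbar d₁ d₂)}
    {X : Kernel (Dbar d₁ d₂) (CadlagPath (Dbar d₁ d₂))} (h : IsSubseqLimit w φ m X)
    {f : Dbar d₁ d₂ → ℝ} (hf : Continuous f) (hfc : HasCompactSupport f) {B : ℝ}
    (hB : ∀ y, |f y| ≤ B) {r : ℝ} (hr : 0 < r) {x : ℕ → OrthLat d₁ d₂} {z : Dbar d₁ d₂}
    (hx : ∀ k, x k ∈ cluster w) (hxz : Tendsto (fun k => scaledPt (φ k) (x k)) atTop (𝓝 z)) :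
    Tendsto (fun k => walkResolvent w (φ k) r f (x k)) atTop
      (𝓝 (∫ p, CadlagPath.expAverage r f p ∂(X z))) := by
  have hw := h.weak x z hx hxz
  have hF := hw (CadlagPath.expAverage r f)
    (CadlagPath.continuous_expAverage hr (hfc.uniformContinuous_of_continuous hf) hB)
    (CadlagPath.measurable_expAverage hr hf) ⟨B, CadlagPath.abs_expAverage_le hr hB⟩
  -- Testing against the constant 1: the non-explosive mass of the walks tends to 1, which removes
  -- the error in `abs_integral_expAverage_sub_le`.
  have h1 := hw (fun _ => 1) continuous_const measurable_const ⟨1, fun _ => by simp⟩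
  have := h.diffusion.conservative
  rw [integral_const (μ := X z), probReal_univ, one_smul] at h1
  have hφ0 : ∀ᶠ k in atTop, φ k ≠ 0 :=
    (h.strictMono.tendsto_atTop.eventually_gt_atTop 0).mono fun k hk => hk.ne'
  have hdiff : Tendsto (fun k => ∫ p, CadlagPath.expAverage r f p ∂(scaledWalkLaw w (φ k) (x k)) -
      walkResolvent w (φ k) r f (x k)) atTop (𝓝 0) := by
    refine squeeze_zero_norm' (a := fun k => B * (1 - ∫ _, (1 : ℝ) ∂(scaledWalkLaw w (φ k) (x k))))
      ?_ ?_
    · filter_upwards [hφ0] with k hk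
      exact abs_integral_expAverage_sub_le (vertexWeight_ne_zero_of_mem_cluster (hx k)) hk hr hf hB
    · have h2 := ((tendsto_const_nhds (x := (1 : ℝ))).sub h1).const_mul B
      rwa [sub_self, mul_zero] at h2
  have hsub := hF.sub hdiff
  simp only [sub_sub_cancel, sub_zero] at hsub
  exact hsub

theorem limsup_subseq_le {u : ℕ → ℝ≥0∞} {ψ : ℕ → ℕ} (hψ : Tendsto ψ atTop atTop) :
    limsup (fun k => u (ψ k)) atTop ≤ limsup u atTop := by
  change limsup u (map ψ atTop) ≤ _
  exact limsup_le_limsup_of_le hψ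

/-- The Dirichlet form of a subsequential limit is dominated by the limsup of the discrete ones. -/
theorem IsSubseqLimit.limitEnergy_le {w : Env d₁ d₂} {φ : ℕ → ℕ} {m : Measure (Dbar d₁ d₂)}
    {X : Kernel (Dbar d₁ d₂) (CadlagPath (Dbar d₁ d₂))} (h : IsSubseqLimit w φ m X)
    {f : Dbar d₁ d₂ → ℝ} (hf : Continuous f) (hfc : HasCompactSupport f) :
    limitEnergy m X f ≤ limsup (fun n => discreteEnergy w n f) atTop := by
  classical
  have := h.locallyFinite
  obtain ⟨B, hB⟩ := hf.bounded_above_of_compact_support hfc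
  have hfi : Integrable f m := hf.integrable_of_hasCompactSupport hfc
  set L := limsup (fun n => discreteEnergy w n f) atTop with hL
  by_cases hLtop : L = ⊤
  · rw [hLtop]; exact le_top
  rw [← ENNReal.ofReal_toReal hLtop]
  refine h.diffusion.limitEnergy_le_of_resolvent hf hB hfi fun r hr => ?_
  rw [← ENNReal.ofReal_le_ofReal_iff ENNReal.toReal_nonneg, ENNReal.ofReal_toReal hLtop]
  -- φ 0 may be 0, where the scaling degenerates; from index 1 on a strictly increasing sequence is
  -- positive.
  set ψ : ℕ → ℕ := fun k => φ (k + 1) with hψ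
  have hψ0 : ∀ k, ψ k ≠ 0 := fun k => by
    exact ((Nat.zero_le _).trans_lt (h.strictMono (Nat.succ_pos k))).ne'
  have hψtop : Tendsto ψ atTop atTop := h.strictMono.tendsto_atTop.comp (tendsto_add_atTop_nat 1)
  have hloc : ∀ k, IsLocallyFiniteMeasure (scaledMeasure w (ψ k)) := fun k =>
    isLocallyFiniteMeasure_scaledMeasure w (hψ0 k)
  have hvague : ∀ g : Dbar d₁ d₂ → ℝ, Continuous g → HasCompactSupport g →
      Tendsto (fun k => ∫ y, g y ∂(scaledMeasure w (ψ k))) atTop (𝓝 (∫ y, g y ∂m)) :=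
    fun g hg hgc => (h.vague g hg hgc).comp (tendsto_add_atTop_nat 1)
  set R : ℕ → OrthLat d₁ d₂ → ℝ := fun k x =>
    if x ∈ cluster w then walkResolvent w (ψ k) r f x else 0 with hR
  set v : ℕ → Dbar d₁ d₂ → ℝ := fun k => Function.extend (scaledPt (ψ k)) (R k) 0 with hv
  have hvx : ∀ k, ∀ x ∈ cluster w, v k (scaledPt (ψ k) x) = walkResolvent w (ψ k) r f x := by
    intro k x hx
    simp only [hv, (scaledPt_injective (hψ0 k)).extend_apply, hR, if_pos hx]
  have hB0 : 0 ≤ B := (abs_nonneg _).trans (hB ⟨0, fun _ => le_rfl⟩)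
  have hvB : ∀ k y, |v k y| ≤ B := by
    intro k y
    by_cases hy : ∃ x, scaledPt (ψ k) x = y
    · obtain ⟨x, rfl⟩ := hy
      by_cases hx : x ∈ cluster w
      · rw [hvx k x hx]
        exact abs_walkResolvent_le (hψ0 k) hr hB hx
      · simp only [hv, (scaledPt_injective (hψ0 k)).extend_apply, hR, if_neg hx, abs_zero]
        exact hB0
    · simp only [hv, Function.extend_apply' _ _ _ hy, Pi.zero_apply, abs_zero]
      exact hB0
  have hconv : ∀ (y : ℕ → Dbar d₁ d₂) (z : Dbar d₁ d₂),
      (∀ᶠ k in atTop, y k ∈ scaledPt (ψ k) '' cluster w) → Tendsto y atTop (𝓝 z) →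
      Tendsto (fun k => v k (y k)) atTop
        (𝓝 (∫ p, CadlagPath.expAverage r f p ∂(X z))) := by
    intro y z hy hyz
    obtain ⟨k₀, hk₀⟩ := hy.exists
    obtain ⟨x₀, hx₀, _⟩ := hk₀
    -- The points y k lie on the rescaled cluster only eventually, whereas `IsSubseqLimit.weak`
    -- needs cluster points for every k; x₀ fills the exceptions.
    have hch : ∀ k, ∃ x ∈ cluster w, y k ∈ scaledPt (ψ k) '' cluster w → scaledPt (ψ k) x = y k := by
      intro k
      by_cases hk : y k ∈ scaledPt (ψ k) '' cluster w
      · obtain ⟨x, hx, hxy⟩ := hk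
        exact ⟨x, hx, fun _ => hxy⟩
      · exact ⟨x₀, hx₀, fun h => absurd h hk⟩
    choose x hx hxy using hch
    -- Undoes the shift in ψ; the value at k = 0 is irrelevant.
    set x' : ℕ → OrthLat d₁ d₂ := fun k => x (k - 1) with hx'
    have hx'lim : Tendsto (fun k => scaledPt (φ k) (x' k)) atTop (𝓝 z) := by
      rw [← tendsto_add_atTop_iff_nat 1]
      refine hyz.congr' ?_
      filter_upwards [hy] with k hk
      exact (hxy k hk).symm
    have hlim : Tendsto (fun k => walkResolvent w (ψ k) r f (x k)) atTop
        (𝓝 (∫ p, CadlagPath.expAverage r f p ∂(X z))) :=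
      (h.tendsto_walkResolvent hf hfc hB hr (fun k => hx (k - 1)) hx'lim).comp
        (tendsto_add_atTop_nat 1)
    refine hlim.congr' ?_
    filter_upwards [hy] with k hk
    rw [← hxy k hk, hvx k _ (hx k)]
  have hlim1 := tendsto_integral_mul_of_continuous_convergence
    (fun k => ae_scaledMeasure w (ψ k)) hvague hvB
    (fun k => aestronglyMeasurable_scaledMeasure w _ _) hconv hf hfc
  have hlim2 : Tendsto (fun k => ∫ y, f y ^ 2 ∂(scaledMeasure w (ψ k))) atTop
      (𝓝 (∫ y, f y ^ 2 ∂m)) :=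
    hvague _ (hf.pow 2) (hfc.comp_left (g := fun x : ℝ => x ^ 2) (by simp))
  have hlim := ENNReal.tendsto_ofReal ((hlim2.sub hlim1).const_mul r)
  rw [← hlim.limsup_eq]
  calc limsup _ atTop ≤ limsup (fun k => discreteEnergy w (ψ k) f) atTop :=
        limsup_le_limsup (Eventually.of_forall fun k =>
          ofReal_resolvent_form_le_discreteEnergy w (hψ0 k) hr hB hfc (hvx k))
    _ ≤ L := limsup_subseq_le (u := fun n => discreteEnergy w n f) hψtop

end

/-! ### A law of large numbers along increasing finite sets -/

/-- An increasing sequence of finite sets with unbounded cardinalities can be enumerated so that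
each of its members is an initial segment. -/
theorem exists_enumeration_of_monotone {α : Type*} [Countable α] {K : ℕ → Finset α}
    (hK : Monotone K) (hcard : Tendsto (fun n => (K n).card) atTop atTop) :
    ∃ e : ℕ → α, Function.Injective e ∧
      ∀ n, ∀ F : α → ℝ, ∑ x ∈ K n, F x = ∑ i ∈ Finset.range (K n).card, F (e i) := by
  classical
  obtain ⟨enc, henc⟩ := exists_injective_nat α
  let first : α → ℕ := fun x => sInf {n | x ∈ K n}
  -- Elements are ordered by first appearance, ties being broken by an arbitrary encoding.
  -- Everything before x then lies in the finite set where x first appears, so its rank is finite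
  -- and every K n is an initial segment.
  let key : α → ℕ ×ₗ ℕ := fun x => toLex (first x, enc x)
  have hkey : Function.Injective key := fun x y h => henc (by
    have := congrArg (fun z => (ofLex z).2) h
    exact this)
  have hmem : ∀ {x n}, x ∈ K n → x ∈ K (first x) := fun {x n} h =>
    Nat.sInf_mem (s := {n | x ∈ K n}) ⟨n, h⟩
  have hfirst : ∀ {x n}, x ∈ K n → first x ≤ n := fun {x n} h => Nat.sInf_le h
  let rank : α → ℕ := fun x => ((K (first x)).filter fun y => key y < key x).card
  have hbelow : ∀ {x y n m}, x ∈ K n → y ∈ K m → key y < key x → y ∈ K (first x) := by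
    intro x y n m _ hy h
    refine hK ?_ (hmem hy)
    rcases Prod.Lex.toLex_lt_toLex.1 h with h | h
    · exact h.le
    · exact h.1.le
  have hlt : ∀ {x n}, x ∈ K n → rank x < (K n).card := by
    intro x n hx
    refine Finset.card_lt_card ((Finset.ssubset_iff_of_subset ?_).2 ⟨x, hx, ?_⟩)
    · exact fun y hy => hK (hfirst hx) (Finset.mem_filter.1 hy).1
    · simp
  have hmono : ∀ {x y n m}, x ∈ K n → y ∈ K m → key x < key y → rank x < rank y := by
    intro x y n m hx hy h
    refine Finset.card_lt_card ((Finset.ssubset_iff_of_subset ?_).2 ⟨x, ?_, ?_⟩)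
    · intro z hz
      have hz := Finset.mem_filter.1 hz
      exact Finset.mem_filter.2 ⟨hbelow hy hz.1 (hz.2.trans h), hz.2.trans h⟩
    · exact Finset.mem_filter.2 ⟨hbelow hy hx h, h⟩
    · simp
  have hinj : ∀ {x y n m}, x ∈ K n → y ∈ K m → rank x = rank y → x = y := by
    intro x y n m hx hy h
    rcases lt_trichotomy (key x) (key y) with h1 | h1 | h1
    · exact absurd h (hmono hx hy h1).ne
    · exact hkey h1
    · exact absurd h (hmono hy hx h1).ne'
  have himage : ∀ n, (K n).image rank = Finset.range (K n).card := by
    intro n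
    refine Finset.eq_of_subset_of_card_le ?_ ?_
    · intro i hi
      obtain ⟨x, hx, rfl⟩ := Finset.mem_image.1 hi
      exact Finset.mem_range.2 (hlt hx)
    · rw [Finset.card_image_of_injOn fun x hx y hy h => hinj hx hy h, Finset.card_range]
  have hsurj : ∀ i, ∃ x, (∃ n, x ∈ K n) ∧ rank x = i := by
    intro i
    obtain ⟨n, hn⟩ := (hcard.eventually_gt_atTop i).exists
    have : i ∈ (K n).image rank := by rw [himage]; exact Finset.mem_range.2 hn
    obtain ⟨x, hx, h⟩ := Finset.mem_image.1 this
    exact ⟨x, ⟨n, hx⟩, h⟩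
  choose e he hre using hsurj
  refine ⟨e, fun i j h => by rw [← hre i, ← hre j, h], fun n F => ?_⟩
  rw [← himage n, Finset.sum_image fun x hx y hy h => hinj hx hy h]
  refine Finset.sum_congr rfl fun x hx => ?_
  obtain ⟨m, hm⟩ := he (rank x)
  rw [hinj hm hx (hre (rank x))]

/-- The strong law of large numbers along an increasing sequence of finite index sets of size
at most of the order of a normalization tending to infinity. -/
theorem ae_tendsto_sum_sub_div {Ω α : Type*} [MeasurableSpace Ω] {P : Measure Ω}
    [IsProbabilityMeasure P] [Countable α] {ξ : α → Ω → ℝ} {c : ℝ}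
    (hint : ∀ x, Integrable (ξ x) P) (hindep : Pairwise (Function.onFun (· ⟂ᵢ[P] ·) ξ))
    (hident : ∀ x y, IdentDistrib (ξ x) (ξ y) P P) (hc : ∀ x, ∫ ω, ξ x ω ∂P = c)
    {K : ℕ → Finset α} (hK : Monotone K) {a : ℕ → ℝ} (ha : Tendsto a atTop atTop) {B : ℝ}
    (hB : ∀ᶠ n in atTop, ((K n).card : ℝ) ≤ B * a n) :
    ∀ᵐ ω ∂P, Tendsto (fun n => (a n)⁻¹ * ∑ x ∈ K n, (ξ x ω - c)) atTop (𝓝 0) := by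
  have hcardm : Monotone fun n => (K n).card := fun _ _ h => Finset.card_le_card (hK h)
  -- Either the cardinalities diverge and the usual strong law applies along the enumeration, or the
  -- sets are eventually constant and the normalisation kills a fixed sum.
  rcases tendsto_atTop_of_monotone hcardm with htop | ⟨l, hl⟩
  · obtain ⟨e, he, hsum⟩ := exists_enumeration_of_monotone hK htop
    have hslln := strong_law_ae_real (fun i => ξ (e i)) (hint _)
      (fun i j hij => hindep (he.ne hij)) (fun i => hident _ _)
    filter_upwards [hslln] with ω hω
    have h1 : Tendsto (fun n => ((∑ i ∈ Finset.range (K n).card, ξ (e i) ω) / (K n).card - c))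
        atTop (𝓝 0) := by
      have := (hω.comp htop).sub_const c
      simpa [hc] using this
    have h2 : Tendsto (fun n => |B| *
        |(∑ i ∈ Finset.range (K n).card, ξ (e i) ω) / (K n).card - c|) atTop (𝓝 0) := by
      simpa using h1.abs.const_mul |B|
    refine squeeze_zero_norm' ?_ h2
    filter_upwards [hB, ha.eventually_gt_atTop 0, htop.eventually_gt_atTop 0] with n hBn han hcn
    have hcn' : (0 : ℝ) < (K n).card := by exact_mod_cast hcn
    have h3 : ∑ x ∈ K n, (ξ x ω - c) =
        (K n).card * ((∑ i ∈ Finset.range (K n).card, ξ (e i) ω) / (K n).card - c) := by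
      rw [Finset.sum_sub_distrib, hsum n fun x => ξ x ω]
      simp only [Finset.sum_const, nsmul_eq_mul]
      field_simp
    rw [h3, Real.norm_eq_abs, ← mul_assoc, abs_mul]
    refine mul_le_mul_of_nonneg_right ?_ (abs_nonneg _)
    rw [abs_of_nonneg (by positivity)]
    refine le_trans ?_ (le_abs_self B)
    rw [inv_mul_le_iff₀ han]
    linarith
  · refine ae_of_all _ fun ω => ?_
    have hev : ∀ᶠ n in atTop, (K n).card = l := tendsto_pure.1 (by rwa [nhds_discrete] at hl)
    obtain ⟨N, hN⟩ := eventually_atTop.1 hev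
    have hconst : ∀ᶠ n in atTop, K n = K N := by
      filter_upwards [eventually_ge_atTop N] with n hn
      exact (Finset.eq_of_subset_of_card_le (hK hn) (by rw [hN n hn, hN N le_rfl])).symm
    have h1 : Tendsto (fun n => (a n)⁻¹ * ∑ x ∈ K N, (ξ x ω - c)) atTop (𝓝 0) := by
      simpa using (tendsto_inv_atTop_zero.comp ha).mul_const (∑ x ∈ K N, (ξ x ω - c))
    refine h1.congr' ?_
    filter_upwards [hconst] with n hn
    rw [hn]

noncomputable section

variable {d₁ d₂ : ℕ}

/-! ### Lattice boxes and grid cells -/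

theorem finite_latBox (N : ℕ) : {x : OrthLat d₁ d₂ | ∀ j, |x.1 j| ≤ N}.Finite := by
  refine Set.Finite.of_finite_image (f := Subtype.val) ?_ Subtype.val_injective.injOn
  refine (Set.finite_Icc (fun _ => -(N : ℤ)) (fun _ => (N : ℤ))).subset ?_
  rintro _ ⟨x, hx, rfl⟩
  exact ⟨fun j => (abs_le.1 (hx j)).1, fun j => (abs_le.1 (hx j)).2⟩

/-- The lattice points in the cube of side `2 N` centred at the origin. -/
def latBox (d₁ d₂ N : ℕ) : Finset (OrthLat d₁ d₂) := (finite_latBox N).toFinset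

theorem mem_latBox {N : ℕ} {x : OrthLat d₁ d₂} : x ∈ latBox d₁ d₂ N ↔ ∀ j, |x.1 j| ≤ N := by
  simp [latBox]

theorem latBox_mono {N M : ℕ} (h : N ≤ M) : latBox d₁ d₂ N ⊆ latBox d₁ d₂ M := fun x hx =>
  mem_latBox.2 fun j => (mem_latBox.1 hx j).trans (by exact_mod_cast h)

theorem card_latBox_le (N : ℕ) : (latBox d₁ d₂ N).card ≤ (2 * N + 1) ^ (d₁ + d₂) := by
  classical
  have h1 : (latBox d₁ d₂ N).card ≤
      (Finset.Icc (fun _ : Fin d₁ ⊕ Fin d₂ => -(N : ℤ)) (fun _ => (N : ℤ))).card := by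
    refine Finset.card_le_card_of_injOn Subtype.val ?_ Subtype.val_injective.injOn
    intro x hx
    have hx := mem_latBox.1 hx
    simp only [Finset.coe_Icc, Set.mem_Icc]
    exact ⟨fun j => (abs_le.1 (hx j)).1, fun j => (abs_le.1 (hx j)).2⟩
  refine h1.trans (le_of_eq ?_)
  rw [Pi.card_Icc]
  simp only [Int.card_Icc, Finset.prod_const, Finset.card_univ, Fintype.card_sum, Fintype.card_fin]
  congr 1
  omega

theorem card_latBox_mul_le (R : ℕ) {n : ℕ} (hn : n ≠ 0) :
    ((latBox d₁ d₂ (n * R)).card : ℝ) ≤ (2 * R + 1) ^ (d₁ + d₂) * (n : ℝ) ^ (d₁ + d₂) := by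
  have h1 : ((latBox d₁ d₂ (n * R)).card : ℝ) ≤ ((2 * (n * R) + 1 : ℕ) : ℝ) ^ (d₁ + d₂) := by
    exact_mod_cast card_latBox_le (d₁ := d₁) (d₂ := d₂) (n * R)
  refine h1.trans ?_
  rw [← mul_pow]
  have : (1 : ℝ) ≤ n := by exact_mod_cast Nat.one_le_iff_ne_zero.2 hn
  gcongr
  push_cast
  nlinarith

/-- The index of the cell of the grid of mesh `1 / m` containing `x / n`. -/
def cellIdx (m n : ℕ) (x : OrthLat d₁ d₂) : OrthLat d₁ d₂ :=
  ⟨fun j => (m * x.1 j) / n, fun i =>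
    Int.ediv_nonneg (mul_nonneg (Int.natCast_nonneg m) (x.2 i)) (Int.natCast_nonneg n)⟩

theorem cellIdx_eq_iff {m n : ℕ} (hn : n ≠ 0) {x k : OrthLat d₁ d₂} :
    cellIdx m n x = k ↔ ∀ j, k.1 j * n ≤ m * x.1 j ∧ m * x.1 j < (k.1 j + 1) * n := by
  have hn' : (0 : ℤ) < n := by positivity
  rw [Subtype.ext_iff, funext_iff]
  refine forall_congr' fun j => ?_
  rw [add_mul, one_mul]
  exact Int.ediv_eq_iff_of_pos hn'

/-- As n grows, x/n moves monotonically along a ray, so it spends an interval of times in each cell.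
-/
theorem cellIdx_eq_of_between {m t n n' : ℕ} (ht : t ≠ 0) (htn : t ≤ n) (hnn : n ≤ n')
    {x k : OrthLat d₁ d₂} (h1 : cellIdx m t x = k) (h2 : cellIdx m n' x = k) :
    cellIdx m n x = k := by
  rw [cellIdx_eq_iff (by omega)] at h1 h2 ⊢
  intro j
  have a := h1 j
  have b := h2 j
  have htn' : (t : ℤ) ≤ n := by exact_mod_cast htn
  have hnn' : (n : ℤ) ≤ n' := by exact_mod_cast hnn
  rcases le_or_gt 0 (k.1 j) with hk | hk
  · constructor <;> nlinarith
  · constructor <;> nlinarith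

/-- The points in a given cell at scale n do not increase with n. They are the difference of two
families that do, the points S that have entered the cell by time n and the points U that have left
it again, and the strong law applies to each family. -/
theorem ae_tendsto_sum_cell {Ω : Type*} [MeasurableSpace Ω] {P : Measure Ω}
    [IsProbabilityMeasure P] {ξ : OrthLat d₁ d₂ → Ω → ℝ} {c : ℝ} (hd : d₁ + d₂ ≠ 0)
    (hint : ∀ x, Integrable (ξ x) P) (hindep : Pairwise (Function.onFun (· ⟂ᵢ[P] ·) ξ))
    (hident : ∀ x y, IdentDistrib (ξ x) (ξ y) P P) (hc : ∀ x, ∫ ω, ξ x ω ∂P = c)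
    (R m : ℕ) (k : OrthLat d₁ d₂) [DecidableEq (OrthLat d₁ d₂)] :
    ∀ᵐ ω ∂P, Tendsto (fun n : ℕ => ((n : ℝ) ^ (d₁ + d₂))⁻¹ *
      ∑ x ∈ (latBox d₁ d₂ (n * R)).filter (fun x => cellIdx m n x = k), (ξ x ω - c))
      atTop (𝓝 0) := by
  classical
  have ha : Tendsto (fun n : ℕ => (n : ℝ) ^ (d₁ + d₂)) atTop atTop :=
    (tendsto_pow_atTop hd).comp tendsto_natCast_atTop_atTop
  let S : ℕ → Finset (OrthLat d₁ d₂) := fun n =>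
    (latBox d₁ d₂ (n * R)).filter fun x => ∃ t, t ≠ 0 ∧ t ≤ n ∧ cellIdx m t x = k
  let U : ℕ → Finset (OrthLat d₁ d₂) := fun n => (S n).filter fun x => cellIdx m n x ≠ k
  have hS : Monotone S := by
    intro n n' hnn x hx
    obtain ⟨hx1, t, ht, htn, hx2⟩ := Finset.mem_filter.1 hx
    exact Finset.mem_filter.2
      ⟨latBox_mono (Nat.mul_le_mul_right R hnn) hx1, t, ht, htn.trans hnn, hx2⟩
  have hU : Monotone U := by
    intro n n' hnn x hx
    obtain ⟨hx1, hx2⟩ := Finset.mem_filter.1 hx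
    obtain ⟨-, t, ht, htn, hx3⟩ := Finset.mem_filter.1 hx1
    exact Finset.mem_filter.2 ⟨hS hnn hx1, fun h => hx2 (cellIdx_eq_of_between ht htn hnn hx3 h)⟩
  have hScard : ∀ᶠ n : ℕ in atTop, ((S n).card : ℝ) ≤
      (2 * R + 1) ^ (d₁ + d₂) * (n : ℝ) ^ (d₁ + d₂) := by
    filter_upwards [eventually_ne_atTop 0] with n hn
    refine le_trans ?_ (card_latBox_mul_le R hn)
    exact_mod_cast Finset.card_le_card (Finset.filter_subset _ _)
  have hUcard : ∀ᶠ n : ℕ in atTop, ((U n).card : ℝ) ≤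
      (2 * R + 1) ^ (d₁ + d₂) * (n : ℝ) ^ (d₁ + d₂) := by
    filter_upwards [hScard] with n hn
    refine le_trans ?_ hn
    exact_mod_cast Finset.card_le_card (Finset.filter_subset _ _)
  filter_upwards [ae_tendsto_sum_sub_div hint hindep hident hc hS ha hScard,
    ae_tendsto_sum_sub_div hint hindep hident hc hU ha hUcard] with ω h1 h2
  have h3 := h1.sub h2
  rw [sub_zero] at h3
  refine h3.congr' ?_
  filter_upwards [eventually_ne_atTop 0] with n hn
  rw [← mul_sub, ← Finset.sum_filter_add_sum_filter_not (S n) (fun x => cellIdx m n x ≠ k),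
    add_sub_cancel_left]
  congr 1
  refine Finset.sum_congr (Finset.ext fun x => ?_) fun _ _ => rfl
  simp only [S, Finset.mem_filter, not_not]
  constructor
  · rintro ⟨⟨h, -⟩, h'⟩
    exact ⟨h, h'⟩
  · rintro ⟨h, h'⟩
    exact ⟨⟨h, n, hn, le_rfl, h'⟩, h'⟩

theorem ae_tendsto_sum_latBox {Ω : Type*} [MeasurableSpace Ω] {P : Measure Ω}
    [IsProbabilityMeasure P] {ξ : OrthLat d₁ d₂ → Ω → ℝ} {c : ℝ} (hd : d₁ + d₂ ≠ 0)
    (hint : ∀ x, Integrable (ξ x) P) (hindep : Pairwise (Function.onFun (· ⟂ᵢ[P] ·) ξ))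
    (hident : ∀ x y, IdentDistrib (ξ x) (ξ y) P P) (hc : ∀ x, ∫ ω, ξ x ω ∂P = c) (R : ℕ) :
    ∀ᵐ ω ∂P, Tendsto (fun n : ℕ => ((n : ℝ) ^ (d₁ + d₂))⁻¹ *
      ∑ x ∈ latBox d₁ d₂ (n * R), (ξ x ω - c)) atTop (𝓝 0) := by
  refine ae_tendsto_sum_sub_div hint hindep hident hc
    (fun n n' h => latBox_mono (Nat.mul_le_mul_right R h))
    ((tendsto_pow_atTop hd).comp tendsto_natCast_atTop_atTop)
    (B := (2 * R + 1) ^ (d₁ + d₂)) ?_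
  filter_upwards [eventually_ne_atTop 0] with n hn
  exact card_latBox_mul_le R hn

theorem dist_scaledPt_cellIdx_le {m n : ℕ} (hm : m ≠ 0) (hn : n ≠ 0) (x : OrthLat d₁ d₂) :
    dist (scaledPt n x) (scaledPt m (cellIdx m n x)) ≤ √(d₁ + d₂ : ℕ) / m := by
  have hm' : (0 : ℝ) < m := by positivity
  have hn' : (0 : ℝ) < n := by positivity
  have h1 : ∀ j, |(x.1 j : ℝ) / n - ((cellIdx m n x).1 j : ℝ) / m| ≤ (m : ℝ)⁻¹ := by
    intro j
    obtain ⟨h1, h2⟩ := (cellIdx_eq_iff hn).1 (rfl : cellIdx m n x = _) j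
    have h1' : ((cellIdx m n x).1 j : ℝ) * n ≤ m * x.1 j := by exact_mod_cast h1
    have h2' : (m : ℝ) * x.1 j < ((cellIdx m n x).1 j + 1) * n := by exact_mod_cast h2
    have e : (x.1 j : ℝ) / n - ((cellIdx m n x).1 j : ℝ) / m =
        (m * x.1 j - (cellIdx m n x).1 j * n) / (n * m) := by field_simp
    rw [e, abs_of_nonneg (div_nonneg (by linarith) (by positivity)), div_le_iff₀ (by positivity)]
    field_simp
    linarith
  rw [Subtype.dist_eq, EuclideanSpace.dist_eq]
  have h2 : ∑ j, dist ((scaledPt n x).1 j) ((scaledPt m (cellIdx m n x)).1 j) ^ 2 ≤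
      (d₁ + d₂ : ℕ) * ((m : ℝ)⁻¹) ^ 2 := by
    refine (Finset.sum_le_card_nsmul _ _ (((m : ℝ)⁻¹) ^ 2) fun j _ => ?_).trans ?_
    · gcongr
      exact h1 j
    · simp
  refine (Real.sqrt_le_sqrt h2).trans ?_
  rw [Real.sqrt_mul (by positivity), Real.sqrt_sq (by positivity), div_eq_mul_inv]

/-- Weighted law of large numbers: almost surely, simultaneously for all continuous compactly
supported weights. -/
theorem ae_tendsto_weighted_sum {Ω : Type*} [MeasurableSpace Ω] {P : Measure Ω}
    [IsProbabilityMeasure P] {ξ : OrthLat d₁ d₂ → Ω → ℝ} {c : ℝ} (hd : d₁ + d₂ ≠ 0)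
    (hpos : ∀ x ω, 0 ≤ ξ x ω)
    (hint : ∀ x, Integrable (ξ x) P) (hindep : Pairwise (Function.onFun (· ⟂ᵢ[P] ·) ξ))
    (hident : ∀ x y, IdentDistrib (ξ x) (ξ y) P P) (hc : ∀ x, ∫ ω, ξ x ω ∂P = c) :
    ∀ᵐ ω ∂P, ∀ (R : ℕ) (g : Dbar d₁ d₂ → ℝ), UniformContinuous g →
      (∀ y : Dbar d₁ d₂, (∃ j, (R : ℝ) < |y.1 j|) → g y = 0) →
      Tendsto (fun n : ℕ => ((n : ℝ) ^ (d₁ + d₂))⁻¹ *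
        ∑ x ∈ latBox d₁ d₂ (n * R), g (scaledPt n x) * (ξ x ω - c)) atTop (𝓝 0) := by
  classical
  have hcell : ∀ᵐ ω ∂P, ∀ (R m : ℕ) (k : OrthLat d₁ d₂),
      Tendsto (fun n : ℕ => ((n : ℝ) ^ (d₁ + d₂))⁻¹ *
        ∑ x ∈ (latBox d₁ d₂ (n * R)).filter (fun x => cellIdx m n x = k), (ξ x ω - c))
        atTop (𝓝 0) := by
    simp only [ae_all_iff]
    exact fun R m k => ae_tendsto_sum_cell hd hint hindep hident hc R m k
  have hbox : ∀ᵐ ω ∂P, ∀ R : ℕ, Tendsto (fun n : ℕ => ((n : ℝ) ^ (d₁ + d₂))⁻¹ *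
      ∑ x ∈ latBox d₁ d₂ (n * R), (ξ x ω - c)) atTop (𝓝 0) := by
    simp only [ae_all_iff]
    exact fun R => ae_tendsto_sum_latBox hd hint hindep hident hc R
  have hc0 : 0 ≤ c := by
    rw [← hc ⟨0, fun _ => le_rfl⟩]
    exact integral_nonneg fun ω => hpos _ ω
  filter_upwards [hcell, hbox] with ω h1 h2 R g hg hgR
  rw [Metric.tendsto_atTop']
  intro ε hε
  -- An eventual bound for n^{-d} ∑ (ξ + c) over the box, the 1 being the allowed error in the law
  -- of large numbers. The mesh 1/m is then chosen so that g oscillates by at most ε/(2V) within a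
  -- cell.
  obtain ⟨V, hV⟩ : ∃ V : ℝ, V = 1 + 2 * c * (2 * R + 1) ^ (d₁ + d₂) := ⟨_, rfl⟩
  have hV0 : 0 < V := by rw [hV]; positivity
  obtain ⟨δ, hδ, hgδ⟩ := Metric.uniformContinuous_iff.1 hg (ε / (2 * V)) (by positivity)
  obtain ⟨m, hm⟩ := exists_nat_gt (√(d₁ + d₂ : ℕ) / δ)
  have hm0 : m ≠ 0 := by
    rintro rfl
    have : 0 ≤ √(d₁ + d₂ : ℕ) / δ := by positivity
    simp only [Nat.cast_zero] at hm
    linarith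
  have hm' : (0 : ℝ) < m := by positivity
  have hosc : ∀ n : ℕ, n ≠ 0 → ∀ x : OrthLat d₁ d₂,
      |g (scaledPt n x) - g (scaledPt m (cellIdx m n x))| ≤ ε / (2 * V) := by
    intro n hn x
    refine (hgδ ?_).le
    refine (dist_scaledPt_cellIdx_le hm0 hn x).trans_lt ?_
    rw [div_lt_iff₀ hδ] at hm
    rw [div_lt_iff₀ hm']
    linarith
  -- the piecewise constant approximation
  have hstep : Tendsto (fun n : ℕ => ((n : ℝ) ^ (d₁ + d₂))⁻¹ *
      ∑ x ∈ latBox d₁ d₂ (n * R), g (scaledPt m (cellIdx m n x)) * (ξ x ω - c)) atTop (𝓝 0) := by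
    have h3 : Tendsto (fun n : ℕ => ∑ k ∈ latBox d₁ d₂ (m * R), g (scaledPt m k) *
        (((n : ℝ) ^ (d₁ + d₂))⁻¹ *
        ∑ x ∈ (latBox d₁ d₂ (n * R)).filter (fun x => cellIdx m n x = k), (ξ x ω - c)))
        atTop (𝓝 0) := by
      have := tendsto_finsetSum (latBox d₁ d₂ (m * R)) fun k _ =>
        (h1 R m k).const_mul (g (scaledPt m k))
      simpa using this
    refine h3.congr fun n => ?_
    -- Cells whose index lies outside the box of size mR have their corner beyond R, where g
    -- vanishes, so only finitely many cells matter, independently of n.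
    rw [← Finset.sum_filter_of_ne (s := latBox d₁ d₂ (n * R))
      (f := fun x => g (scaledPt m (cellIdx m n x)) * (ξ x ω - c))
      (p := fun x => cellIdx m n x ∈ latBox d₁ d₂ (m * R))]
    · rw [← Finset.sum_fiberwise_of_maps_to (t := latBox d₁ d₂ (m * R)) (g := cellIdx m n)
        (fun x hx => (Finset.mem_filter.1 hx).2), Finset.mul_sum]
      refine Finset.sum_congr rfl fun k hk => ?_
      rw [mul_left_comm]
      congr 1
      rw [Finset.mul_sum]
      refine Finset.sum_congr ?_ fun x hx => ?_
      · ext x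
        simp only [Finset.mem_filter]
        constructor
        · rintro ⟨h, rfl⟩
          exact ⟨⟨h, hk⟩, rfl⟩
        · rintro ⟨⟨h, -⟩, h'⟩
          exact ⟨h, h'⟩
      · rw [(Finset.mem_filter.1 hx).2]
    · intro x _ hne
      by_contra hmem
      refine hne ?_
      rw [hgR _ ?_, zero_mul]
      rw [mem_latBox] at hmem
      push Not at hmem
      obtain ⟨j, hj⟩ := hmem
      refine ⟨j, ?_⟩
      change (R : ℝ) < |((cellIdx m n x).1 j : ℝ) / m|
      rw [abs_div, abs_of_pos hm', lt_div_iff₀ hm']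
      have : ((m * R : ℕ) : ℝ) < |((cellIdx m n x).1 j : ℝ)| := by exact_mod_cast hj
      push_cast at this
      linarith
  have hst := (Metric.tendsto_atTop'.1 hstep) (ε / 2) (by positivity)
  obtain ⟨N₁, hN₁⟩ := hst
  obtain ⟨N₂, hN₂⟩ := (Metric.tendsto_atTop'.1 (h2 R)) 1 one_pos
  refine ⟨max N₁ N₂, fun n hn => ?_⟩
  have hn0 : n ≠ 0 := by omega
  have hn1 := hN₁ n (lt_of_le_of_lt (le_max_left _ _) hn)
  have hn2 := hN₂ n (lt_of_le_of_lt (le_max_right _ _) hn)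
  rw [Real.dist_eq, sub_zero] at hn1 hn2 ⊢
  have hnpos : (0 : ℝ) < (n : ℝ) ^ (d₁ + d₂) := by positivity
  have hmass : ((n : ℝ) ^ (d₁ + d₂))⁻¹ * ∑ x ∈ latBox d₁ d₂ (n * R), (ξ x ω + c) ≤ V := by
    have e : ∑ x ∈ latBox d₁ d₂ (n * R), (ξ x ω + c) =
        ∑ x ∈ latBox d₁ d₂ (n * R), (ξ x ω - c) + 2 * c * (latBox d₁ d₂ (n * R)).card := by
      rw [Finset.sum_add_distrib, Finset.sum_sub_distrib]
      simp only [Finset.sum_const, nsmul_eq_mul]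
      ring
    rw [e, mul_add, hV]
    refine add_le_add (le_of_lt (lt_of_abs_lt hn2)) ?_
    rw [inv_mul_le_iff₀ hnpos]
    have := mul_le_mul_of_nonneg_left (card_latBox_mul_le (d₁ := d₁) (d₂ := d₂) R hn0)
      (by positivity : 0 ≤ 2 * c)
    linarith
  have hdiff : |((n : ℝ) ^ (d₁ + d₂))⁻¹ * ∑ x ∈ latBox d₁ d₂ (n * R),
      g (scaledPt n x) * (ξ x ω - c) - ((n : ℝ) ^ (d₁ + d₂))⁻¹ *
      ∑ x ∈ latBox d₁ d₂ (n * R), g (scaledPt m (cellIdx m n x)) * (ξ x ω - c)| ≤ ε / 2 := by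
    rw [← mul_sub, ← Finset.sum_sub_distrib, abs_mul, abs_of_pos (by positivity)]
    have h4 : |∑ x ∈ latBox d₁ d₂ (n * R), (g (scaledPt n x) * (ξ x ω - c) -
        g (scaledPt m (cellIdx m n x)) * (ξ x ω - c))| ≤
        ε / (2 * V) * ∑ x ∈ latBox d₁ d₂ (n * R), (ξ x ω + c) := by
      rw [Finset.mul_sum]
      refine (Finset.abs_sum_le_sum_abs _ _).trans (Finset.sum_le_sum fun x _ => ?_)
      rw [← sub_mul, abs_mul]
      refine mul_le_mul (hosc n hn0 x) ?_ (abs_nonneg _) (by positivity)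
      rw [abs_le]
      constructor <;> linarith [hpos x ω]
    calc ((n : ℝ) ^ (d₁ + d₂))⁻¹ * _ ≤ ((n : ℝ) ^ (d₁ + d₂))⁻¹ *
        (ε / (2 * V) * ∑ x ∈ latBox d₁ d₂ (n * R), (ξ x ω + c)) :=
          mul_le_mul_of_nonneg_left h4 (by positivity)
      _ = ε / (2 * V) * (((n : ℝ) ^ (d₁ + d₂))⁻¹ *
        ∑ x ∈ latBox d₁ d₂ (n * R), (ξ x ω + c)) := by ring
      _ ≤ ε / (2 * V) * V := mul_le_mul_of_nonneg_left hmass (by positivity)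
      _ = ε / 2 := by field_simp
  have := abs_le.1 hdiff
  have := abs_lt.1 hn1
  rw [abs_lt]
  constructor <;> linarith

end

noncomputable section

variable {d₁ d₂ : ℕ}

/-! ### Riemann sums over the lattice -/

/-- The projection of `ℝ^d` onto `D̄`. -/
def projDom (x : Euc d₁ d₂) : Euc d₁ d₂ :=
  WithLp.toLp 2 (Sum.elim (fun i => max 0 (x (Sum.inl i))) (fun i => x (Sum.inr i)))

theorem projDom_mem (x : Euc d₁ d₂) : projDom x ∈ closedDom d₁ d₂ := fun _ => le_max_left _ _

theorem projDom_of_mem {x : Euc d₁ d₂} (hx : x ∈ closedDom d₁ d₂) : projDom x = x := by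
  ext j
  rcases j with i | i
  · exact max_eq_right (hx i)
  · rfl

theorem continuous_projDom : Continuous (projDom (d₁ := d₁) (d₂ := d₂)) := by
  refine (PiLp.continuous_toLp 2 _).comp (continuous_pi fun j => ?_)
  rcases j with i | i
  · exact continuous_const.max (PiLp.continuous_apply 2 _ _)
  · exact PiLp.continuous_apply 2 _ _

theorem measurableSet_closedDom : MeasurableSet (closedDom d₁ d₂) :=
  (isClosed_closedDom d₁ d₂).measurableSet

-- The known lattice Riemann sum theorem requires a globally continuous integrand on a bounded set
-- with null frontier. Composing G with the projection onto D̄ supplies the first, and the part of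
-- the cube of half-side R inside D̄ is the second.
open scoped Pointwise in
theorem tendsto_riemann_sum {G : Euc d₁ d₂ → ℝ} (hG : ContinuousOn G (closedDom d₁ d₂)) {R : ℕ}
    (hGR : ∀ y ∈ closedDom d₁ d₂, (∃ j, (R : ℝ) < |y j|) → G y = 0) :
    Tendsto (fun n : ℕ => ((n : ℝ) ^ (d₁ + d₂))⁻¹ *
      ∑ x ∈ latBox d₁ d₂ (n * R), G (scaledPt n x)) atTop (𝓝 (∫ y in closedDom d₁ d₂, G y)) := by
  let F : (Fin d₁ ⊕ Fin d₂ → ℝ) → ℝ := fun v => G (projDom (WithLp.toLp 2 v))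
  have hF : Continuous F := hG.comp_continuous
    (continuous_projDom.comp (PiLp.continuous_toLp 2 _)) fun v => projDom_mem _
  let s : Set (Fin d₁ ⊕ Fin d₂ → ℝ) := Set.Icc (Sum.elim (fun _ => 0) fun _ => -(R : ℝ)) fun _ => R
  have hs : ∀ v, v ∈ s ↔ (WithLp.toLp 2 v : Euc d₁ d₂) ∈ closedDom d₁ d₂ ∧ ∀ j, |v j| ≤ R := by
    intro v
    constructor
    · rintro ⟨h1, h2⟩
      refine ⟨fun i => h1 (Sum.inl i), fun j => abs_le.2 ⟨le_trans ?_ (h1 j), h2 j⟩⟩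
      rcases j with i | i <;> simp
    · rintro ⟨h1, h2⟩
      refine ⟨fun j => ?_, fun j => (abs_le.1 (h2 j)).2⟩
      rcases j with i | i
      · exact h1 i
      · exact (abs_le.1 (h2 _)).1
  have hlim := tendsto_tsum_div_pow_atTop_integral s F hF (Metric.isBounded_Icc _ _)
    measurableSet_Icc ((convex_Icc _ _).addHaar_frontier volume)
  have hint : ∫ x in s, F x = ∫ y in closedDom d₁ d₂, G y := by
    have hmp := PiLp.volume_preserving_toLp (Fin d₁ ⊕ Fin d₂)
    rw [← hmp.setIntegral_preimage_emb (MeasurableEquiv.toLp 2 _).measurableEmbedding]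
    rw [setIntegral_eq_of_subset_of_forall_sdiff_eq_zero (s := s)
      (hmp.measurable measurableSet_closedDom) (fun v hv => ((hs v).1 hv).1)]
    · refine setIntegral_congr_fun measurableSet_Icc fun v hv => ?_
      simp only [F]
      rw [projDom_of_mem ((hs v).1 hv).1]
    · rintro v ⟨hv1, hv2⟩
      refine hGR _ hv1 ?_
      by_contra hcon
      push Not at hcon
      exact hv2 ((hs v).2 ⟨hv1, hcon⟩)
  rw [hint] at hlim
  refine hlim.congr' ?_
  filter_upwards [eventually_ne_atTop 0] with n hn
  have hn' : (0 : ℝ) < n := by positivity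
  have hne : NeZero n := ⟨hn⟩
  rw [Fintype.card_sum, Fintype.card_fin, Fintype.card_fin, div_eq_inv_mul]
  congr 1
  classical
  have hT : s ∩ (n : ℝ)⁻¹ • (Submodule.span ℤ (Set.range (Pi.basisFun ℝ (Fin d₁ ⊕ Fin d₂))) :
      Set (Fin d₁ ⊕ Fin d₂ → ℝ)) =
      ((latBox d₁ d₂ (n * R)).image fun x j => (x.1 j : ℝ) / n : Finset _) := by
    ext v
    rw [Set.mem_inter_iff, hs, ← Submodule.coe_pointwise_smul, SetLike.mem_coe,
      BoxIntegral.unitPartition.mem_smul_span_iff, Finset.coe_image,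
      Set.mem_image]
    constructor
    · rintro ⟨⟨h1, h2⟩, h3⟩
      choose z hz using h3
      have hz' : ∀ j, (z j : ℝ) = n * v j := fun j => by simpa using hz j
      refine ⟨⟨z, fun i => ?_⟩, mem_latBox.2 fun j => ?_, funext fun j => ?_⟩
      · have h4 : (0 : ℝ) ≤ z (Sum.inl i) := by
          rw [hz']
          exact mul_nonneg hn'.le (h1 i)
        exact_mod_cast h4
      · have h4 : |(z j : ℝ)| ≤ n * R := by
          rw [hz', abs_mul, abs_of_pos hn']
          exact mul_le_mul_of_nonneg_left (h2 j) hn'.le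
        exact_mod_cast h4
      · change (z j : ℝ) / n = v j
        rw [hz']
        field_simp
    · rintro ⟨x, hx, rfl⟩
      refine ⟨⟨(scaledPt n x).2, fun j => ?_⟩, fun j => ⟨x.1 j, ?_⟩⟩
      · have h4 : |(x.1 j : ℝ)| ≤ n * R := by exact_mod_cast mem_latBox.1 hx j
        rw [abs_div, abs_of_pos hn', div_le_iff₀ hn']
        linarith
      · simp only [eq_intCast]
        field_simp
  rw [hT, Finset.tsum_subtype', Finset.sum_image]
  · refine Finset.sum_congr rfl fun x _ => ?_
    change G (projDom (scaledPt n x).1) = _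
    rw [projDom_of_mem (scaledPt n x).2]
  · intro x _ y _ hxy
    refine Subtype.ext (funext fun j => ?_)
    have h4 : (x.1 j : ℝ) / n = y.1 j / n := congrFun hxy j
    rw [div_left_inj' hn'.ne'] at h4
    exact_mod_cast h4

end

noncomputable section

variable {d₁ d₂ : ℕ}

/-! ### Calculus on the closed domain -/

theorem convex_closedDom : Convex ℝ (closedDom d₁ d₂) := by
  intro x hx y hy a b ha hb _ i
  have h1 := mul_nonneg ha (hx i)
  have h2 := mul_nonneg hb (hy i)
  simpa using add_nonneg h1 h2

theorem isOpen_openDom : IsOpen (openDom d₁ d₂) := by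
  have : openDom d₁ d₂ = ⋂ i, {x : Euc d₁ d₂ | 0 < x (Sum.inl i)} := by
    ext; simp [openDom]
  rw [this]
  exact isOpen_iInter_of_finite fun i =>
    isOpen_lt continuous_const (PiLp.continuous_apply 2 _ _)

theorem openDom_subset_closedDom : openDom d₁ d₂ ⊆ closedDom d₁ d₂ := fun _ hx i => (hx i).le

theorem interior_closedDom_nonempty : (interior (closedDom d₁ d₂)).Nonempty :=
  ⟨WithLp.toLp 2 fun _ => 1, mem_interior.2
    ⟨openDom d₁ d₂, openDom_subset_closedDom, isOpen_openDom, fun _ => one_pos⟩⟩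

theorem uniqueDiffOn_closedDom : UniqueDiffOn ℝ (closedDom d₁ d₂) :=
  uniqueDiffOn_convex convex_closedDom interior_closedDom_nonempty

theorem interior_closedDom_subset : interior (closedDom d₁ d₂) ⊆ openDom d₁ d₂ := by
  intro x hx i
  obtain ⟨δ, hδ, hball⟩ := Metric.mem_nhds_iff.1 (mem_interior_iff_mem_nhds.1 hx)
  have h1 : x - EuclideanSpace.single (Sum.inl i) (δ / 2) ∈ Metric.ball x δ := by
    rw [Metric.mem_ball, dist_eq_norm, sub_sub_cancel_left, norm_neg, PiLp.norm_single,
      Real.norm_eq_abs, abs_of_pos (by positivity)]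
    linarith
  have h2 := hball h1 i
  simp at h2
  linarith

/-- The two sets differ by part of the frontier of a convex set, which is Lebesgue null. -/
theorem ae_restrict_openDom_eq :
    (volume : Measure (Euc d₁ d₂)).restrict (openDom d₁ d₂) =
      volume.restrict (closedDom d₁ d₂) := by
  refine Measure.restrict_congr_set ?_
  refine (LE.le.eventuallyLE openDom_subset_closedDom).antisymm ?_
  rw [ae_le_set]
  refine measure_mono_null ?_ (convex_closedDom.addHaar_frontier (volume : Measure (Euc d₁ d₂)))
  rintro x ⟨h1, h2⟩
  exact ⟨subset_closure h1, fun h => h2 (interior_closedDom_subset h)⟩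

theorem integrableOn_closedDom_of_continuousOn {E : Type*} [NormedAddCommGroup E]
    {F : Euc d₁ d₂ → E} (hF : ContinuousOn F (closedDom d₁ d₂)) {R : ℝ}
    (hR : ∀ x ∈ closedDom d₁ d₂, R < ‖x‖ → F x = 0) : IntegrableOn F (closedDom d₁ d₂) := by
  have hK : IsCompact (closedDom d₁ d₂ ∩ Metric.closedBall 0 R) :=
    (isCompact_closedBall _ _).inter_left (isClosed_closedDom d₁ d₂)
  refine ((hF.mono inter_subset_left).integrableOn_compact hK).of_forall_sdiff_eq_zero
    measurableSet_closedDom ?_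
  rintro x ⟨h1, h2⟩
  refine hR x h1 ?_
  by_contra h
  exact h2 ⟨h1, by simpa using h⟩

theorem uniformContinuous_toDbar_of_continuousOn {E : Type*} [NormedAddCommGroup E]
    {F : Euc d₁ d₂ → E} (hF : ContinuousOn F (closedDom d₁ d₂)) {R : ℝ}
    (hR : ∀ x ∈ closedDom d₁ d₂, R < ‖x‖ → F x = 0) :
    UniformContinuous fun y : Dbar d₁ d₂ => F y := by
  have hc : Continuous fun y : Dbar d₁ d₂ => F y :=
    continuousOn_iff_continuous_domRestrict.1 hF
  have hs : HasCompactSupport fun y : Dbar d₁ d₂ => F y := by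
    have hK : IsCompact ((Subtype.val : Dbar d₁ d₂ → Euc d₁ d₂) ⁻¹' Metric.closedBall 0 R) :=
      (isClosed_closedDom d₁ d₂).isClosedEmbedding_subtypeVal.isCompact_preimage
        (isCompact_closedBall _ _)
    refine HasCompactSupport.of_support_subset_isCompact hK fun y hy => ?_
    by_contra h
    exact hy (hR y y.2 (by simpa using h))
  exact hs.uniformContinuous_of_continuous hc

theorem hasCompactSupport_toDbar {f : Euc d₁ d₂ → ℝ} (hf : CompactSuppOn f) :
    HasCompactSupport (toDbar f) := by
  obtain ⟨R, hR⟩ := hf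
  have hK : IsCompact ((Subtype.val : Dbar d₁ d₂ → Euc d₁ d₂) ⁻¹' Metric.closedBall 0 R) :=
    (isClosed_closedDom d₁ d₂).isClosedEmbedding_subtypeVal.isCompact_preimage
      (isCompact_closedBall _ _)
  refine HasCompactSupport.of_support_subset_isCompact hK fun y hy => ?_
  by_contra h
  exact hy (hR y y.2 (by simpa using h))

theorem continuous_toDbar {f : Euc d₁ d₂ → ℝ} (hf : ContinuousOn f (closedDom d₁ d₂)) :
    Continuous (toDbar f) :=
  continuousOn_iff_continuous_domRestrict.1 hf

theorem fderivWithin_eq_zero_of_norm_gt {f : Euc d₁ d₂ → ℝ} {R : ℝ}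
    (hR : ∀ x ∈ closedDom d₁ d₂, R < ‖x‖ → f x = 0) {x : Euc d₁ d₂} (hx : x ∈ closedDom d₁ d₂)
    (hxR : R < ‖x‖) : fderivWithin ℝ f (closedDom d₁ d₂) x = 0 := by
  have h1 : f =ᶠ[𝓝[closedDom d₁ d₂] x] fun _ => (0 : ℝ) := by
    filter_upwards [self_mem_nhdsWithin, mem_nhdsWithin_of_mem_nhds
      (continuous_norm.continuousAt.eventually_const_lt hxR)] with y h1 h2
    exact hR y h1 h2
  rw [h1.fderivWithin_eq (hR x hx hxR)]
  simp

theorem Cc2.continuousOn_fderivWithin {f : Euc d₁ d₂ → ℝ} (hf : f ∈ Cc2 d₁ d₂) :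
    ContinuousOn (fderivWithin ℝ f (closedDom d₁ d₂)) (closedDom d₁ d₂) :=
  hf.1.continuousOn_fderivWithin uniqueDiffOn_closedDom one_le_two

theorem norm_sq_eq_sum_apply_single (L : Euc d₁ d₂ →L[ℝ] ℝ) :
    ‖L‖ ^ 2 = ∑ i, (L (EuclideanSpace.single i 1)) ^ 2 := by
  obtain ⟨v, rfl⟩ := (InnerProductSpace.toDual ℝ (Euc d₁ d₂)).surjective L
  rw [LinearIsometryEquiv.norm_map, EuclideanSpace.norm_sq_eq]
  refine Finset.sum_congr rfl fun i _ => ?_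
  rw [InnerProductSpace.toDual_apply_apply, EuclideanSpace.inner_single_right]
  simp

/-- The Dirichlet integral as a sum over the coordinate directions. -/
theorem gradEnergy_eq {f : Euc d₁ d₂ → ℝ} (hf : f ∈ Cc2 d₁ d₂) :
    gradEnergy f = ∑ i, ENNReal.ofReal (∫ x in closedDom d₁ d₂,
      (fderivWithin ℝ f (closedDom d₁ d₂) x (EuclideanSpace.single i 1)) ^ 2) := by
  obtain ⟨R, hR⟩ := hf.2
  have hc : ∀ i, ContinuousOn (fun x => (fderivWithin ℝ f (closedDom d₁ d₂) x
      (EuclideanSpace.single i 1)) ^ 2) (closedDom d₁ d₂) := fun i =>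
    ((Cc2.continuousOn_fderivWithin hf).clm_apply continuousOn_const).pow 2
  have hint : ∀ i, IntegrableOn (fun x => (fderivWithin ℝ f (closedDom d₁ d₂) x
      (EuclideanSpace.single i 1)) ^ 2) (closedDom d₁ d₂) := fun i =>
    integrableOn_closedDom_of_continuousOn (hc i) (R := R) fun x hx hxR => by
      rw [fderivWithin_eq_zero_of_norm_gt hR hx hxR]
      simp
  simp_rw [fun i => ofReal_integral_eq_lintegral_ofReal (hint i) (ae_of_all _ fun x => sq_nonneg _)]
  rw [gradEnergy, ← lintegral_finsetSum' _ fun i _ =>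
    (hint i).aestronglyMeasurable.aemeasurable.ennreal_ofReal]
  refine lintegral_congr fun x => ?_
  rw [← ENNReal.ofReal_sum_of_nonneg fun i _ => sq_nonneg _, ← norm_sq_eq_sum_apply_single,
    ENNReal.ofReal_pow (norm_nonneg _), ofReal_norm]

theorem gradEnergy_lt_top {f : Euc d₁ d₂ → ℝ} (hf : f ∈ Cc2 d₁ d₂) : gradEnergy f < ⊤ := by
  rw [gradEnergy_eq hf]
  exact ENNReal.sum_lt_top.2 fun i _ => ENNReal.ofReal_lt_top

end

noncomputable section

variable {d₁ d₂ : ℕ}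

/-! ### The edges of the lattice -/

/-- The neighbour of `x` in the direction of the `i`-th unit vector. -/
def shiftLat (i : Fin d₁ ⊕ Fin d₂) (x : OrthLat d₁ d₂) : OrthLat d₁ d₂ :=
  ⟨x.1 + Pi.single i 1, fun k => add_nonneg (x.2 k) (by
    rw [Pi.single_apply]
    split_ifs <;> simp)⟩

theorem latGraph_adj_shiftLat (i : Fin d₁ ⊕ Fin d₂) (x : OrthLat d₁ d₂) :
    (latGraph d₁ d₂).Adj x (shiftLat i x) := by
  change ∑ j, (x.1 j - (x.1 j + (Pi.single i 1 : Fin d₁ ⊕ Fin d₂ → ℤ) j)) ^ 2 = 1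
  rw [Finset.sum_eq_single i]
  · simp
  · intro j _ hj
    simp [hj]
  · simp

theorem exists_shiftLat_of_adj {x y : OrthLat d₁ d₂} (h : (latGraph d₁ d₂).Adj x y) :
    ∃ i, y = shiftLat i x ∨ x = shiftLat i y := by
  have h' : ∑ j, (x.1 j - y.1 j) ^ 2 = 1 := h
  obtain ⟨i, hi⟩ : ∃ i, x.1 i - y.1 i ≠ 0 := by
    by_contra hcon
    push Not at hcon
    simp [hcon] at h'
  have h1 : 1 ≤ (x.1 i - y.1 i) ^ 2 := by
    have : 0 < (x.1 i - y.1 i) ^ 2 := by positivity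
    omega
  have h2 : (x.1 i - y.1 i) ^ 2 + ∑ j ∈ Finset.univ.erase i, (x.1 j - y.1 j) ^ 2 = 1 := by
    rw [Finset.add_sum_erase _ (fun j => (x.1 j - y.1 j) ^ 2) (Finset.mem_univ i), h']
  have h3 : 0 ≤ ∑ j ∈ Finset.univ.erase i, (x.1 j - y.1 j) ^ 2 :=
    Finset.sum_nonneg fun j _ => sq_nonneg _
  have h4 : ∀ j, j ≠ i → x.1 j = y.1 j := by
    intro j hj
    have h5 : ∑ j ∈ Finset.univ.erase i, (x.1 j - y.1 j) ^ 2 = 0 := by omega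
    have h6 := (Finset.sum_eq_zero_iff_of_nonneg fun j _ => sq_nonneg _).1 h5 j
      (Finset.mem_erase.2 ⟨hj, Finset.mem_univ j⟩)
    have := pow_eq_zero_iff (two_ne_zero) |>.1 h6
    omega
  have h7 : (x.1 i - y.1 i) ^ 2 = 1 := by omega
  refine ⟨i, ?_⟩
  rcases (show x.1 i - y.1 i = 1 ∨ x.1 i - y.1 i = -1 by
    simpa using h7) with h8 | h8
  · right
    refine Subtype.ext (funext fun j => ?_)
    change x.1 j = y.1 j + (Pi.single i 1 : Fin d₁ ⊕ Fin d₂ → ℤ) j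
    rcases eq_or_ne j i with rfl | hj
    · rw [Pi.single_eq_same]
      omega
    · rw [Pi.single_eq_of_ne hj, h4 j hj, add_zero]
  · left
    refine Subtype.ext (funext fun j => ?_)
    change y.1 j = x.1 j + (Pi.single i 1 : Fin d₁ ⊕ Fin d₂ → ℤ) j
    rcases eq_or_ne j i with rfl | hj
    · rw [Pi.single_eq_same]
      omega
    · rw [Pi.single_eq_of_ne hj, h4 j hj, add_zero]

/-- The edge from `x` in the direction of the `i`-th unit vector. -/
def latEdge (i : Fin d₁ ⊕ Fin d₂) (x : OrthLat d₁ d₂) : (latGraph d₁ d₂).edgeSet :=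
  ⟨s(x, shiftLat i x), latGraph_adj_shiftLat i x⟩

theorem latEdge_injective (i : Fin d₁ ⊕ Fin d₂) :
    Function.Injective (latEdge (d₁ := d₁) (d₂ := d₂) i) := by
  intro x y h
  have h1 : s(x, shiftLat i x) = s(y, shiftLat i y) := congrArg Subtype.val h
  rcases Sym2.eq_iff.1 h1 with h2 | ⟨h2, h3⟩
  · exact h2.1
  · have a : x.1 i = y.1 i + (Pi.single i 1 : Fin d₁ ⊕ Fin d₂ → ℤ) i := by
      conv_lhs => rw [h2]
      rfl
    have b : x.1 i + (Pi.single i 1 : Fin d₁ ⊕ Fin d₂ → ℤ) i = y.1 i := by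
      conv_rhs => rw [← h3]
      rfl
    rw [Pi.single_eq_same] at a b
    omega

theorem conduct_shiftLat (w : Env d₁ d₂) (i : Fin d₁ ⊕ Fin d₂) (x : OrthLat d₁ d₂) :
    conduct w x (shiftLat i x) = w (latEdge i x) := by
  rw [conduct, dif_pos (latGraph_adj_shiftLat i x)]
  rfl

/-- Every adjacent ordered pair is (x, x + e_i) or its reversal, and both kinds contribute the same
sum. -/
theorem tsum_tsum_le_of_adj (F : OrthLat d₁ d₂ → OrthLat d₁ d₂ → ℝ≥0∞)
    (hsymm : ∀ x y, F x y = F y x) (hadj : ∀ x y, ¬ (latGraph d₁ d₂).Adj x y → F x y = 0) :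
    ∑' x, ∑' y, F x y ≤ 2 * ∑ i, ∑' x, F x (shiftLat i x) := by
  classical
  have h1 : ∀ x y, F x y ≤ (∑' i, if y = shiftLat i x then F x y else 0) +
      ∑' i, if x = shiftLat i y then F x y else 0 := by
    intro x y
    by_cases h : (latGraph d₁ d₂).Adj x y
    · obtain ⟨i, hi | hi⟩ := exists_shiftLat_of_adj h
      · refine le_add_right (le_trans ?_ (ENNReal.le_tsum i))
        rw [if_pos hi]
      · refine le_add_left (le_trans ?_ (ENNReal.le_tsum i))
        rw [if_pos hi]
    · rw [hadj x y h]
      exact zero_le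
  have h2 : ∑' x, ∑' y, ∑' i, (if y = shiftLat i x then F x y else 0) =
      ∑ i, ∑' x, F x (shiftLat i x) := by
    have e : ∑ i, ∑' x, F x (shiftLat i x) = ∑' i, ∑' x, F x (shiftLat i x) :=
      (tsum_fintype _).symm
    rw [e, ENNReal.tsum_comm (β := OrthLat d₁ d₂) (α := Fin d₁ ⊕ Fin d₂)]
    refine tsum_congr fun x => ?_
    rw [ENNReal.tsum_comm]
    refine tsum_congr fun i => ?_
    rw [tsum_eq_single (shiftLat i x) fun y hy => if_neg hy, if_pos rfl]
  have h3 : ∑' x, ∑' y, ∑' i, (if x = shiftLat i y then F x y else 0) =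
      ∑ i, ∑' x, F x (shiftLat i x) := by
    rw [← h2, ENNReal.tsum_comm]
    refine tsum_congr fun x => tsum_congr fun y => tsum_congr fun i => ?_
    rw [hsymm]
  calc ∑' x, ∑' y, F x y ≤ ∑' x, ∑' y, ((∑' i, if y = shiftLat i x then F x y else 0) +
        ∑' i, if x = shiftLat i y then F x y else 0) :=
        ENNReal.tsum_le_tsum fun x => ENNReal.tsum_le_tsum fun y => h1 x y
    _ = 2 * ∑ i, ∑' x, F x (shiftLat i x) := by
        simp_rw [ENNReal.tsum_add]
        rw [h2, h3, two_mul]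

/-- Dropping the cluster constraint leaves an i.i.d. weighted sum; the double counting of edges
cancels the factor 1/2. -/
theorem discreteEnergy_le_sum (w : Env d₁ d₂) (n : ℕ) (f : Dbar d₁ d₂ → ℝ) :
    discreteEnergy w n f ≤ ENNReal.ofReal ((n : ℝ) ^ (2 - ((d₁ + d₂ : ℕ) : ℤ))) *
      ∑ i, ∑' x, ENNReal.ofReal ((f (scaledPt n x) - f (scaledPt n (shiftLat i x))) ^ 2) *
        (w (latEdge i x) : ℝ≥0∞) := by
  classical
  let F : OrthLat d₁ d₂ → OrthLat d₁ d₂ → ℝ≥0∞ := fun x y =>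
    ENNReal.ofReal ((f (scaledPt n x) - f (scaledPt n y)) ^ 2) * conduct w x y
  have hF := tsum_tsum_le_of_adj F (fun x y => by
      simp only [F]
      rw [conduct_comm, ← neg_sub, neg_sq]) (fun x y h => by
      simp only [F]
      rw [conduct_eq_zero (mt mem_nbrs.1 h)]
      simp)
  have h1 : (∑' x : OrthLat d₁ d₂, ∑' y : OrthLat d₁ d₂,
      if x ∈ cluster w ∧ y ∈ cluster w ∧ (openGraph w).Adj x y then F x y else 0) ≤
      ∑' x, ∑' y, F x y :=
    ENNReal.tsum_le_tsum fun x => ENNReal.tsum_le_tsum fun y => by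
      split_ifs
      · exact le_rfl
      · exact zero_le
  have h2 : discreteEnergy w n f ≤ ENNReal.ofReal ((n : ℝ) ^ (2 - ((d₁ + d₂ : ℕ) : ℤ)) / 2) *
      (2 * ∑ i, ∑' x, F x (shiftLat i x)) := by
    refine le_trans (le_of_eq ?_) (mul_le_mul_right (h1.trans hF) _)
    rw [discreteEnergy]
  refine h2.trans (le_of_eq ?_)
  rw [← mul_assoc]
  congr 1
  · rw [ENNReal.ofReal_div_of_pos two_pos, ENNReal.ofReal_ofNat,
      ENNReal.div_mul_cancel two_ne_zero ENNReal.ofNat_ne_top]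
  · simp only [F, conduct_shiftLat]

end

noncomputable section

variable {d₁ d₂ : ℕ}

/-! ### The upper bound for the discrete energies -/

theorem scaledPt_shiftLat {n : ℕ} (i : Fin d₁ ⊕ Fin d₂) (x : OrthLat d₁ d₂) :
    (scaledPt n (shiftLat i x)).1 = (scaledPt n x).1 + EuclideanSpace.single i ((n : ℝ)⁻¹) := by
  ext j
  change (((x.1 j + (Pi.single i 1 : Fin d₁ ⊕ Fin d₂ → ℤ) j : ℤ)) : ℝ) / n =
    (x.1 j : ℝ) / n + (EuclideanSpace.single i ((n : ℝ)⁻¹) : Euc d₁ d₂) j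
  rcases eq_or_ne j i with rfl | hj
  · simp [add_div]
  · simp [hj]

theorem lt_norm_scaledPt_of_notMem_latBox {n N : ℕ} (hn : n ≠ 0) {x : OrthLat d₁ d₂}
    (hx : x ∉ latBox d₁ d₂ (n * N)) : (N : ℝ) < ‖(scaledPt n x).1‖ := by
  have hn' : (0 : ℝ) < n := by positivity
  rw [mem_latBox] at hx
  push Not at hx
  obtain ⟨j, hj⟩ := hx
  have h1 : ((n * N : ℕ) : ℝ) < |(x.1 j : ℝ)| := by exact_mod_cast hj
  refine lt_of_lt_of_le ?_ (PiLp.norm_apply_le (scaledPt n x).1 j)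
  change (N : ℝ) < |(x.1 j : ℝ) / n|
  rw [abs_div, abs_of_pos hn', lt_div_iff₀ hn']
  push_cast at h1
  linarith

/-- Difference quotients along the lattice edges are uniformly close to partial derivatives. -/
theorem eventually_diff_sq_le {f : Euc d₁ d₂ → ℝ} (hf : f ∈ Cc2 d₁ d₂) (i : Fin d₁ ⊕ Fin d₂)
    {ε : ℝ} (hε : 0 < ε) : ∀ᶠ n : ℕ in atTop, ∀ x : OrthLat d₁ d₂,
      (n : ℝ) ^ 2 * (f (scaledPt n x) - f (scaledPt n (shiftLat i x))) ^ 2 ≤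
        (fderivWithin ℝ f (closedDom d₁ d₂) (scaledPt n x) (EuclideanSpace.single i 1)) ^ 2 + ε := by
  obtain ⟨R, hR⟩ := hf.2
  have huc := uniformContinuous_toDbar_of_continuousOn
    (((Cc2.continuousOn_fderivWithin hf).clm_apply
      (continuousOn_const (c := EuclideanSpace.single i (1 : ℝ)))).pow 2) (R := R)
    fun x hx hxR => by
      simp only [Pi.pow_apply]
      rw [fderivWithin_eq_zero_of_norm_gt hR hx hxR]
      simp
  obtain ⟨δ, hδ, hunif⟩ := Metric.uniformContinuous_iff.1 huc ε hε
  have hinv : ∀ᶠ n : ℕ in atTop, ((n : ℝ)⁻¹) < δ :=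
    (tendsto_inv_atTop_zero.comp tendsto_natCast_atTop_atTop).eventually_lt_const hδ
  filter_upwards [hinv, eventually_ne_atTop 0] with n hnδ hn x
  have hn' : (0 : ℝ) < n := by positivity
  -- Mean value theorem on the edge, which stays in the convex set D̄. The difference quotient is a
  -- partial derivative at a point within 1/n of x/n, and the squared partial derivative is
  -- uniformly continuous.
  obtain ⟨z, hz, hzf⟩ := domain_mvt (f := f) (s := closedDom d₁ d₂)
    (f' := fderivWithin ℝ f (closedDom d₁ d₂))
    (fun y hy => ((hf.1.differentiableOn two_ne_zero) y hy).hasFDerivWithinAt)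
    convex_closedDom (scaledPt n x).2 (scaledPt n (shiftLat i x)).2
  have hzD : z ∈ closedDom d₁ d₂ :=
    convex_closedDom.segment_subset (scaledPt n x).2 (scaledPt n (shiftLat i x)).2 hz
  rw [scaledPt_shiftLat, add_sub_cancel_left] at hzf
  have hsingle : (EuclideanSpace.single i ((n : ℝ)⁻¹) : Euc d₁ d₂) =
      (n : ℝ)⁻¹ • EuclideanSpace.single i (1 : ℝ) := by
    ext j
    rcases eq_or_ne j i with rfl | hj
    · simp
    · simp [hj]
  have hdist : dist (⟨z, hzD⟩ : Dbar d₁ d₂) (scaledPt n x) < δ := by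
    refine lt_of_le_of_lt ?_ hnδ
    rw [Subtype.dist_eq]
    have h1 := (convex_closedBall (scaledPt n x).1 ((n : ℝ)⁻¹)).segment_subset
      (Metric.mem_closedBall_self (by positivity))
      (y := (scaledPt n (shiftLat i x)).1) (by
        rw [scaledPt_shiftLat, Metric.mem_closedBall, dist_eq_norm, add_sub_cancel_left,
          PiLp.norm_single, Real.norm_eq_abs, abs_of_pos (by positivity)])
    exact Metric.mem_closedBall.1 (h1 hz)
  have h2 := hunif hdist
  rw [Real.dist_eq] at h2
  have h3 : (n : ℝ) ^ 2 * (f (scaledPt n x) - f (scaledPt n (shiftLat i x))) ^ 2 =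
      (fderivWithin ℝ f (closedDom d₁ d₂) z (EuclideanSpace.single i 1)) ^ 2 := by
    rw [← neg_sub, neg_sq, scaledPt_shiftLat, hzf, hsingle, map_smul, smul_eq_mul]
    field_simp
  rw [h3]
  have := (abs_lt.1 h2).2
  simp only [Pi.pow_apply] at this
  linarith

/-- Deterministic upper bound for the limit superior of the discrete energies, given the law of
large numbers for the conductances. -/
theorem limsup_discreteEnergy_le {w : Env d₁ d₂} {c : ℝ≥0}
    (hbox : ∀ i, ∀ R : ℕ, Tendsto (fun n : ℕ => ((n : ℝ) ^ (d₁ + d₂))⁻¹ *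
      ∑ x ∈ latBox d₁ d₂ (n * R), ((w (latEdge i x) : ℝ) - c)) atTop (𝓝 0))
    (hlln : ∀ i, ∀ (R : ℕ) (g : Dbar d₁ d₂ → ℝ), UniformContinuous g →
      (∀ y : Dbar d₁ d₂, (∃ j, (R : ℝ) < |y.1 j|) → g y = 0) →
      Tendsto (fun n : ℕ => ((n : ℝ) ^ (d₁ + d₂))⁻¹ *
        ∑ x ∈ latBox d₁ d₂ (n * R), g (scaledPt n x) * ((w (latEdge i x) : ℝ) - c)) atTop (𝓝 0))
    {f : Euc d₁ d₂ → ℝ} (hf : f ∈ Cc2 d₁ d₂) :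
    limsup (fun n => discreteEnergy w n (toDbar f)) atTop ≤ c * gradEnergy f := by
  obtain ⟨R, hR⟩ := hf.2
  -- The extra 1 covers the other endpoint of an edge, at distance 1/n ≤ 1: edges starting outside
  -- the box of size N then contribute nothing.
  obtain ⟨N, hN⟩ := exists_nat_gt (R + 1)
  let G : Fin d₁ ⊕ Fin d₂ → Euc d₁ d₂ → ℝ := fun i y =>
    (fderivWithin ℝ f (closedDom d₁ d₂) y (EuclideanSpace.single i 1)) ^ 2
  have hGc : ∀ i, ContinuousOn (G i) (closedDom d₁ d₂) := fun i =>
    ((Cc2.continuousOn_fderivWithin hf).clm_apply continuousOn_const).pow 2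
  have hG0 : ∀ i y, y ∈ closedDom d₁ d₂ → R < ‖y‖ → G i y = 0 := fun i y hy hyR => by
    simp only [G]
    rw [fderivWithin_eq_zero_of_norm_gt hR hy hyR]
    simp
  have hGN : ∀ i, ∀ y ∈ closedDom d₁ d₂, (∃ j, (N : ℝ) < |y j|) → G i y = 0 := by
    rintro i y hy ⟨j, hj⟩
    have h1 : |y j| ≤ ‖y‖ := PiLp.norm_apply_le y j
    exact hG0 i y hy (by linarith)
  have hconv : ∀ i, Tendsto (fun n : ℕ => ((n : ℝ) ^ (d₁ + d₂))⁻¹ *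
      ∑ x ∈ latBox d₁ d₂ (n * N), G i (scaledPt n x) * w (latEdge i x)) atTop
      (𝓝 (c * ∫ y in closedDom d₁ d₂, G i y)) := by
    intro i
    have h1 := hlln i N (fun y => G i y)
      (uniformContinuous_toDbar_of_continuousOn (hGc i) (hG0 i)) (fun y hy => hGN i y y.2 hy)
    have h2 := (tendsto_riemann_sum (hGc i) (hGN i)).const_mul (c : ℝ)
    have h3 := h1.add h2
    rw [zero_add] at h3
    refine h3.congr fun n => ?_
    rw [mul_left_comm, ← mul_add, Finset.mul_sum, ← Finset.sum_add_distrib]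
    congr 1
    exact Finset.sum_congr rfl fun x _ => by ring
  -- Eventual bound for the normalised total conductance in the box, which multiplies the uniform
  -- error ε of the difference quotients.
  obtain ⟨V, hV⟩ : ∃ V : ℝ, V = 1 + c * (2 * N + 1) ^ (d₁ + d₂) := ⟨_, rfl⟩
  have hV0 : 0 < V := by rw [hV]; positivity
  have hmass : ∀ i, ∀ᶠ n : ℕ in atTop, ((n : ℝ) ^ (d₁ + d₂))⁻¹ *
      ∑ x ∈ latBox d₁ d₂ (n * N), (w (latEdge i x) : ℝ) ≤ V := by
    intro i
    filter_upwards [(hbox i N).eventually_lt_const one_pos, eventually_ne_atTop 0] with n h1 hn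
    have hnpos : (0 : ℝ) < (n : ℝ) ^ (d₁ + d₂) := by positivity
    have h2 : ((n : ℝ) ^ (d₁ + d₂))⁻¹ * (c * (latBox d₁ d₂ (n * N)).card) ≤
        c * (2 * N + 1) ^ (d₁ + d₂) := by
      rw [inv_mul_le_iff₀ hnpos]
      have := mul_le_mul_of_nonneg_left (card_latBox_mul_le (d₁ := d₁) (d₂ := d₂) N hn)
        (NNReal.coe_nonneg c)
      linarith
    rw [Finset.sum_sub_distrib, mul_sub] at h1
    simp only [Finset.sum_const, nsmul_eq_mul] at h1
    rw [mul_comm ((latBox d₁ d₂ (n * N)).card : ℝ) (c : ℝ)] at h1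
    linarith
  have hbound : ∀ ε : ℝ, 0 < ε → limsup (fun n => discreteEnergy w n (toDbar f)) atTop ≤
      ∑ i, ENNReal.ofReal (c * (∫ y in closedDom d₁ d₂, G i y) + ε * V) := by
    intro ε hε
    have hlim : Tendsto (fun n : ℕ => ∑ i, ENNReal.ofReal (((n : ℝ) ^ (d₁ + d₂))⁻¹ *
        ∑ x ∈ latBox d₁ d₂ (n * N), G i (scaledPt n x) * w (latEdge i x) + ε * V)) atTop
        (𝓝 (∑ i, ENNReal.ofReal (c * (∫ y in closedDom d₁ d₂, G i y) + ε * V))) :=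
      tendsto_finsetSum _ fun i _ => ENNReal.tendsto_ofReal ((hconv i).add_const _)
    rw [← hlim.limsup_eq]
    refine limsup_le_limsup ?_
    filter_upwards [eventually_all.2 fun i => eventually_diff_sq_le hf i hε,
      eventually_all.2 hmass, eventually_ne_atTop 0] with n h1 h2 hn
    have hn' : (1 : ℝ) ≤ n := by exact_mod_cast Nat.one_le_iff_ne_zero.2 hn
    have hnpos : (0 : ℝ) < (n : ℝ) ^ (d₁ + d₂) := by positivity
    refine (discreteEnergy_le_sum w n (toDbar f)).trans ?_
    rw [Finset.mul_sum]
    refine Finset.sum_le_sum fun i _ => ?_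
    have hzero : ∀ x ∉ latBox d₁ d₂ (n * N),
        ENNReal.ofReal ((toDbar f (scaledPt n x) - toDbar f (scaledPt n (shiftLat i x))) ^ 2) *
          (w (latEdge i x) : ℝ≥0∞) = 0 := by
      intro x hx
      have h3 := lt_norm_scaledPt_of_notMem_latBox hn hx
      have h4 : ‖(scaledPt n x).1‖ - (n : ℝ)⁻¹ ≤ ‖(scaledPt n (shiftLat i x)).1‖ := by
        rw [scaledPt_shiftLat]
        have := norm_sub_le ((scaledPt n x).1 + EuclideanSpace.single i ((n : ℝ)⁻¹))
          (EuclideanSpace.single i ((n : ℝ)⁻¹))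
        rw [add_sub_cancel_right, PiLp.norm_single, Real.norm_eq_abs,
          abs_of_pos (by positivity)] at this
        linarith
      have h5 : (n : ℝ)⁻¹ ≤ 1 := inv_le_one_of_one_le₀ hn'
      simp only [toDbar]
      rw [hR _ (scaledPt n x).2 (by linarith), hR _ (scaledPt n (shiftLat i x)).2 (by linarith)]
      simp
    rw [tsum_eq_sum (s := latBox d₁ d₂ (n * N)) hzero, Finset.mul_sum]
    have hterm : ∀ x ∈ latBox d₁ d₂ (n * N),
        ENNReal.ofReal ((n : ℝ) ^ (2 - ((d₁ + d₂ : ℕ) : ℤ))) *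
          (ENNReal.ofReal ((toDbar f (scaledPt n x) - toDbar f (scaledPt n (shiftLat i x))) ^ 2) *
          (w (latEdge i x) : ℝ≥0∞)) ≤ ENNReal.ofReal (((n : ℝ) ^ (d₁ + d₂))⁻¹ *
          ((G i (scaledPt n x) + ε) * w (latEdge i x))) := by
      intro x _
      rw [← ENNReal.ofReal_coe_nnreal, ← ENNReal.ofReal_mul (by positivity),
        ← ENNReal.ofReal_mul (by positivity)]
      refine ENNReal.ofReal_le_ofReal ?_
      rw [zpow_sub₀ (by positivity), zpow_natCast, zpow_ofNat, div_eq_inv_mul, mul_assoc]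
      refine mul_le_mul_of_nonneg_left ?_ (by positivity)
      rw [← mul_assoc]
      exact mul_le_mul_of_nonneg_right (h1 i x) (NNReal.coe_nonneg _)
    refine (Finset.sum_le_sum hterm).trans ?_
    rw [← ENNReal.ofReal_sum_of_nonneg fun x _ => by positivity]
    refine ENNReal.ofReal_le_ofReal ?_
    rw [← Finset.mul_sum]
    simp_rw [add_mul]
    rw [Finset.sum_add_distrib, mul_add, ← Finset.mul_sum]
    have := mul_le_mul_of_nonneg_left (h2 i) hε.le
    linarith
  have hlim : Tendsto (fun ε : ℝ =>
      ∑ i, ENNReal.ofReal (c * (∫ y in closedDom d₁ d₂, G i y) + ε * V)) (𝓝[>] 0)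
      (𝓝 (∑ i, ENNReal.ofReal (c * (∫ y in closedDom d₁ d₂, G i y)))) := by
    refine tendsto_finsetSum _ fun i _ => ENNReal.tendsto_ofReal ?_
    have : Tendsto (fun ε : ℝ => c * (∫ y in closedDom d₁ d₂, G i y) + ε * V) (𝓝 0)
        (𝓝 (c * (∫ y in closedDom d₁ d₂, G i y) + 0 * V)) :=
      tendsto_const_nhds.add (tendsto_id.mul_const V)
    rw [zero_mul, add_zero] at this
    exact this.mono_left nhdsWithin_le_nhds
  have hfin := ge_of_tendsto hlim (eventually_nhdsWithin_of_forall fun ε hε => hbound ε hε)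
  refine hfin.trans (le_of_eq ?_)
  rw [gradEnergy_eq hf, Finset.mul_sum]
  refine Finset.sum_congr rfl fun i _ => ?_
  rw [ENNReal.ofReal_mul (NNReal.coe_nonneg c), ENNReal.ofReal_coe_nnreal]

/-- Almost surely the discrete energies are asymptotically dominated by the Dirichlet integral. -/
theorem ae_limsup_discreteEnergy_le {Ω : Type*} [MeasurableSpace Ω] {P : Measure Ω}
    [IsProbabilityMeasure P] {μ : (latGraph d₁ d₂).edgeSet → Ω → ℝ≥0}
    (hmeas : ∀ e, Measurable (μ e)) (hindep : iIndepFun μ P)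
    (hident : ∀ e e', IdentDistrib (μ e) (μ e') P P)
    {C₀ : ℝ≥0} (hC₀ : ∀ e, ∫⁻ ω, (μ e ω : ℝ≥0∞) ∂P = C₀) :
    ∀ᵐ ω ∂P, ∀ f ∈ Cc2 d₁ d₂,
      limsup (fun n => discreteEnergy (fun e => μ e ω) n (toDbar f)) atTop ≤ C₀ * gradEnergy f := by
  rcases eq_or_ne (d₁ + d₂) 0 with hd | hd
  -- In dimension zero the normalisation n^d does not diverge, but there are no edge directions
  -- either, so the required laws are vacuous.
  · refine ae_of_all _ fun ω f hf => ?_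
    have : IsEmpty (Fin d₁ ⊕ Fin d₂) := by
      obtain ⟨rfl, rfl⟩ := Nat.add_eq_zero_iff.1 hd
      infer_instance
    exact limsup_discreteEnergy_le (w := fun e => μ e ω) (fun i => isEmptyElim i)
      (fun i => isEmptyElim i) hf
  have hint : ∀ i x, Integrable (fun ω => (μ (latEdge i x) ω : ℝ)) P := by
    intro i x
    refine ⟨(hmeas _).coe_nnreal_real.aestronglyMeasurable, ?_⟩
    have : ∫⁻ ω, ‖(μ (latEdge i x) ω : ℝ)‖ₑ ∂P = C₀ := by
      rw [← hC₀ (latEdge i x)]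
      exact lintegral_congr fun ω => by simp
    rw [HasFiniteIntegral, this]
    exact ENNReal.coe_lt_top
  have hmean : ∀ i x, ∫ ω, (μ (latEdge i x) ω : ℝ) ∂P = C₀ := by
    intro i x
    rw [integral_eq_lintegral_of_nonneg_ae (ae_of_all _ fun ω => NNReal.coe_nonneg _)
      (hmeas _).coe_nnreal_real.aestronglyMeasurable]
    simp_rw [ENNReal.ofReal_coe_nnreal]
    rw [hC₀, ENNReal.coe_toReal]
  have hind : ∀ i, Pairwise (Function.onFun (· ⟂ᵢ[P] ·)
      fun (x : OrthLat d₁ d₂) ω => (μ (latEdge i x) ω : ℝ)) := by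
    -- Working one direction at a time makes the edges distinct for distinct x, so the conductances
    -- are independent.
    intro i x y hxy
    exact (hindep.indepFun ((latEdge_injective i).ne hxy)).comp measurable_coe_nnreal_real
      measurable_coe_nnreal_real
  have hid : ∀ i, ∀ x y : OrthLat d₁ d₂, IdentDistrib (fun ω => (μ (latEdge i x) ω : ℝ))
      (fun ω => (μ (latEdge i y) ω : ℝ)) P P := fun i x y =>
    (hident (latEdge i x) (latEdge i y)).comp measurable_coe_nnreal_real
  have h1 : ∀ᵐ ω ∂P, ∀ i, ∀ R : ℕ, Tendsto (fun n : ℕ => ((n : ℝ) ^ (d₁ + d₂))⁻¹ *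
      ∑ x ∈ latBox d₁ d₂ (n * R), ((μ (latEdge i x) ω : ℝ) - C₀)) atTop (𝓝 0) := by
    simp only [ae_all_iff]
    exact fun i R => ae_tendsto_sum_latBox hd (hint i) (hind i) (hid i) (hmean i) R
  have h2 := ae_all_iff.2 fun i => ae_tendsto_weighted_sum hd
    (fun x ω => NNReal.coe_nonneg (μ (latEdge i x) ω)) (hint i) (hind i) (hid i) (hmean i)
  filter_upwards [h1, h2] with ω h3 h4 f hf
  exact limsup_discreteEnergy_le (w := fun e => μ e ω) h3 h4 hf

end

noncomputable section

variable {d₁ d₂ : ℕ}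

/-! ### Weak gradients -/

/-- The gradient of a function on `D̄`. -/
def gradDom (f : Euc d₁ d₂ → ℝ) (x : Euc d₁ d₂) : Euc d₁ d₂ :=
  (InnerProductSpace.toDual ℝ (Euc d₁ d₂)).symm (fderivWithin ℝ f (closedDom d₁ d₂) x)

theorem inner_gradDom (f : Euc d₁ d₂ → ℝ) (x v : Euc d₁ d₂) :
    inner ℝ (gradDom f x) v = fderivWithin ℝ f (closedDom d₁ d₂) x v :=
  InnerProductSpace.toDual_symm_apply

theorem norm_gradDom (f : Euc d₁ d₂ → ℝ) (x : Euc d₁ d₂) :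
    ‖gradDom f x‖ = ‖fderivWithin ℝ f (closedDom d₁ d₂) x‖ :=
  LinearIsometryEquiv.norm_map _ _

theorem memLp_two_of_continuousOn_closedDom {E : Type*} [NormedAddCommGroup E]
    {F : Euc d₁ d₂ → E} (hF : ContinuousOn F (closedDom d₁ d₂)) {R : ℝ}
    (hR : ∀ x ∈ closedDom d₁ d₂, R < ‖x‖ → F x = 0) :
    MemLp F 2 (volume.restrict (openDom d₁ d₂)) := by
  rw [ae_restrict_openDom_eq]
  have hm : AEStronglyMeasurable F (volume.restrict (closedDom d₁ d₂)) :=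
    hF.aestronglyMeasurable measurableSet_closedDom
  rw [memLp_two_iff_integrable_sq_norm hm]
  exact integrableOn_closedDom_of_continuousOn (hF.norm.pow 2) (R := R)
    fun x hx hxR => by simp [hR x hx hxR]

theorem Cc2.continuousOn_gradDom {f : Euc d₁ d₂ → ℝ} (hf : f ∈ Cc2 d₁ d₂) :
    ContinuousOn (gradDom f) (closedDom d₁ d₂) :=
  (LinearIsometryEquiv.continuous _).comp_continuousOn (Cc2.continuousOn_fderivWithin hf)

theorem fderivWithin_eq_fderiv_of_mem_openDom {f : Euc d₁ d₂ → ℝ} {x : Euc d₁ d₂}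
    (hx : x ∈ openDom d₁ d₂) : fderivWithin ℝ f (closedDom d₁ d₂) x = fderiv ℝ f x :=
  fderivWithin_of_mem_nhds
    (mem_of_superset (isOpen_openDom.mem_nhds hx) openDom_subset_closedDom)

theorem setIntegral_openDom_eq_integral {F : Euc d₁ d₂ → ℝ} (hF : ∀ x ∉ openDom d₁ d₂, F x = 0) :
    ∫ x in openDom d₁ d₂, F x = ∫ x, F x :=
  setIntegral_eq_integral_of_forall_compl_eq_zero hF

theorem integrable_of_continuousOn_of_tsupport {F ψ : Euc d₁ d₂ → ℝ}
    (hF : ContinuousOn F (closedDom d₁ d₂)) (hψ : Continuous ψ) (hc : HasCompactSupport ψ)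
    (hsub : tsupport ψ ⊆ openDom d₁ d₂) : Integrable (fun x => F x * ψ x) := by
  obtain ⟨R, hR⟩ := hc.isCompact.isBounded.subset_closedBall 0
  have h1 : IntegrableOn (fun x => F x * ψ x) (closedDom d₁ d₂) :=
    integrableOn_closedDom_of_continuousOn (hF.mul hψ.continuousOn) (R := R) fun x _ hxR => by
      rw [image_eq_zero_of_notMem_tsupport (f := ψ), mul_zero]
      intro h
      have := hR h
      rw [mem_closedBall_zero_iff] at this
      linarith
  refine h1.integrable_of_forall_notMem_eq_zero fun x hx => ?_
  rw [image_eq_zero_of_notMem_tsupport fun h => hx (openDom_subset_closedDom (hsub h)), mul_zero]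

/-- Test functions are compactly supported inside the open set D, so integration by parts on the
whole space applies without boundary terms, whatever the values of f off D̄. -/
theorem Cc2.isWeakGrad {f : Euc d₁ d₂ → ℝ} (hf : f ∈ Cc2 d₁ d₂) : IsWeakGrad f (gradDom f) := by
  obtain ⟨R, hR⟩ := hf.2
  refine ⟨memLp_two_of_continuousOn_closedDom (Cc2.continuousOn_gradDom hf) (R := R)
    fun x hx hxR => ?_, fun ψ hψ hψc hψD v => ?_⟩
  · rw [← norm_eq_zero, norm_gradDom, fderivWithin_eq_zero_of_norm_gt hR hx hxR, norm_zero]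
  have hdψ : Continuous fun x => fderiv ℝ ψ x v :=
    (hψ.continuous_fderiv (by simp)).clm_apply continuous_const
  have hdc : HasCompactSupport fun x => fderiv ℝ ψ x v := hψc.fderiv_apply (𝕜 := ℝ) v
  have hdsub : tsupport (fun x => fderiv ℝ ψ x v) ⊆ tsupport ψ := tsupport_fderiv_apply_subset ℝ v
  have hψ0 : ∀ x ∉ openDom d₁ d₂, ψ x = 0 := fun x hx =>
    image_eq_zero_of_notMem_tsupport fun h => hx (hψD h)
  have hdψ0 : ∀ x ∉ openDom d₁ d₂, fderiv ℝ ψ x v = 0 := fun x hx =>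
    image_eq_zero_of_notMem_tsupport (f := fun x => fderiv ℝ ψ x v) fun h => hx (hψD (hdsub h))
  have heq : ∀ x, fderiv ℝ f x v * ψ x = inner ℝ (gradDom f x) v * ψ x := by
    intro x
    by_cases hx : x ∈ openDom d₁ d₂
    · rw [inner_gradDom, fderivWithin_eq_fderiv_of_mem_openDom hx]
    · rw [hψ0 x hx, mul_zero, mul_zero]
  rw [setIntegral_openDom_eq_integral fun x hx => by rw [hdψ0 x hx, mul_zero],
    setIntegral_openDom_eq_integral fun x hx => by rw [hψ0 x hx, mul_zero]]
  simp_rw [← heq]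
  refine integral_mul_fderiv_eq_neg_fderiv_mul_of_integrable ?_ ?_ ?_ (fun x hx => ?_)
    fun x _ => (hψ.differentiable (by simp)) x
  · simp_rw [heq]
    exact integrable_of_continuousOn_of_tsupport
      ((Cc2.continuousOn_gradDom hf).inner continuousOn_const) hψ.continuous hψc hψD
  · exact integrable_of_continuousOn_of_tsupport hf.1.continuousOn hdψ hdc (hdsub.trans hψD)
  · exact integrable_of_continuousOn_of_tsupport hf.1.continuousOn hψ.continuous hψc hψD
  · exact (hf.1.differentiableOn two_ne_zero).differentiableAt
      (mem_of_superset (isOpen_openDom.mem_nhds (hψD hx)) openDom_subset_closedDom)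

theorem Cc2.mem_W12 {f : Euc d₁ d₂ → ℝ} (hf : f ∈ Cc2 d₁ d₂) : f ∈ W12 d₁ d₂ := by
  obtain ⟨R, hR⟩ := hf.2
  exact ⟨memLp_two_of_continuousOn_closedDom hf.1.continuousOn hR, _, Cc2.isWeakGrad hf⟩

theorem memLp_two_mul_continuous {F ψ : Euc d₁ d₂ → ℝ} {U : Set (Euc d₁ d₂)}
    (hF : MemLp F 2 (volume.restrict U)) (hψ : Continuous ψ) (hc : HasCompactSupport ψ) :
    Integrable (fun x => F x * ψ x) (volume.restrict U) :=
  hF.integrable_mul (q := 2) ((hψ.memLp_of_hasCompactSupport hc).restrict U)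

/-- The fundamental lemma of the calculus of variations, coordinate by coordinate. It makes
`refForm` independent of the choice in `weakGrad`. -/
theorem IsWeakGrad.ae_eq {u : Euc d₁ d₂ → ℝ} {G G' : Euc d₁ d₂ → Euc d₁ d₂}
    (h : IsWeakGrad u G) (h' : IsWeakGrad u G') :
    G =ᵐ[volume.restrict (openDom d₁ d₂)] G' := by
  have hcoord : ∀ i, ∀ᵐ x ∂(volume.restrict (openDom d₁ d₂)),
      inner ℝ (G x) (EuclideanSpace.single i (1 : ℝ)) =
        inner ℝ (G' x) (EuclideanSpace.single i (1 : ℝ)) := by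
    intro i
    have hm := (h.1.inner_const (EuclideanSpace.single i (1 : ℝ)) (𝕜 := ℝ))
    have hm' := (h'.1.inner_const (EuclideanSpace.single i (1 : ℝ)) (𝕜 := ℝ))
    have hloc : LocallyIntegrableOn (fun x => inner ℝ (G x) (EuclideanSpace.single i (1 : ℝ)) -
        inner ℝ (G' x) (EuclideanSpace.single i (1 : ℝ))) (openDom d₁ d₂) volume :=
      locallyIntegrableOn_of_locallyIntegrable_restrict
        ((hm.sub hm').locallyIntegrable one_le_two)
    have hz := isOpen_openDom.ae_eq_zero_of_integral_contDiff_smul_eq_zero hloc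
      fun ψ hψ hψc hψD => by
        have e1 := h.2 ψ hψ hψc hψD (EuclideanSpace.single i (1 : ℝ))
        have e2 := h'.2 ψ hψ hψc hψD (EuclideanSpace.single i (1 : ℝ))
        rw [e1, neg_inj] at e2
        have hψ0 : ∀ x ∉ openDom d₁ d₂, ψ x = 0 := fun x hx =>
          image_eq_zero_of_notMem_tsupport fun h => hx (hψD h)
        rw [← setIntegral_openDom_eq_integral fun x hx => by rw [hψ0 x hx, zero_smul]]
        have e3 : ∀ x, ψ x • (inner ℝ (G x) (EuclideanSpace.single i (1 : ℝ)) -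
            inner ℝ (G' x) (EuclideanSpace.single i (1 : ℝ))) =
            inner ℝ (G x) (EuclideanSpace.single i (1 : ℝ)) * ψ x -
            inner ℝ (G' x) (EuclideanSpace.single i (1 : ℝ)) * ψ x := fun x => by
          rw [smul_eq_mul]; ring
        simp_rw [e3]
        rw [integral_sub (memLp_two_mul_continuous hm hψ.continuous hψc)
          (memLp_two_mul_continuous hm' hψ.continuous hψc), e2, sub_self]
    rw [ae_restrict_iff' isOpen_openDom.measurableSet]
    filter_upwards [hz] with x hx hxD
    exact sub_eq_zero.1 (hx hxD)
  filter_upwards [ae_all_iff.2 hcoord] with x hx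
  ext i
  simpa [EuclideanSpace.inner_single_right] using hx i

theorem isWeakGrad_weakGrad {u : Euc d₁ d₂ → ℝ} (h : ∃ G, IsWeakGrad u G) :
    IsWeakGrad u (weakGrad u) := by
  rw [weakGrad, dif_pos h]
  exact h.choose_spec

theorem IsWeakGrad.sub {u v : Euc d₁ d₂ → ℝ} {G H : Euc d₁ d₂ → Euc d₁ d₂}
    (hu : MemLp u 2 (volume.restrict (openDom d₁ d₂)))
    (hv : MemLp v 2 (volume.restrict (openDom d₁ d₂)))
    (h : IsWeakGrad u G) (h' : IsWeakGrad v H) : IsWeakGrad (u - v) (G - H) := by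
  refine ⟨h.1.sub h'.1, fun ψ hψ hψc hψD z => ?_⟩
  have hdψ : Continuous fun x => fderiv ℝ ψ x z :=
    (hψ.continuous_fderiv (by simp)).clm_apply continuous_const
  have hdc : HasCompactSupport fun x => fderiv ℝ ψ x z := hψc.fderiv_apply (𝕜 := ℝ) z
  simp only [Pi.sub_apply, sub_mul, inner_sub_left]
  rw [integral_sub (memLp_two_mul_continuous hu hdψ hdc) (memLp_two_mul_continuous hv hdψ hdc),
    integral_sub (memLp_two_mul_continuous (h.1.inner_const z) hψ.continuous hψc)
      (memLp_two_mul_continuous (h'.1.inner_const z) hψ.continuous hψc),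
    h.2 ψ hψ hψc hψD z, h'.2 ψ hψ hψc hψD z]
  ring

/-! ### The reference form -/

theorem dotProduct_self_eq_norm_sq (v : Euc d₁ d₂) : v.ofLp ⬝ᵥ v.ofLp = ‖v‖ ^ 2 := by
  rw [EuclideanSpace.norm_sq_eq]
  refine Finset.sum_congr rfl fun i _ => ?_
  rw [Real.norm_eq_abs, sq_abs, sq]

theorem refForm_eq {A : Euc d₁ d₂ → Matrix (Fin d₁ ⊕ Fin d₂) (Fin d₁ ⊕ Fin d₂) ℝ}
    {u : Euc d₁ d₂ → ℝ} {G : Euc d₁ d₂ → Euc d₁ d₂} (hG : IsWeakGrad u G) :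
    refForm A u u = (1 / 2) * ∫ x in openDom d₁ d₂, (G x).ofLp ⬝ᵥ (A x).mulVec (G x).ofLp := by
  rw [refForm]
  congr 1
  refine integral_congr_ae ?_
  filter_upwards [(isWeakGrad_weakGrad ⟨G, hG⟩).ae_eq hG] with x hx
  rw [hx]

theorem refForm_le {A : Euc d₁ d₂ → Matrix (Fin d₁ ⊕ Fin d₂) (Fin d₁ ⊕ Fin d₂) ℝ} {c : ℝ}
    (hc : 1 ≤ c) (hA : ∀ᵐ x ∂(volume.restrict (closedDom d₁ d₂)), ∀ ξ : Fin d₁ ⊕ Fin d₂ → ℝ,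
      c⁻¹ * (ξ ⬝ᵥ ξ) ≤ ξ ⬝ᵥ (A x).mulVec ξ ∧ ξ ⬝ᵥ (A x).mulVec ξ ≤ c * (ξ ⬝ᵥ ξ))
    {u : Euc d₁ d₂ → ℝ} {G : Euc d₁ d₂ → Euc d₁ d₂} (hG : IsWeakGrad u G) :
    refForm A u u ≤ c / 2 * ∫ x in openDom d₁ d₂, ‖G x‖ ^ 2 := by
  rw [refForm_eq hG]
  have hsq : Integrable (fun x => ‖G x‖ ^ 2) (volume.restrict (openDom d₁ d₂)) :=
    (memLp_two_iff_integrable_sq_norm hG.1.aestronglyMeasurable).1 hG.1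
  rw [← ae_restrict_openDom_eq] at hA
  have h1 : ∫ x in openDom d₁ d₂, (G x).ofLp ⬝ᵥ (A x).mulVec (G x).ofLp ≤
      ∫ x in openDom d₁ d₂, c * ‖G x‖ ^ 2 := by
    refine integral_mono_of_nonneg ?_ (hsq.const_mul c) ?_
    · filter_upwards [hA] with x hx
      have := (hx (G x).ofLp).1
      rw [dotProduct_self_eq_norm_sq] at this
      exact le_trans (by positivity) this
    · filter_upwards [hA] with x hx
      have := (hx (G x).ofLp).2
      rwa [dotProduct_self_eq_norm_sq] at this
  rw [integral_const_mul] at h1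
  linarith

/-- Unlike in the upper bound, measurability of A matters here: without integrability of ∇u · A∇u
its Bochner integral would be 0 and the inequality could fail. -/
theorem le_refForm {A : Euc d₁ d₂ → Matrix (Fin d₁ ⊕ Fin d₂) (Fin d₁ ⊕ Fin d₂) ℝ} {c : ℝ}
    (hc : 1 ≤ c) (hm : ∀ i j, Measurable fun x => A x i j)
    (hA : ∀ᵐ x ∂(volume.restrict (closedDom d₁ d₂)), ∀ ξ : Fin d₁ ⊕ Fin d₂ → ℝ,
      c⁻¹ * (ξ ⬝ᵥ ξ) ≤ ξ ⬝ᵥ (A x).mulVec ξ ∧ ξ ⬝ᵥ (A x).mulVec ξ ≤ c * (ξ ⬝ᵥ ξ))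
    {u : Euc d₁ d₂ → ℝ} {G : Euc d₁ d₂ → Euc d₁ d₂} (hG : IsWeakGrad u G) :
    ∫ x in openDom d₁ d₂, ‖G x‖ ^ 2 ≤ 2 * c * refForm A u u := by
  rw [refForm_eq hG]
  have hsq : Integrable (fun x => ‖G x‖ ^ 2) (volume.restrict (openDom d₁ d₂)) :=
    (memLp_two_iff_integrable_sq_norm hG.1.aestronglyMeasurable).1 hG.1
  rw [← ae_restrict_openDom_eq] at hA
  have hc0 : 0 < c := by linarith
  have hmeas : AEStronglyMeasurable (fun x => (G x).ofLp ⬝ᵥ (A x).mulVec (G x).ofLp)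
      (volume.restrict (openDom d₁ d₂)) := by
    have hGi : ∀ i, AEMeasurable (fun x => G x i) (volume.restrict (openDom d₁ d₂)) := fun i =>
      (PiLp.continuous_apply 2 _ i).measurable.comp_aemeasurable
        hG.1.aestronglyMeasurable.aemeasurable
    refine AEMeasurable.aestronglyMeasurable ?_
    simp only [dotProduct, Matrix.mulVec]
    exact Finset.aemeasurable_fun_sum _ fun i _ => (hGi i).mul
      (Finset.aemeasurable_fun_sum _ fun j _ => (hm i j).aemeasurable.mul (hGi j))
  have hint : Integrable (fun x => (G x).ofLp ⬝ᵥ (A x).mulVec (G x).ofLp)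
      (volume.restrict (openDom d₁ d₂)) := by
    refine (hsq.const_mul c).mono' hmeas ?_
    filter_upwards [hA] with x hx
    have h1 := (hx (G x).ofLp).1
    have h2 := (hx (G x).ofLp).2
    rw [dotProduct_self_eq_norm_sq] at h1 h2
    rw [Real.norm_eq_abs, abs_of_nonneg (le_trans (by positivity) h1)]
    exact h2
  have h1 : ∫ x in openDom d₁ d₂, c⁻¹ * ‖G x‖ ^ 2 ≤
      ∫ x in openDom d₁ d₂, (G x).ofLp ⬝ᵥ (A x).mulVec (G x).ofLp := by
    refine integral_mono_ae (hsq.const_mul _) hint ?_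
    filter_upwards [hA] with x hx
    have h1 := (hx (G x).ofLp).1
    rwa [dotProduct_self_eq_norm_sq] at h1
  rw [integral_const_mul, inv_mul_le_iff₀ hc0] at h1
  linarith

end

noncomputable section

variable {d₁ d₂ : ℕ}

/-! ### Mollification in `L²` -/

theorem eLpNorm_two_sq {α F : Type*} [MeasurableSpace α] [NormedAddCommGroup F] (g : α → F)
    (μ : Measure α) : eLpNorm g 2 μ ^ 2 = ∫⁻ x, ‖g x‖ₑ ^ 2 ∂μ := by
  have := eLpNorm_nnreal_pow_eq_lintegral (f := g) (μ := μ) (p := 2) two_ne_zero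
  simpa using this

/-- Strong continuity of the translation group on L², read off from the continuous additive action
on `Lp`. -/
theorem eventually_eLpNorm_translate_sub_le {E F : Type*} [NormedAddCommGroup E]
    [NormedSpace ℝ E] [FiniteDimensional ℝ E] [MeasurableSpace E] [BorelSpace E]
    [NormedAddCommGroup F] {ν : Measure E} [ν.IsAddHaarMeasure] {g : E → F} (hg : MemLp g 2 ν)
    {ε : ℝ≥0∞} (hε : 0 < ε) :
    ∀ᶠ t in 𝓝 (0 : E), eLpNorm (fun x => g (x - t) - g x) 2 ν ≤ ε := by
  have : Fact ((2 : ℝ≥0∞) ≠ ⊤) := ⟨ENNReal.ofNat_ne_top⟩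
  have hcont : Continuous fun t : E => DomAddAct.mk (-t) +ᵥ hg.toLp g :=
    Continuous.vadd (DomAddAct.mkHomeomorph.continuous.comp continuous_neg) continuous_const
  have h1 : Tendsto (fun t : E => edist (DomAddAct.mk (-t) +ᵥ hg.toLp g) (hg.toLp g)) (𝓝 0)
      (𝓝 0) := by
    have h2 := hcont.tendsto 0
    rw [neg_zero, DomAddAct.mk_zero, zero_vadd] at h2
    exact tendsto_iff_edist_tendsto_0.1 h2
  filter_upwards [h1.eventually_le_const hε] with t ht
  rw [DomAddAct.mk_vadd_toLp, Lp.edist_toLp_toLp] at ht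
  refine le_trans (le_of_eq ?_) ht
  refine eLpNorm_congr_ae (ae_of_all _ fun x => ?_)
  simp [sub_eq_neg_add]

/-- Mollification with a probability density moves an `L²` function by at most the modulus of
continuity of its translations on the support of the density. -/
theorem eLpNorm_convolution_sub_le {E F : Type*} [NormedAddCommGroup E]
    [NormedSpace ℝ E] [FiniteDimensional ℝ E] [MeasurableSpace E] [BorelSpace E]
    [NormedAddCommGroup F] [NormedSpace ℝ F] [CompleteSpace F] {ν : Measure E} [ν.IsAddHaarMeasure]
    {g : E → F} (hg : MemLp g 2 ν) {φ : E → ℝ} (hφ : Continuous φ) (hφc : HasCompactSupport φ)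
    (hφ0 : ∀ x, 0 ≤ φ x) (hφ1 : ∫ x, φ x ∂ν = 1) {ε : ℝ≥0∞}
    (hε : ∀ t ∈ Function.support φ, eLpNorm (fun x => g (x - t) - g x) 2 ν ≤ ε) :
    eLpNorm (fun x => convolution φ g (ContinuousLinearMap.lsmul ℝ ℝ) ν x - g x) 2 ν ≤ ε := by
  -- A strongly measurable representative is needed for joint measurability of g(x - t), hence for
  -- Fubini.
  wlog hgm : StronglyMeasurable g generalizing g
  · have hae : hg.1.mk g =ᵐ[ν] g := hg.1.ae_eq_mk.symm
    have h1 := this (g := hg.1.mk g) (hg.ae_eq hae.symm) (fun t ht => by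
      refine le_trans (le_of_eq (eLpNorm_congr_ae ?_)) (hε t ht)
      have h2 : ∀ᵐ x ∂ν, hg.1.mk g (x - t) = g (x - t) :=
        (measurePreserving_sub_right ν t).quasiMeasurePreserving.ae hae
      filter_upwards [hae, h2] with x h3 h4
      rw [h3, h4]) hg.1.stronglyMeasurable_mk
    refine le_trans (le_of_eq (eLpNorm_congr_ae ?_)) h1
    rw [convolution_congr _ EventuallyEq.rfl hae]
    filter_upwards [hae] with x hx
    rw [hx]
  have hφm : Measurable fun x => ENNReal.ofReal (φ x) := hφ.measurable.ennreal_ofReal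
  have hφi : Integrable φ ν := hφ.integrable_of_hasCompactSupport hφc
  let ρ : Measure E := ν.withDensity fun x => ENNReal.ofReal (φ x)
  have hρ : IsProbabilityMeasure ρ := ⟨by
    rw [withDensity_apply _ MeasurableSet.univ, setLIntegral_univ,
      ← ofReal_integral_eq_lintegral_ofReal hφi (ae_of_all _ hφ0), hφ1, ENNReal.ofReal_one]⟩
  have hloc : LocallyIntegrable g ν := hg.locallyIntegrable one_le_two
  have hjoint : StronglyMeasurable fun p : E × E => g (p.1 - p.2) - g p.1 :=
    (hgm.comp_measurable (measurable_fst.sub measurable_snd)).sub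
      (hgm.comp_measurable measurable_fst)
  have hslice : ∀ x, StronglyMeasurable fun t => g (x - t) - g x := fun x =>
    hjoint.comp_measurable (measurable_const.prodMk measurable_id)
  -- Jensen for the probability ρ = φ dν: the difference is a ρ-average of g(x - t) - g(x), and its
  -- L¹(ρ) norm is at most its L²(ρ) norm.
  have hpt : ∀ x, ‖convolution φ g (ContinuousLinearMap.lsmul ℝ ℝ) ν x - g x‖ₑ ^ 2 ≤
      ∫⁻ t, ‖g (x - t) - g x‖ₑ ^ 2 ∂ρ := by
    intro x
    have hex : Integrable (fun t => φ t • g (x - t)) ν :=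
      hφc.convolutionExists_left (ContinuousLinearMap.lsmul ℝ ℝ) hφ hloc x
    have e1 : convolution φ g (ContinuousLinearMap.lsmul ℝ ℝ) ν x - g x =
        ∫ t, φ t • (g (x - t) - g x) ∂ν := by
      simp_rw [smul_sub]
      rw [integral_sub hex (hφi.smul_const _), integral_smul_const, hφ1, one_smul]
      rfl
    have e2 : ‖∫ t, φ t • (g (x - t) - g x) ∂ν‖ₑ ≤ eLpNorm (fun t => g (x - t) - g x) 1 ρ := by
      refine (enorm_integral_le_lintegral_enorm _).trans (le_of_eq ?_)
      rw [eLpNorm_one_eq_lintegral_enorm,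
        lintegral_withDensity_eq_lintegral_mul _ hφm (hslice x).enorm]
      refine lintegral_congr fun t => ?_
      rw [enorm_smul, Pi.mul_apply, Real.enorm_of_nonneg (hφ0 t)]
    have e3 : eLpNorm (fun t => g (x - t) - g x) 1 ρ ≤ eLpNorm (fun t => g (x - t) - g x) 2 ρ :=
      eLpNorm_le_eLpNorm_of_exponent_le one_le_two (hslice x).aestronglyMeasurable
    rw [e1, ← eLpNorm_two_sq]
    gcongr
    exact e2.trans e3
  have hsq : eLpNorm (fun x => convolution φ g (ContinuousLinearMap.lsmul ℝ ℝ) ν x - g x) 2 ν ^ 2 ≤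
      ε ^ 2 := by
    rw [eLpNorm_two_sq]
    calc ∫⁻ x, ‖convolution φ g (ContinuousLinearMap.lsmul ℝ ℝ) ν x - g x‖ₑ ^ 2 ∂ν
        ≤ ∫⁻ x, ∫⁻ t, ‖g (x - t) - g x‖ₑ ^ 2 ∂ρ ∂ν := lintegral_mono hpt
      _ = ∫⁻ t, ∫⁻ x, ‖g (x - t) - g x‖ₑ ^ 2 ∂ν ∂ρ :=
          lintegral_lintegral_swap (hjoint.enorm.pow_const 2).aemeasurable
      _ ≤ ∫⁻ _, ε ^ 2 ∂ρ := by
          refine lintegral_mono_ae ?_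
          rw [ae_withDensity_iff hφm]
          refine ae_of_all _ fun t ht => ?_
          rw [← eLpNorm_two_sq]
          gcongr
          refine hε t fun h => ht ?_
          rw [h, ENNReal.ofReal_zero]
      _ = ε ^ 2 := by simp
  exact (ENNReal.pow_le_pow_left_iff two_ne_zero).1 hsq

end

noncomputable section

variable {d₁ d₂ : ℕ}

/-! ### Smooth approximation in `W^{1,2}` -/

theorem mem_Cc2_of_contDiff {f : Euc d₁ d₂ → ℝ} (hf : ContDiff ℝ 2 f)
    (hc : HasCompactSupport f) : f ∈ Cc2 d₁ d₂ := by
  obtain ⟨R, hR⟩ := hc.isCompact.isBounded.subset_closedBall 0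
  refine ⟨hf.contDiffOn, R, fun x _ hx => image_eq_zero_of_notMem_tsupport fun h => ?_⟩
  have := hR h
  rw [mem_closedBall_zero_iff] at this
  linarith

/-- A smooth probability density supported near the origin inside `-D`. -/
theorem exists_mollifier {δ : ℝ} (hδ : 0 < δ) : ∃ φ : Euc d₁ d₂ → ℝ,
    ContDiff ℝ ((⊤ : ℕ∞) : WithTop ℕ∞) φ ∧ HasCompactSupport φ ∧ (∀ x, 0 ≤ φ x) ∧ ∫ x, φ x = 1 ∧
      Function.support φ ⊆ Metric.ball 0 δ ∧ ∀ x ∈ tsupport φ, -x ∈ openDom d₁ d₂ := by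
  let e : Euc d₁ d₂ := WithLp.toLp 2 fun _ => 1
  obtain ⟨s, hs, hsδ⟩ : ∃ s : ℝ, 0 < s ∧ s * (‖e‖ + 1) < δ :=
    ⟨δ / (2 * (‖e‖ + 1)), by positivity, by
      rw [div_mul_eq_mul_div, div_lt_iff₀ (by positivity)]
      nlinarith [norm_nonneg e]⟩
  -- Centred at (-s, …, -s) with radius s/2, so every coordinate of the support is at most -s/2
  -- while the norm stays below δ.
  let b : ContDiffBump (-(s • e)) := ⟨s / 4, s / 2, by positivity, by linarith⟩
  refine ⟨b.normed volume, b.contDiff_normed, b.hasCompactSupport_normed, b.nonneg_normed,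
    b.integral_normed, ?_, ?_⟩
  · rw [b.support_normed_eq]
    intro x hx
    rw [mem_ball_zero_iff]
    have h1 : ‖x + s • e‖ < s / 2 := by
      rw [Metric.mem_ball, dist_eq_norm, sub_neg_eq_add] at hx
      exact hx
    have h2 : ‖x‖ ≤ ‖x + s • e‖ + ‖s • e‖ := by
      have := norm_sub_le (x + s • e) (s • e)
      rwa [add_sub_cancel_right] at this
    rw [norm_smul, Real.norm_eq_abs, abs_of_pos hs] at h2
    linarith
  · rw [b.tsupport_normed_eq]
    intro x hx i
    rw [Metric.mem_closedBall, dist_eq_norm, sub_neg_eq_add] at hx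
    have h1 : |(x + s • e) (Sum.inl i)| ≤ s / 2 := (PiLp.norm_apply_le _ _).trans hx
    have h2 : (x + s • e) (Sum.inl i) = x (Sum.inl i) + s := by simp [e]
    rw [h2] at h1
    have := (abs_le.1 h1).2
    change 0 < -(x (Sum.inl i))
    linarith

/-- On `D̄` the gradient of the mollified function is the mollified weak gradient. -/
theorem gradDom_convolution {u : Euc d₁ d₂ → ℝ} {G : Euc d₁ d₂ → Euc d₁ d₂}
    (hu : MemLp u 2 (volume.restrict (openDom d₁ d₂))) (hG : IsWeakGrad u G)
    {φ : Euc d₁ d₂ → ℝ} (hφ : ContDiff ℝ ((⊤ : ℕ∞) : WithTop ℕ∞) φ) (hφc : HasCompactSupport φ)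
    (hφD : ∀ x ∈ tsupport φ, -x ∈ openDom d₁ d₂) {x : Euc d₁ d₂} (hx : x ∈ closedDom d₁ d₂) :
    gradDom (convolution φ ((openDom d₁ d₂).indicator u) (ContinuousLinearMap.lsmul ℝ ℝ) volume) x =
      convolution φ ((openDom d₁ d₂).indicator G) (ContinuousLinearMap.lsmul ℝ ℝ) volume x := by
  have hD : MeasurableSet (openDom d₁ d₂) := isOpen_openDom.measurableSet
  have hul : LocallyIntegrable ((openDom d₁ d₂).indicator u) volume :=
    ((memLp_indicator_iff_restrict hD).2 hu).locallyIntegrable one_le_two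
  have hGl : LocallyIntegrable ((openDom d₁ d₂).indicator G) volume :=
    ((memLp_indicator_iff_restrict hD).2 hG.1).locallyIntegrable one_le_two
  have hswap : convolution φ ((openDom d₁ d₂).indicator u) (ContinuousLinearMap.lsmul ℝ ℝ) volume =
      convolution ((openDom d₁ d₂).indicator u) φ (ContinuousLinearMap.lsmul ℝ ℝ) volume := by
    ext y
    rw [convolution_lsmul_swap, convolution_lsmul]
    exact integral_congr_ae (ae_of_all _ fun t => by simp only [smul_eq_mul]; ring)
  have hderiv := hφc.hasFDerivAt_convolution_right (ContinuousLinearMap.lsmul ℝ ℝ) hul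
    (hφ.of_le (by simp)) x
  refine ext_inner_right ℝ fun v => ?_
  rw [inner_gradDom, hswap, hderiv.hasFDerivWithinAt.fderivWithin (uniqueDiffOn_closedDom x hx),
    convolution_precompR_apply _ hul (hφc.fderiv ℝ) (hφ.continuous_fderiv (by simp))]
  -- For x in D̄ the support of ψ lies in x + D ⊆ D because the kernel lives in -D, so ψ is an
  -- admissible test function up to and including boundary points x.
  let ψ : Euc d₁ d₂ → ℝ := fun t => φ (x - t)
  have hψ : ContDiff ℝ ((⊤ : ℕ∞) : WithTop ℕ∞) ψ := hφ.comp (contDiff_const.sub contDiff_id)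
  have hψc : HasCompactSupport ψ := hφc.comp_homeomorph (Homeomorph.subLeft x)
  have hts : tsupport ψ = (Homeomorph.subLeft x) ⁻¹' tsupport φ :=
    tsupport_comp_eq_preimage φ (Homeomorph.subLeft x)
  have hψD : tsupport ψ ⊆ openDom d₁ d₂ := by
    intro t ht i
    rw [hts] at ht
    have h1 : x - t ∈ tsupport φ := ht
    have h2 : 0 < -((x - t) (Sum.inl i)) := hφD _ h1 i
    have h3 : (x - t) (Sum.inl i) = x (Sum.inl i) - t (Sum.inl i) := rfl
    rw [h3] at h2
    linarith [hx i]
  have hψ' : ∀ t, fderiv ℝ ψ t v = -(fderiv ℝ φ (x - t) v) := by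
    intro t
    have h1 : HasFDerivAt φ (fderiv ℝ φ (x - t)) (x - t) :=
      (hφ.differentiable (by simp) _).hasFDerivAt
    have h2 : HasFDerivAt (fun t : Euc d₁ d₂ => x - t) (-(ContinuousLinearMap.id ℝ _)) t :=
      (hasFDerivAt_id t).const_sub x
    have h3 := (h1.comp t h2).fderiv
    change fderiv ℝ (φ ∘ fun t => x - t) t v = _
    rw [h3]
    simp
  have hweak := hG.2 ψ hψ hψc hψD v
  have e1 : convolution ((openDom d₁ d₂).indicator u) (fun a => fderiv ℝ φ a v)
      (ContinuousLinearMap.lsmul ℝ ℝ) volume x =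
      -∫ t in openDom d₁ d₂, u t * fderiv ℝ ψ t v := by
    rw [convolution_lsmul, ← integral_indicator hD, ← integral_neg]
    refine integral_congr_ae (ae_of_all _ fun t => ?_)
    simp only [hψ', smul_eq_mul]
    by_cases ht : t ∈ openDom d₁ d₂
    · simp [ht]
    · simp [ht]
  have e2 : inner ℝ (convolution φ ((openDom d₁ d₂).indicator G)
      (ContinuousLinearMap.lsmul ℝ ℝ) volume x) v =
      ∫ t in openDom d₁ d₂, inner ℝ (G t) v * ψ t := by
    have hint : Integrable (fun t => φ (x - t) • (openDom d₁ d₂).indicator G t) volume := by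
      have := (hφc.convolutionExists_left (ContinuousLinearMap.lsmul ℝ ℝ) hφ.continuous hGl x)
      exact this.integrable_swap
    rw [convolution_lsmul_swap, real_inner_comm, ← integral_inner hint, ← integral_indicator hD]
    refine integral_congr_ae (ae_of_all _ fun t => ?_)
    by_cases ht : t ∈ openDom d₁ d₂
    · simp [ht, ψ, real_inner_comm, inner_smul_right, mul_comm]
    · simp [ht]
  rw [e2]
  refine Eq.trans e1 ?_
  rw [hweak, neg_neg]

/-- Mollify the zero extensions of u and G with the one-sided kernel; on D̄ the gradient of the
first is the mollification of the second. Bounded support of u makes the result compactly supported.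
-/
theorem exists_Cc2_approx_of_compactSupp {u : Euc d₁ d₂ → ℝ} {G : Euc d₁ d₂ → Euc d₁ d₂}
    (hu : MemLp u 2 (volume.restrict (openDom d₁ d₂))) (hG : IsWeakGrad u G) {R : ℝ}
    (hR : ∀ x, R < ‖x‖ → u x = 0) {ε : ℝ≥0∞} (hε : 0 < ε) :
    ∃ f ∈ Cc2 d₁ d₂, eLpNorm (u - f) 2 (volume.restrict (openDom d₁ d₂)) ≤ ε ∧
      eLpNorm (G - gradDom f) 2 (volume.restrict (openDom d₁ d₂)) ≤ ε := by
  have hD : MeasurableSet (openDom d₁ d₂) := isOpen_openDom.measurableSet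
  have hu' := (memLp_indicator_iff_restrict hD).2 hu
  have hG' := (memLp_indicator_iff_restrict hD).2 hG.1
  obtain ⟨δ, hδ, hball⟩ := Metric.mem_nhds_iff.1
    ((eventually_eLpNorm_translate_sub_le hu' hε).and (eventually_eLpNorm_translate_sub_le hG' hε))
  obtain ⟨φ, hφ, hφc, hφ0, hφ1, hφδ, hφD⟩ := exists_mollifier (d₁ := d₁) (d₂ := d₂) hδ
  have h1 := eLpNorm_convolution_sub_le hu' hφ.continuous hφc hφ0 hφ1
    fun t ht => (hball (hφδ ht)).1
  have h2 := eLpNorm_convolution_sub_le hG' hφ.continuous hφc hφ0 hφ1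
    fun t ht => (hball (hφδ ht)).2
  have hsupp : HasCompactSupport ((openDom d₁ d₂).indicator u) := by
    refine HasCompactSupport.of_support_subset_isCompact (isCompact_closedBall 0 R) fun x hx => ?_
    rw [mem_closedBall_zero_iff]
    by_contra h
    exact hx (indicator_apply_eq_zero.2 fun _ => hR x (not_le.1 h))
  refine ⟨convolution φ ((openDom d₁ d₂).indicator u) (ContinuousLinearMap.lsmul ℝ ℝ) volume,
    mem_Cc2_of_contDiff ?_ (hφc.convolution _ hsupp), ?_, ?_⟩
  · exact hφc.contDiff_convolution_left _ (hφ.of_le (by exact_mod_cast le_top))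
      (hu'.locallyIntegrable one_le_two)
  · refine le_trans (le_of_eq ?_) ((eLpNorm_mono_measure _
      (Measure.restrict_le_self (s := openDom d₁ d₂))).trans h1)
    rw [← eLpNorm_neg]
    refine eLpNorm_congr_ae ?_
    filter_upwards [ae_restrict_mem hD] with x hx
    simp [hx]
  · refine le_trans (le_of_eq ?_) ((eLpNorm_mono_measure _
      (Measure.restrict_le_self (s := openDom d₁ d₂))).trans h2)
    rw [← eLpNorm_neg]
    refine eLpNorm_congr_ae ?_
    filter_upwards [ae_restrict_mem hD] with x hx
    rw [Pi.neg_apply, Pi.sub_apply,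
      gradDom_convolution hu hG hφ hφc hφD (openDom_subset_closedDom hx)]
    simp [hx]

end

noncomputable section

variable {d₁ d₂ : ℕ}

/-! ### Cutting off -/

/-- Product rule for a weak gradient and a smooth compactly supported function. -/
theorem IsWeakGrad.mul_smooth {u : Euc d₁ d₂ → ℝ} {G : Euc d₁ d₂ → Euc d₁ d₂}
    (hu : MemLp u 2 (volume.restrict (openDom d₁ d₂))) (hG : IsWeakGrad u G)
    {χ : Euc d₁ d₂ → ℝ} (hχ : ContDiff ℝ ((⊤ : ℕ∞) : WithTop ℕ∞) χ) (hχc : HasCompactSupport χ) :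
    IsWeakGrad (fun x => χ x * u x) fun x => χ x • G x + u x • gradient χ x := by
  have hgc : Continuous (gradient χ) :=
    (LinearIsometryEquiv.continuous _).comp (hχ.continuous_fderiv (by simp))
  have hgi : ∀ x v, inner ℝ (gradient χ x) v = fderiv ℝ χ x v := fun x v =>
    InnerProductSpace.toDual_symm_apply
  have hgs : HasCompactSupport (gradient χ) := by
    refine (hχc.fderiv ℝ).mono fun x hx => ?_
    intro h
    refine hx ?_
    rw [gradient, h, map_zero]
  obtain ⟨B₁, hB₁⟩ := hχ.continuous.bounded_above_of_compact_support hχc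
  obtain ⟨B₂, hB₂⟩ := hgc.bounded_above_of_compact_support hgs
  have hm1 : MemLp (fun x => χ x • G x) 2 (volume.restrict (openDom d₁ d₂)) :=
    hG.1.of_le_mul (c := B₁) (hχ.continuous.aestronglyMeasurable.smul hG.1.1)
      (ae_of_all _ fun x => by
      rw [norm_smul]
      exact mul_le_mul_of_nonneg_right (hB₁ x) (norm_nonneg _))
  have hm2 : MemLp (fun x => u x • gradient χ x) 2 (volume.restrict (openDom d₁ d₂)) :=
    hu.of_le_mul (c := B₂) (hu.1.smul hgc.aestronglyMeasurable) (ae_of_all _ fun x => by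
      rw [norm_smul, mul_comm]
      exact mul_le_mul_of_nonneg_right (hB₂ x) (norm_nonneg _))
  refine ⟨hm1.add hm2, fun ψ hψ hψc hψD v => ?_⟩
  have hψχ : ContDiff ℝ ((⊤ : ℕ∞) : WithTop ℕ∞) fun x => χ x * ψ x := hχ.mul hψ
  -- χψ is again admissible, and the term of its derivative falling on χ becomes u∇χ.
  have hprod := hG.2 (fun x => χ x * ψ x) hψχ hψc.mul_left
    (tsupport_mul_subset_right.trans hψD) v
  have hd : ∀ x, fderiv ℝ (fun x => χ x * ψ x) x v =
      χ x * fderiv ℝ ψ x v + ψ x * fderiv ℝ χ x v := by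
    intro x
    rw [fderiv_fun_mul (hχ.differentiable (by simp) x) (hψ.differentiable (by simp) x)]
    simp
  have hdψ : Continuous fun x => fderiv ℝ ψ x v :=
    (hψ.continuous_fderiv (by simp)).clm_apply continuous_const
  have hdψc : HasCompactSupport fun x => fderiv ℝ ψ x v := hψc.fderiv_apply (𝕜 := ℝ) v
  have hdχ : Continuous fun x => fderiv ℝ χ x v :=
    (hχ.continuous_fderiv (by simp)).clm_apply continuous_const
  have i1 : Integrable (fun x => u x * (χ x * fderiv ℝ ψ x v))
      (volume.restrict (openDom d₁ d₂)) :=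
    memLp_two_mul_continuous hu (hχ.continuous.mul hdψ) hdψc.mul_left
  have i2 : Integrable (fun x => u x * (ψ x * fderiv ℝ χ x v))
      (volume.restrict (openDom d₁ d₂)) :=
    memLp_two_mul_continuous hu (hψ.continuous.mul hdχ) hψc.mul_right
  have i3 : Integrable (fun x => inner ℝ (G x) v * (χ x * ψ x))
      (volume.restrict (openDom d₁ d₂)) :=
    memLp_two_mul_continuous (hG.1.inner_const v) (hχ.continuous.mul hψ.continuous) hψc.mul_left
  simp_rw [hd, mul_add] at hprod
  rw [integral_add i1 i2] at hprod
  have e1 : ∫ x in openDom d₁ d₂, χ x * u x * fderiv ℝ ψ x v =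
      ∫ x in openDom d₁ d₂, u x * (χ x * fderiv ℝ ψ x v) :=
    integral_congr_ae (ae_of_all _ fun x => by ring)
  have e2 : ∫ x in openDom d₁ d₂, inner ℝ (χ x • G x + u x • gradient χ x) v * ψ x =
      (∫ x in openDom d₁ d₂, inner ℝ (G x) v * (χ x * ψ x)) +
        ∫ x in openDom d₁ d₂, u x * (ψ x * fderiv ℝ χ x v) := by
    rw [← integral_add i3 i2]
    refine integral_congr_ae (ae_of_all _ fun x => ?_)
    simp only [inner_add_left, inner_smul_left, hgi, conj_trivial]
    ring
  rw [e1, e2]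
  linarith

/-- Smooth cutoff functions with small gradient. -/
theorem exists_cutoff : ∃ (χ : ℕ → Euc d₁ d₂ → ℝ) (B : ℝ),
    (∀ n, ContDiff ℝ ((⊤ : ℕ∞) : WithTop ℕ∞) (χ n)) ∧ (∀ n, HasCompactSupport (χ n)) ∧
    (∀ n x, 0 ≤ χ n x ∧ χ n x ≤ 1) ∧ (∀ (n : ℕ) x, ‖x‖ ≤ n → χ n x = 1) ∧
    ∀ (n : ℕ) x, ‖gradient (χ n) x‖ ≤ B / (n + 1) := by
  let b : ContDiffBump (0 : Euc d₁ d₂) := ⟨1, 2, one_pos, one_lt_two⟩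
  obtain ⟨B, hB⟩ := (b.contDiff.continuous_fderiv (n := 1) (by simp)).bounded_above_of_compact_support
    (b.hasCompactSupport.fderiv ℝ)
  have hpos : ∀ n : ℕ, (0 : ℝ) < n + 1 := fun n => by positivity
  -- One fixed bump dilated by n + 1, which avoids dividing by zero at n = 0.
  refine ⟨fun n x => b (((n : ℝ) + 1)⁻¹ • x), B, fun n => ?_, fun n => ?_, fun n x => ?_,
    fun n x hx => ?_, fun n x => ?_⟩
  · exact b.contDiff.comp (contDiff_const_smul _)
  · exact b.hasCompactSupport.comp_smul (inv_ne_zero (hpos n).ne')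
  · exact ⟨b.nonneg, b.le_one⟩
  · refine b.one_of_mem_closedBall ?_
    rw [mem_closedBall_zero_iff, norm_smul, norm_inv, Real.norm_eq_abs, abs_of_pos (hpos n)]
    change _ ≤ (1 : ℝ)
    rw [inv_mul_le_iff₀ (hpos n)]
    linarith
  · have h1 : HasFDerivAt (b : Euc d₁ d₂ → ℝ) (fderiv ℝ b (((n : ℝ) + 1)⁻¹ • x))
        (((n : ℝ) + 1)⁻¹ • x) :=
      (b.contDiff.differentiable (n := 1) (by simp) _).hasFDerivAt
    have h2 : HasFDerivAt (fun x : Euc d₁ d₂ => ((n : ℝ) + 1)⁻¹ • x)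
        (((n : ℝ) + 1)⁻¹ • ContinuousLinearMap.id ℝ (Euc d₁ d₂)) x :=
      (((n : ℝ) + 1)⁻¹ • ContinuousLinearMap.id ℝ (Euc d₁ d₂)).hasFDerivAt
    have h3 : fderiv ℝ (fun x => b (((n : ℝ) + 1)⁻¹ • x)) x =
        ((n : ℝ) + 1)⁻¹ • fderiv ℝ b (((n : ℝ) + 1)⁻¹ • x) := by
      have := (h1.comp x h2).fderiv
      change fderiv ℝ (b ∘ fun x => ((n : ℝ) + 1)⁻¹ • x) x = _
      rw [this]
      ext v
      simp
    rw [gradient, LinearIsometryEquiv.norm_map, h3, norm_smul, norm_inv, Real.norm_eq_abs,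
      abs_of_pos (hpos n), div_eq_inv_mul]
    exact mul_le_mul_of_nonneg_left (hB _) (inv_nonneg.2 (hpos n).le)

theorem tendsto_eLpNorm_cutoff {F : Type*} [NormedAddCommGroup F] [NormedSpace ℝ F]
    {ν : Measure (Euc d₁ d₂)} {g : Euc d₁ d₂ → F} (hg : MemLp g 2 ν)
    {χ : ℕ → Euc d₁ d₂ → ℝ} (hχm : ∀ n, Continuous (χ n)) (hχ : ∀ n x, 0 ≤ χ n x ∧ χ n x ≤ 1)
    (hχ1 : ∀ (n : ℕ) x, ‖x‖ ≤ n → χ n x = 1) :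
    Tendsto (fun n => eLpNorm (fun x => (1 - χ n x) • g x) 2 ν) atTop (𝓝 0) := by
  have h1 : Tendsto (fun n => ∫⁻ x, ‖(1 - χ n x) • g x‖ₑ ^ 2 ∂ν) atTop (𝓝 (∫⁻ _, 0 ∂ν)) := by
    refine tendsto_lintegral_of_dominated_convergence' (fun x => ‖g x‖ₑ ^ 2) (fun n => ?_)
      (fun n => ae_of_all _ fun x => ?_) ?_ (ae_of_all _ fun x => ?_)
    · exact (((continuous_const.sub (hχm n)).aestronglyMeasurable.smul hg.1).enorm).pow_const 2
    · change ‖(1 - χ n x) • g x‖ₑ ^ 2 ≤ ‖g x‖ₑ ^ 2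
      gcongr
      rw [enorm_smul]
      refine mul_le_of_le_one_left zero_le ?_
      rw [Real.enorm_of_nonneg (by linarith [(hχ n x).2]), ENNReal.ofReal_le_one]
      linarith [(hχ n x).1]
    · rw [← eLpNorm_two_sq]
      exact (ENNReal.pow_lt_top hg.2).ne
    · refine tendsto_const_nhds.congr' ?_
      obtain ⟨N, hN⟩ := exists_nat_ge ‖x‖
      filter_upwards [eventually_ge_atTop N] with n hn
      rw [hχ1 n x (hN.trans (by exact_mod_cast hn))]
      simp
  rw [lintegral_zero] at h1
  simp_rw [← eLpNorm_two_sq] at h1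
  have h2 := h1.ennrpow_const (1 / 2 : ℝ)
  rw [ENNReal.zero_rpow_of_pos (by norm_num)] at h2
  refine h2.congr fun n => ?_
  rw [← ENNReal.rpow_natCast, ← ENNReal.rpow_mul]
  norm_num

/-- Cut off, then mollify. The gradient error has three parts, (1 - χ)G, u∇χ and the mollification
error, each at most ε/3; the function itself needs only two. -/
theorem exists_Cc2_approx {u : Euc d₁ d₂ → ℝ} {G : Euc d₁ d₂ → Euc d₁ d₂}
    (hu : MemLp u 2 (volume.restrict (openDom d₁ d₂))) (hG : IsWeakGrad u G)
    {ε : ℝ≥0∞} (hε : 0 < ε) :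
    ∃ f ∈ Cc2 d₁ d₂, eLpNorm (u - f) 2 (volume.restrict (openDom d₁ d₂)) ≤ ε ∧
      eLpNorm (G - gradDom f) 2 (volume.restrict (openDom d₁ d₂)) ≤ ε := by
  obtain ⟨χ, B, hχ, hχc, hχ01, hχ1, hχB⟩ := exists_cutoff (d₁ := d₁) (d₂ := d₂)
  have hε3 : 0 < ε / 3 := ENNReal.div_pos hε.ne' ENNReal.ofNat_ne_top
  have t1 := tendsto_eLpNorm_cutoff hu (fun n => (hχ n).continuous) hχ01 hχ1
  have t2 := tendsto_eLpNorm_cutoff hG.1 (fun n => (hχ n).continuous) hχ01 hχ1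
  have t3 : Tendsto (fun n : ℕ => ENNReal.ofReal (B / (n + 1)) *
      eLpNorm u 2 (volume.restrict (openDom d₁ d₂))) atTop (𝓝 0) := by
    have h1 : Tendsto (fun n : ℕ => ENNReal.ofReal (B / (n + 1))) atTop (𝓝 0) := by
      rw [← ENNReal.ofReal_zero]
      exact ENNReal.tendsto_ofReal (tendsto_const_div_atTop_nhds_zero_nat B |>.comp
        (tendsto_add_atTop_nat 1) |>.congr fun n => by simp)
    have := ENNReal.Tendsto.mul_const h1 (Or.inr hu.2.ne)
    rwa [zero_mul] at this
  obtain ⟨n, h1, h2, h3⟩ := ((t1.eventually_le_const hε3).and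
    ((t2.eventually_le_const hε3).and (t3.eventually_le_const hε3))).exists
  have hgc : Continuous (gradient (χ n)) :=
    (LinearIsometryEquiv.continuous _).comp ((hχ n).continuous_fderiv (by simp))
  have hG' := hG.mul_smooth hu (hχ n) (hχc n)
  have hu' : MemLp (fun x => χ n x * u x) 2 (volume.restrict (openDom d₁ d₂)) :=
    hu.of_le ((hχ n).continuous.aestronglyMeasurable.mul hu.1) (ae_of_all _ fun x => by
      rw [norm_mul, Real.norm_of_nonneg (hχ01 n x).1]
      exact mul_le_of_le_one_left (norm_nonneg _) (hχ01 n x).2)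
  obtain ⟨R, hR⟩ := (hχc n).isCompact.isBounded.subset_closedBall 0
  obtain ⟨f, hf, hf1, hf2⟩ := exists_Cc2_approx_of_compactSupp hu' hG' (R := R) (fun x hx => by
    rw [image_eq_zero_of_notMem_tsupport (f := χ n), zero_mul]
    intro h
    have := hR h
    rw [mem_closedBall_zero_iff] at this
    linarith) hε3
  have hfL := (Cc2.mem_W12 hf).1
  have hfG := (Cc2.isWeakGrad hf).1
  have hle : ε / 3 + ε / 3 + ε / 3 = ε := ENNReal.add_thirds ε
  refine ⟨f, hf, ?_, ?_⟩
  · have e : u - f = (fun x => (1 - χ n x) • u x) + ((fun x => χ n x * u x) - f) := by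
      ext x
      simp only [Pi.sub_apply, Pi.add_apply, smul_eq_mul]
      ring
    rw [e]
    refine (eLpNorm_add_le ((continuous_const.sub (hχ n).continuous).aestronglyMeasurable.smul hu.1)
      (hu'.sub hfL).1 one_le_two).trans ?_
    calc _ ≤ ε / 3 + ε / 3 := add_le_add h1 hf1
      _ ≤ ε / 3 + ε / 3 + ε / 3 := le_self_add
      _ = ε := hle
  · have e : G - gradDom f = ((fun x => (1 - χ n x) • G x) - fun x => u x • gradient (χ n) x) +
        ((fun x => χ n x • G x + u x • gradient (χ n) x) - gradDom f) := by
      ext1 x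
      simp only [Pi.sub_apply, Pi.add_apply, sub_smul, one_smul]
      abel
    have m1 : AEStronglyMeasurable (fun x => (1 - χ n x) • G x)
        (volume.restrict (openDom d₁ d₂)) :=
      (continuous_const.sub (hχ n).continuous).aestronglyMeasurable.smul hG.1.1
    have m2 : AEStronglyMeasurable (fun x => u x • gradient (χ n) x)
        (volume.restrict (openDom d₁ d₂)) := hu.1.smul hgc.aestronglyMeasurable
    have h4 : eLpNorm (fun x => u x • gradient (χ n) x) 2 (volume.restrict (openDom d₁ d₂)) ≤
        ε / 3 := by
      refine le_trans (eLpNorm_le_mul_eLpNorm_of_ae_le_mul (ae_of_all _ fun x => ?_) 2) h3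
      rw [norm_smul, mul_comm]
      exact mul_le_mul_of_nonneg_right (hχB n x) (norm_nonneg _)
    rw [e]
    refine (eLpNorm_add_le (m1.sub m2) (hG'.1.sub hfG).1 one_le_two).trans ?_
    calc _ ≤ (ε / 3 + ε / 3) + ε / 3 :=
          add_le_add ((eLpNorm_sub_le m1 m2 one_le_two).trans (add_le_add h2 h4)) hf2
      _ = ε := hle

end

noncomputable section

variable {d₁ d₂ : ℕ}

/-! ### The core property -/

theorem integral_norm_sq_le_of_eLpNorm_le {α F : Type*} [MeasurableSpace α]
    [NormedAddCommGroup F] {ν : Measure α} {h : α → F} (hh : MemLp h 2 ν) {η : ℝ} (hη : 0 ≤ η)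
    (hle : eLpNorm h 2 ν ≤ ENNReal.ofReal η) : ∫ x, ‖h x‖ ^ 2 ∂ν ≤ η ^ 2 := by
  rw [integral_eq_lintegral_of_nonneg_ae (ae_of_all _ fun x => sq_nonneg _) (hh.1.norm.pow 2)]
  refine ENNReal.toReal_le_of_le_ofReal (sq_nonneg η) ?_
  rw [ENNReal.ofReal_pow hη]
  refine le_trans (le_of_eq ?_) (pow_le_pow_left₀ zero_le hle 2)
  rw [eLpNorm_two_sq]
  exact lintegral_congr fun x => by rw [ENNReal.ofReal_pow (norm_nonneg _), ofReal_norm]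

theorem exists_Cc2_uniform_approx {g : Euc d₁ d₂ → ℝ} (hg : ContinuousOn g (closedDom d₁ d₂))
    (hgc : CompactSuppOn g) {ε : ℝ} (hε : 0 < ε) :
    ∃ f ∈ Cc2 d₁ d₂, ∀ x ∈ closedDom d₁ d₂, |g x - f x| < ε := by
  obtain ⟨R, hR⟩ := hgc
  obtain ⟨χ, -, hχ, hχc, -, hχ1, -⟩ := exists_cutoff (d₁ := d₁) (d₂ := d₂)
  obtain ⟨n, hn⟩ := exists_nat_ge R
  -- Composing with the projection extends g continuously to ℝ^d and the cutoff restores compact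
  -- support, so an ordinary symmetric mollifier suffices for uniform approximation.
  let h : Euc d₁ d₂ → ℝ := fun x => χ n x * g (projDom x)
  have hc : Continuous h := (hχ n).continuous.mul
    (hg.comp_continuous continuous_projDom projDom_mem)
  have hs : HasCompactSupport h := (hχc n).mul_right
  have heq : ∀ x ∈ closedDom d₁ d₂, h x = g x := by
    intro x hx
    simp only [h]
    rw [projDom_of_mem hx]
    rcases le_or_gt ‖x‖ n with h1 | h1
    · rw [hχ1 n x h1, one_mul]
    · rw [hR x hx (hn.trans_lt h1), mul_zero]
  obtain ⟨δ, hδ, hunif⟩ := Metric.uniformContinuous_iff.1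
    (hs.uniformContinuous_of_continuous hc) (ε / 2) (by positivity)
  let b : ContDiffBump (0 : Euc d₁ d₂) := ⟨δ / 2, δ, by positivity, by linarith⟩
  refine ⟨convolution (b.normed volume) h (ContinuousLinearMap.lsmul ℝ ℝ) volume,
    mem_Cc2_of_contDiff ?_ (b.hasCompactSupport_normed.convolution _ hs), fun x hx => ?_⟩
  · exact b.hasCompactSupport_normed.contDiff_convolution_left _ b.contDiff_normed
      hc.locallyIntegrable
  · have h1 := ContDiffBump.dist_normed_convolution_le (φ := b) (μ := volume) (g := h) (x₀ := x)
      (ε := ε / 2) hc.aestronglyMeasurable fun y hy => (hunif hy).le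
    rw [← heq x hx, abs_sub_comm]
    rw [Real.dist_eq] at h1
    linarith

theorem isCore_Cc2 {A : Euc d₁ d₂ → Matrix (Fin d₁ ⊕ Fin d₂) (Fin d₁ ⊕ Fin d₂) ℝ}
    (hA : IsElliptic A) : IsCore A (Cc2 d₁ d₂) where
  subset f hf := ⟨Cc2.mem_W12 hf, hf.1.continuousOn, hf.2⟩
  dense_form u hu ε hε := by
    obtain ⟨-, -, c, hc, hAc⟩ := hA
    obtain ⟨huL, G, hG⟩ := hu
    -- With η² = ε/(c + 2) the total (c/2)η² + η² is ε/2, strictly below ε.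
    have hη : 0 < √(ε / (c + 2)) := Real.sqrt_pos.2 (by positivity)
    obtain ⟨f, hf, h1, h2⟩ := exists_Cc2_approx huL hG (ENNReal.ofReal_pos.2 hη)
    have hfW := Cc2.isWeakGrad hf
    have hfL := (Cc2.mem_W12 hf).1
    refine ⟨f, hf, ?_⟩
    have e1 := refForm_le hc hAc (hG.sub huL hfL hfW)
    have e2 := integral_norm_sq_le_of_eLpNorm_le (hG.1.sub hfW.1) hη.le h2
    have e3 := integral_norm_sq_le_of_eLpNorm_le (huL.sub hfL) hη.le h1
    simp only [Pi.sub_apply, Real.norm_eq_abs, sq_abs] at e3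
    rw [Real.sq_sqrt (by positivity)] at e2 e3
    have e4 := mul_le_mul_of_nonneg_left e2 (by positivity : 0 ≤ c / 2)
    have e5 : c / 2 * (ε / (c + 2)) + ε / (c + 2) = ε / 2 := by
      field_simp
    linarith
  dense_unif g hg hgc ε hε := exists_Cc2_uniform_approx hg hgc hε

theorem gradEnergy_eq_ofReal {f : Euc d₁ d₂ → ℝ} (hf : f ∈ Cc2 d₁ d₂) :
    gradEnergy f = ENNReal.ofReal (∫ x in openDom d₁ d₂, ‖gradDom f x‖ ^ 2) := by
  have hG := (Cc2.isWeakGrad hf).1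
  rw [ofReal_integral_eq_lintegral_ofReal
    ((memLp_two_iff_integrable_sq_norm hG.1).1 hG) (ae_of_all _ fun x => sq_nonneg _),
    gradEnergy, ae_restrict_openDom_eq]
  refine lintegral_congr fun x => ?_
  rw [ENNReal.ofReal_pow (norm_nonneg _), norm_gradDom, ofReal_norm]

theorem IsSubseqLimit.toDbar_mem_limitDomain {w : Env d₁ d₂} {φ : ℕ → ℕ}
    {m : Measure (Dbar d₁ d₂)} {X : Kernel (Dbar d₁ d₂) (CadlagPath (Dbar d₁ d₂))}
    (h : IsSubseqLimit w φ m X) {f : Euc d₁ d₂ → ℝ} (hf : f ∈ Cc2 d₁ d₂)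
    (hfin : limsup (fun n => discreteEnergy w n (toDbar f)) atTop < ⊤) :
    toDbar f ∈ limitDomain m X := by
  have hm := h.locallyFinite
  have hc := continuous_toDbar hf.1.continuousOn
  have hs := hasCompactSupport_toDbar hf.2
  exact ⟨hc.memLp_of_hasCompactSupport hs, (h.limitEnergy_le hc hs).trans_lt hfin⟩

end

/-! ### The main theorem. -/

theorem proposition3 {Ω : Type*} [MeasurableSpace Ω] (P : Measure Ω) [IsProbabilityMeasure P]
    (d₁ d₂ : ℕ) (μ : (latGraph d₁ d₂).edgeSet → Ω → ℝ≥0)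
    (hmeas : ∀ e, Measurable (μ e)) (hindep : iIndepFun μ P)
    (hident : ∀ e e', IdentDistrib (μ e) (μ e') P P)
    (C₀ : ℝ≥0) (hC₀ : ∀ e, ∫⁻ ω, (μ e ω : ℝ≥0∞) ∂P = C₀) :
    (∀ᵐ ω ∂P, ∀ f ∈ Cc2 d₁ d₂,
      (∀ φ m X, IsSubseqLimit (fun e => μ e ω) φ m X →
        toDbar f ∈ limitDomain m X ∧
        limitEnergy m X (toDbar f) ≤
          limsup (fun n => discreteEnergy (fun e => μ e ω) n (toDbar f)) atTop) ∧
      limsup (fun n => discreteEnergy (fun e => μ e ω) n (toDbar f)) atTop ≤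
        C₀ * gradEnergy f) ∧
    (∀ A : Euc d₁ d₂ → Matrix (Fin d₁ ⊕ Fin d₂) (Fin d₁ ⊕ Fin d₂) ℝ, IsElliptic A →
      IsCore A (Cc2 d₁ d₂) ∧
      ∃ C : ℝ, 1 ≤ C ∧ ∀ᵐ ω ∂P, ∀ φ m X, IsSubseqLimit (fun e => μ e ω) φ m X →
        ∀ f ∈ Cc2 d₁ d₂, toDbar f ∈ limitDomain m X ∧
          limitEnergy m X (toDbar f) ≤ ENNReal.ofReal (C * refForm A f f)) := by
  have hlim := ae_limsup_discreteEnergy_le hmeas hindep hident hC₀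
  have hmain : ∀ᵐ ω ∂P, ∀ f ∈ Cc2 d₁ d₂,
      (∀ φ m X, IsSubseqLimit (fun e => μ e ω) φ m X →
        toDbar f ∈ limitDomain m X ∧
        limitEnergy m X (toDbar f) ≤
          limsup (fun n => discreteEnergy (fun e => μ e ω) n (toDbar f)) atTop) ∧
      limsup (fun n => discreteEnergy (fun e => μ e ω) n (toDbar f)) atTop ≤
        C₀ * gradEnergy f := by
    filter_upwards [hlim] with ω hω f hf
    refine ⟨fun φ m X h => ⟨h.toDbar_mem_limitDomain hf ((hω f hf).trans_lt
      (ENNReal.mul_lt_top ENNReal.coe_lt_top (gradEnergy_lt_top hf))), ?_⟩, hω f hf⟩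
    exact h.limitEnergy_le (continuous_toDbar hf.1.continuousOn) (hasCompactSupport_toDbar hf.2)
  refine ⟨hmain, fun A hA => ⟨isCore_Cc2 hA, ?_⟩⟩
  obtain ⟨hAm, -, c, hc, hAc⟩ := hA
  -- From C₀ ∫ |∇f|² ≤ 2cC₀ ℰ(f, f): the 2 undoes the 1/2 in the reference form and c is the
  -- ellipticity constant. The maximum only ensures C ≥ 1.
  refine ⟨max 1 (2 * c * C₀), le_max_left _ _, ?_⟩
  filter_upwards [hmain] with ω hω φ m X h f hf
  obtain ⟨h1, h2⟩ := hω f hf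
  obtain ⟨h3, h4⟩ := h1 φ m X h
  refine ⟨h3, (h4.trans h2).trans ?_⟩
  have h5 := le_refForm hc hAm hAc (Cc2.isWeakGrad hf)
  have h6 : 0 ≤ ∫ x in openDom d₁ d₂, ‖gradDom f x‖ ^ 2 :=
    integral_nonneg fun x => sq_nonneg _
  have h7 : 0 ≤ refForm A f f := nonneg_of_mul_nonneg_right (h6.trans h5) (by positivity)
  rw [gradEnergy_eq_ofReal hf, ← ENNReal.ofReal_coe_nnreal,
    ← ENNReal.ofReal_mul (NNReal.coe_nonneg C₀)]
  refine ENNReal.ofReal_le_ofReal ?_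
  calc (C₀ : ℝ) * ∫ x in openDom d₁ d₂, ‖gradDom f x‖ ^ 2
      ≤ C₀ * (2 * c * refForm A f f) := mul_le_mul_of_nonneg_left h5 (NNReal.coe_nonneg C₀)
    _ = 2 * c * C₀ * refForm A f f := by ring
    _ ≤ max 1 (2 * c * C₀) * refForm A f f :=
        mul_le_mul_of_nonneg_right (le_max_right _ _) h7
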